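/- **Setting.** Let $\mathfrak K:\mathbb R^2\to[0,1]$ be $\mathcal C^2$, rotation invariant, with compact support contained in the open ball $B(0,3)$, $\int\mathfrak K(x)\,dx=1$ and $\int \mathfrak K(x)|x|^2\,dx=4$. For $0<\gamma<\frac13$ put $N=\lfloor\gamma^{-2}\rfloor$, $\varepsilon=\frac{2}{2N+1}$, $\alpha=\gamma^2$, $\delta=\gamma$, and $\Lambda_N=\mathbb Z^2/(2N+1)\mathbb Z^2$, identified with $\{-N,\dots,N\}^2$. Let $\kappa_\gamma(0)=0$ and $\kappa_\gamma(k)=\mathfrak c\,\gamma^2\mathfrak K(\gamma k)$ for $k\in\Lambda_N\setminus\{0\}$, where $\mathfrak c^{-1}=\sum_{k\ne0}\gamma^2\mathfrak K(\gamma k)$. For $\sigma\in\Sigma_N=\{-1,1\}^{\Lambda_N}$ let $h_\gamma(\sigma,k)=\sum_{j}\kappa_\gamma(k-j)\sigma(j)$ and, for $\beta\in\mathbb R$, let $\lambda(\sigma)\propto\exp\big(\tfrac\beta2\sum_{k,j}\kappa_\gamma(k-j)\sigma(j)\sigma(k)\big)$ be the Gibbs measure. Let $(\sigma(t))_{t\ge0}$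 be a pure jump Markov process on $\Sigma_N$, with arbitrary initial law, right-continuous paths with left limits, and generator $$\mathcal L f(\sigma)=\sum_{j\in\Lambda_N}\frac{\lambda(\sigma^j)}{\lambda(\sigma)+\lambda(\sigma^j)}\big(f(\sigma^j)-f(\sigma)\big),$$ where $\sigma^j$ is $\sigma$ with the spin at $j$ flipped. Set $m_\gamma(t,k)=h_\gamma(\sigma(t),k)-h_\gamma(\sigma(0),k)-\int_0^t(\mathcal L h_\gamma(\cdot,k))(\sigma(s))\,ds$. On $\Lambda_\varepsilon=\{\varepsilon k:k\in\Lambda_N\}$ (with periodic subtraction) set $M_\gamma(t,x)=\delta^{-1}m_\gamma(t/\alpha,x/\varepsilon)$ and $K_\gamma(x)=\varepsilon^{-2}\kappa_\gamma(x/\varepsilon)$. For a deterministic $F:[0,\infty)^n\times\Lambda_\varepsilon^n\to\mathbb R$ that is left-continuous in each time variable and bounded on bounded sets of times, define recursively $I_0F=F$ and $$I_nF(t)=\int_{(0,t]}\sum_{y\in\Lambda_\varepsilon}\varepsilon^2\,I_{n-1}F^{(r,y)}(r^-)\,dM_\gamma(r,y),$$ a pathwise Lebesgue–Stieltjes integral,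 where $F^{(r,y)}(r_2,\dots,r_n,y_2,\dots,y_n)=F(r,r_2,\dots,r_n,y,y_2,\dots,y_n)$ and $I_{n-1}F^{(r,y)}(r^-)$ is the left limit at $r$ of $s\mapsto I_{n-1}F^{(s,y)}(s)$ (so that $I_1F(t)=\int_{(0,t]}\sum_y\varepsilon^2F(r,y)\,dM_\gamma(r,y)$). For $1\le\ell\le n$ let $$F_\ell(r_1,\dots,r_n,z_1,\dots,z_\ell,y_{\ell+1},\dots,y_n)=\sum_{y_1,\dots,y_\ell\in\Lambda_\varepsilon}\varepsilon^{2\ell}F(r_1,\dots,r_n,y_1,\dots,y_n)\prod_{i=1}^\ell K_\gamma(y_i-z_i),$$ and let $I_{n-\ell}F_\ell(\mathbf r_\ell,\mathbf z_\ell)$, with $\mathbf r_\ell=(r_1,\dots,r_\ell)$ and $\mathbf z_\ell=(z_1,\dots,z_\ell)$, denote the iterated integral in the variables $r_{\ell+1},\dots,r_n,y_{\ell+1},\dots,y_n$, evaluated at time $r_\ell$, with $\mathbf r_\ell,\mathbf z_\ell$ treated as fixed parameters. **Lemma.** Let $n\ge1$ and $p\ge2$. There exists a constant $C=C(n,p)$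 such that for all $\mathfrak K$, $\gamma$, $\beta$, $(\sigma(t))_{t\ge 0}$ and $F$ as above and all $t\ge0$, $$\Big(\mathbb E\sup_{0\le r\le t}|I_nF(r)|^p\Big)^{2/p}\le C\int_{r_1=0}^t\!\cdots\!\int_{r_n=0}^{r_{n-1}}\sum_{\mathbf z\in\Lambda_\varepsilon^n}\varepsilon^{2n}F_n(\mathbf r,\mathbf z)^2\,d\mathbf r+\mathsf{Err}_n,$$ where, with $r_0=t$, $$\mathsf{Err}_n=C\,\varepsilon^4\delta^{-2}\sum_{\ell=1}^n\int_{r_1=0}^t\!\cdots\!\int_{r_{\ell-1}=0}^{r_{\ell-2}}\sum_{z_1,\dots,z_{\ell-1}\in\Lambda_\varepsilon}\varepsilon^{2(\ell-1)}\Big(\mathbb E\sup_{\substack{0\le r_\ell\le r_{\ell-1}\\ z_\ell\in\Lambda_\varepsilon}}\big|I_{n-\ell}F_\ell(\mathbf r_\ell,\mathbf z_\ell)\big|^p\Big)^{2/p}dr_{\ell-1}\cdots dr_1$$ (for $\ell=1$ there is no time integral and no sum over $z$). -/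

import Mathlib

open MeasureTheory Filter Topology Set
open scoped ENNReal NNReal

noncomputable section

namespace IsingKac

/-! ### The Ising-Kac model on the discrete torus -/

/-- The discrete torus `ℤ² / (2N+1)ℤ²`. Coordinates are identified with `{-N, …, N}` through
`ZMod.valMinAbs`. -/
abbrev Torus (N : ℕ) : Type := ZMod (2 * N + 1) × ZMod (2 * N + 1)

/-- Spin configurations: functions on the torus with values in `{1, -1} = ℤˣ`. -/
abbrev Config (N : ℕ) : Type := Torus N → ℤˣ

/-- The point `γ k ∈ ℝ²`, where `k` is represented in `{-N, …, N}²`. -/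
def scaledPoint (γ : ℝ) {N : ℕ} (k : Torus N) : EuclideanSpace ℝ (Fin 2) :=
  !₂[γ * (k.1.valMinAbs : ℝ), γ * (k.2.valMinAbs : ℝ)]

/-- Assumptions on the profile `𝔎 : ℝ² → [0,1]` of the interaction. -/
structure IsProfile (𝔎 : EuclideanSpace ℝ (Fin 2) → ℝ) : Prop where
  mem_Icc : ∀ x, 𝔎 x ∈ Icc (0 : ℝ) 1
  contDiff : ContDiff ℝ 2 𝔎
  support : tsupport 𝔎 ⊆ Metric.ball 0 3
  rotation_invariant : ∀ x y, ‖x‖ = ‖y‖ → 𝔎 x = 𝔎 y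
  integral_eq_one : ∫ x, 𝔎 x = 1
  second_moment : ∫ x, 𝔎 x * ‖x‖ ^ 2 = 4

/-- The normalisation constant, `(∑_{k ≠ 0} γ² 𝔎(γ k))⁻¹`. -/
def kacConst (𝔎 : EuclideanSpace ℝ (Fin 2) → ℝ) (γ : ℝ) (N : ℕ) : ℝ :=
  (∑ k ∈ (Finset.univ : Finset (Torus N)).erase 0, γ ^ 2 * 𝔎 (scaledPoint γ k))⁻¹

/-- The microscopic interaction kernel `κ_γ`. -/
def kac (𝔎 : EuclideanSpace ℝ (Fin 2) → ℝ) (γ : ℝ) (N : ℕ) (k : Torus N) : ℝ :=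
  if k = 0 then 0 else kacConst 𝔎 γ N * γ ^ 2 * 𝔎 (scaledPoint γ k)

/-- The spin at a site as a real number. -/
def spin {N : ℕ} (η : Config N) (k : Torus N) : ℝ := ((η k : ℤ) : ℝ)

/-- The locally averaged field `h(η, k) = ∑_j κ(k - j) η(j)`. -/
def localField {N : ℕ} (κ : Torus N → ℝ) (η : Config N) (k : Torus N) : ℝ :=
  ∑ j, κ (k - j) * spin η j

def hamiltonian {N : ℕ} (κ : Torus N → ℝ) (η : Config N) : ℝ :=
  -(1 / 2) * ∑ k, ∑ j, κ (k - j) * spin η j * spin η k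

/-- The Gibbs measure at inverse temperature `β` (its probability mass function). -/
def gibbs {N : ℕ} (β : ℝ) (κ : Torus N → ℝ) (η : Config N) : ℝ :=
  Real.exp (-β * hamiltonian κ η) / ∑ η' : Config N, Real.exp (-β * hamiltonian κ η')

/-- The configuration `η^j`, with the spin at `j` flipped. -/
def flip {N : ℕ} (η : Config N) (j : Torus N) : Config N := Function.update η j (-η j)

/-- Jump rates of the Glauber dynamics. -/
def rate {N : ℕ} (β : ℝ) (κ : Torus N → ℝ) (η : Config N) (j : Torus N) : ℝ :=
  gibbs β κ (flip η j) / (gibbs β κ η + gibbs β κ (flip η j))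

/-- The generator `L f(η) = ∑_j c(η, j) (f(η^j) - f(η))`. -/
def generator {N : ℕ} (β : ℝ) (κ : Torus N → ℝ) : (Config N → ℝ) →ₗ[ℝ] (Config N → ℝ) where
  toFun f η := ∑ j, rate β κ η j * (f (flip η j) - f η)
  map_add' f g := by
    funext η
    simp only [Pi.add_apply, ← Finset.sum_add_distrib]
    exact Finset.sum_congr rfl fun j _ => by ring
  map_smul' c f := by
    funext η
    simp only [Pi.smul_apply, smul_eq_mul, RingHom.id_apply, Finset.mul_sum]
    exact Finset.sum_congr rfl fun j _ => by ring

/-- The Markov semigroup `e^{tL}` on functions of the (finite) configuration space. -/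
def semigroup {N : ℕ} (β : ℝ) (κ : Torus N → ℝ) (t : ℝ) :
    (Config N → ℝ) →L[ℝ] (Config N → ℝ) :=
  NormedSpace.exp (t • LinearMap.toContinuousLinearMap (generator β κ))

/-- The `σ`-algebra generated by the process up to time `t`. -/
abbrev past {Ω : Type*} {N : ℕ} (σ : ℝ → Ω → Config N) (t : ℝ) : MeasurableSpace Ω :=
  ⨆ s ∈ Icc (0 : ℝ) t, MeasurableSpace.comap (σ s) ⊤

/-- `σ` is a (pure jump) Markov process with generator `L`: its paths are right-continuous with
left limits in the discrete space of configurations, and its transition semigroup is `e^{tL}`.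
The initial law is arbitrary. Only times `t ≥ 0` matter. -/
structure IsGlauberDynamics {Ω : Type*} [MeasurableSpace Ω] (P : Measure Ω) {N : ℕ}
    (β : ℝ) (κ : Torus N → ℝ) (σ : ℝ → Ω → Config N) : Prop where
  measurable : ∀ t, 0 ≤ t → ∀ η : Config N, MeasurableSet {ω | σ t ω = η}
  right_continuous : ∀ ω t, 0 ≤ t → ∀ᶠ s in 𝓝[>] t, σ s ω = σ t ω
  left_limits : ∀ ω t, 0 < t → ∃ η : Config N, ∀ᶠ s in 𝓝[<] t, σ s ω = η
  markov : ∀ s t, 0 ≤ s → 0 ≤ t → ∀ f : Config N → ℝ,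
    P[fun ω => f (σ (s + t) ω) | past σ s] =ᵐ[P] fun ω => semigroup β κ t f (σ s ω)

/-- The microscopic martingale
`m(t, k) = h(σ(t), k) - h(σ(0), k) - ∫₀ᵗ L h(σ(s), k) ds`, along a fixed path `σ`. -/
def microMartingale {N : ℕ} (β : ℝ) (κ : Torus N → ℝ) (σ : ℝ → Config N) (t : ℝ)
    (k : Torus N) : ℝ :=
  localField κ (σ t) k - localField κ (σ 0) k
    - ∫ s in (0 : ℝ)..t, generator β κ (fun η => localField κ η k) (σ s)

/-! ### Rescaling

The macroscopic lattice `Λ_ε = {ε k}` is indexed by the microscopic points `k` of the torus. -/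

/-- `N = ⌊γ⁻²⌋`. -/
def sysSize (γ : ℝ) : ℕ := ⌊(γ ^ 2)⁻¹⌋₊

/-- `ε = 2 / (2N + 1)`. -/
def eps (γ : ℝ) : ℝ := 2 / (2 * (sysSize γ : ℝ) + 1)

/-- The time scaling `α = γ²`. -/
def alpha (γ : ℝ) : ℝ := γ ^ 2

/-- The amplitude scaling `δ = γ`. -/
def delta (γ : ℝ) : ℝ := γ

/-- The rescaled kernel `K_γ(ε k) = ε⁻² κ_γ(k)`. -/
def Kg (𝔎 : EuclideanSpace ℝ (Fin 2) → ℝ) (γ : ℝ) (k : Torus (sysSize γ)) : ℝ :=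
  (eps γ ^ 2)⁻¹ * kac 𝔎 γ (sysSize γ) k

/-- The rescaled martingale `M_γ(t, ε k) = δ⁻¹ m_γ(t / α, k)`, along a fixed path `σ`. -/
def macroMartingale (𝔎 : EuclideanSpace ℝ (Fin 2) → ℝ) (γ β : ℝ)
    (σ : ℝ → Config (sysSize γ)) (t : ℝ) (k : Torus (sysSize γ)) : ℝ :=
  (delta γ)⁻¹ * microMartingale β (kac 𝔎 γ (sysSize γ)) σ (t / alpha γ) k

/-! ### Iterated integrals -/

open scoped Classical in
/-- The Lebesgue-Stieltjes integral `∫_{(0,t]} g(s) dm(s)` for a path `m : [0, ∞) → ℝ` of bounded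
variation on `[0, t]`. The signed measure `dm` is that of the path stopped at times `0` and `t`. -/
def stieltjesIntegral (m g : ℝ → ℝ) (t : ℝ) : ℝ :=
  if h : BoundedVariationOn (fun s => m (max 0 (min s t))) univ then
    ∫ᵛ s in Ioc 0 t, g s ∂•h.vectorMeasure
  else 0

/-- Kernels in `n` time and `n` space variables. -/
abbrev TimeSpaceKernel (N n : ℕ) : Type := (Fin n → ℝ) → (Fin n → Torus N) → ℝ

/-- The kernel `F^{(r,y)}`, in which the first time and space variables are frozen. -/
def freezeFirst {N n : ℕ} (F : TimeSpaceKernel N (n + 1)) (r : ℝ) (y : Torus N) :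
    TimeSpaceKernel N n :=
  fun rs ys => F (Fin.cons r rs) (Fin.cons y ys)

/-- The iterated integral `I_n F(t)` against a family of paths `M(·, y)` of finite variation:
`I_0 F = F` and
`I_n F(t) = ∫_{(0,t]} ∑_y ε² I_{n-1} F^{(r,y)}(r⁻) dM(r, y)`,
the integrand being the left limit at `r` of `s ↦ I_{n-1} F^{(s,y)}(s)`. For `n = 1` and `F`
left-continuous this left limit is `F(r, y)`. -/
def iteratedIntegral {N : ℕ} (ε : ℝ) (M : ℝ → Torus N → ℝ) :
    (n : ℕ) → TimeSpaceKernel N n → ℝ → ℝ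
  | 0, F, _ => F Fin.elim0 Fin.elim0
  | n + 1, F, t => ∑ y : Torus N, ε ^ 2 *
      stieltjesIntegral (fun s => M s y)
        (Function.leftLim (fun s => iteratedIntegral ε M n (freezeFirst F s y) s)) t

/-- `F_ℓ`: the convolution of `F` with `K` in the first `ℓ` space variables,
`F_ℓ(r, z_1, …, z_ℓ, y_{ℓ+1}, …, y_n) = ∑_{y_1, …, y_ℓ} ε^{2ℓ} F(r, y) ∏_{i ≤ ℓ} K(y_i - z_i)`. -/
def convFirst {N n : ℕ} (ε : ℝ) (K : Torus N → ℝ) (ℓ : ℕ) (hℓ : ℓ ≤ n)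
    (F : TimeSpaceKernel N n) : TimeSpaceKernel N n :=
  fun r z => ∑ y : Fin ℓ → Torus N,
    ε ^ (2 * ℓ) * F r (fun i => if h : (i : ℕ) < ℓ then y ⟨i, h⟩ else z i)
      * ∏ i : Fin ℓ, K (y i - z (Fin.castLE hℓ i))

/-- The kernel in the last `n - ℓ` time and space variables obtained from `G` by freezing the first
`ℓ` times to `r` and the first `ℓ` points to `z`. -/
def freezeMany {N n : ℕ} (ℓ : ℕ) (hℓ : ℓ ≤ n) (G : TimeSpaceKernel N n)
    (r : Fin ℓ → ℝ) (z : Fin ℓ → Torus N) : TimeSpaceKernel N (n - ℓ) :=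
  fun rs ys =>
    G (fun i => Fin.append r rs (Fin.cast (Nat.add_sub_cancel' hℓ).symm i))
      (fun i => Fin.append z ys (Fin.cast (Nat.add_sub_cancel' hℓ).symm i))

/-- `F` is left-continuous on `[0, ∞)` in each of its time variables separately. -/
def LeftContinuousInTimes {N n : ℕ} (F : TimeSpaceKernel N n) : Prop :=
  ∀ (r : Fin n → ℝ) (y : Fin n → Torus N), (∀ i, 0 ≤ r i) → ∀ i,
    ContinuousWithinAt (fun s => F (Function.update r i s) y) (Icc 0 (r i)) (r i)

/-- `F` is bounded on bounded sets of times. -/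
def LocallyBounded {N n : ℕ} (F : TimeSpaceKernel N n) : Prop :=
  ∀ T : ℝ, ∃ B : ℝ, ∀ (r : Fin n → ℝ) (y : Fin n → Torus N),
    (∀ i, r i ∈ Icc 0 T) → |F r y| ≤ B

/-- `∫_{r_1=0}^{t} ∫_{r_2=0}^{r_1} … ∫_{r_k=0}^{r_{k-1}} G(r_1, …, r_k) dr_k … dr_1`, for
`G ≥ 0`; it is `G` itself if `k = 0`. -/
def simplexIntegral : (k : ℕ) → ℝ → ((Fin k → ℝ) → ℝ≥0∞) → ℝ≥0∞
  | 0, _, G => G Fin.elim0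
  | k + 1, t, G => ∫⁻ r in Ioc 0 t, simplexIntegral k r (fun rs => G (Fin.cons r rs))

/-- The last of the times `t, r_1, …, r_k`. -/
def lastTime {k : ℕ} (t : ℝ) (r : Fin k → ℝ) : ℝ :=
  (Fin.cons t r : Fin (k + 1) → ℝ) (Fin.last k)

/-- The process `I_n F` for the martingales `M_γ`. -/
def itInt {Ω : Type*} (𝔎 : EuclideanSpace ℝ (Fin 2) → ℝ) (γ β : ℝ)
    (σ : ℝ → Ω → Config (sysSize γ)) (n : ℕ) (F : TimeSpaceKernel (sysSize γ) n)
    (t : ℝ) (ω : Ω) : ℝ :=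
  iteratedIntegral (eps γ) (macroMartingale 𝔎 γ β (fun s => σ s ω)) n F t

/-- `∫_{r_1=0}^{t} … ∫_{r_n=0}^{r_{n-1}} ∑_z ε^{2n} F_n(r, z)² dr`. -/
def mainTerm (𝔎 : EuclideanSpace ℝ (Fin 2) → ℝ) (γ : ℝ) (n : ℕ)
    (F : TimeSpaceKernel (sysSize γ) n) (t : ℝ) : ℝ≥0∞ :=
  simplexIntegral n t fun r => ENNReal.ofReal
    (∑ z : Fin n → Torus (sysSize γ),
      eps γ ^ (2 * n) * convFirst (eps γ) (Kg 𝔎 γ) n le_rfl F r z ^ 2)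

/-- The sum over `ℓ = k + 1` from `1` to `n` of
`∫_{r_1=0}^{t} … ∫_{r_{ℓ-1}=0}^{r_{ℓ-2}} ∑_{z_1, …, z_{ℓ-1}} ε^{2(ℓ-1)}
  (E sup_{0 ≤ r_ℓ ≤ r_{ℓ-1}, z_ℓ} |I_{n-ℓ} F_ℓ(r_1, …, r_ℓ; z_1, …, z_ℓ)|^p)^{2/p} dr`,
where `r_0 = t` and `I_{n-ℓ} F_ℓ(r_1, …, r_ℓ; z_1, …, z_ℓ)` is evaluated at time `r_ℓ`. -/
def errorSum {Ω : Type*} [MeasurableSpace Ω] (P : Measure Ω)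
    (𝔎 : EuclideanSpace ℝ (Fin 2) → ℝ) (γ β : ℝ) (σ : ℝ → Ω → Config (sysSize γ))
    (p : ℝ) (n : ℕ) (F : TimeSpaceKernel (sysSize γ) n) (t : ℝ) : ℝ≥0∞ :=
  ∑ k : Fin n, simplexIntegral k t fun r =>
    ∑ z : Fin k → Torus (sysSize γ), ENNReal.ofReal (eps γ ^ (2 * (k : ℕ))) *
      (∫⁻ ω, ⨆ s ∈ Icc 0 (lastTime t r), ⨆ x : Torus (sysSize γ),
        ‖itInt 𝔎 γ β σ (n - (k + 1))
          (freezeMany (k + 1) k.isLt (convFirst (eps γ) (Kg 𝔎 γ) (k + 1) k.isLt F)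
            (Fin.snoc (α := fun _ => ℝ) r s)
            (Fin.snoc (α := fun _ => Torus (sysSize γ)) z x)) s ω‖ₑ ^ p ∂P) ^ (2 / p)

end IsingKac

end

namespace IsingKac

/-! ### Elementary inequalities for powers -/

/-! The integrals are peeled off from the outside, by induction on n. Let G(s,y) be the left limit
at s of I_{n-1}F^{(s,y)}. When the spin at z flips, the outermost integral jumps by ±b (K*G)(s,z)
with b = 2δ⁻¹ε², and on the macroscopic time scale a flip has rate at most a = α⁻¹
(`jumpBound_macro`). A Burkholder inequality for such a jump martingale bounds the square of the L^p
norm of its running maximum, up to a constant, by ∫ ∑_z a b² ‖(K*G)(s,z)‖_p² ds + b² ‖sup_{s,z}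
|K*G|‖_p², which is `IsMarkovJump.supMoment_succ_le`. By linearity (`conv_diagIntegral`) K*G is the
left-limit integrand of the kernel convolved in its first space variable. The first term is
therefore handled by the induction hypothesis with (s,z) frozen, and the second is the error term ℓ
= 1; the errors of the lower integral become those with larger ℓ (`IsMarkovJump.supMoment_le`). The
scaling gives ab² ≤ 8ε² and b² = 4ε⁴δ⁻².

The Burkholder inequality is obtained by discretising time, without a continuous-time stochastic
calculus. For a discrete martingale, a pathwise Doob inequality (`partialSups_abs_rpow_le`) and the
second-order expansion of |x+d|^p (`abs_add_rpow_le`) bound the p-th moment X of the maximum by the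
sum of E[|x_k|^{p-2} d_k²] + E|d_k|^p. Over a time step h the conditional q-th moment of an
increment is h times the generator applied to the q-th power of the jump, up to O(h²)
(`IsMarkovJump.exists_integral_increment_le`). Hölder's inequality separates off a factor
X^{(p-2)/p}, or the corresponding power of the maximal jump, and `rpow_two_div_le_of_le` absorbs it.
This gives `IsMarkovJump.exists_discreteIntegral_le`.

To return to continuous time, integrands are truncated at level B, the mesh is sent to zero and then
B to infinity, with Fatou's lemma. Left-point Riemann sums converge to Stieltjes integrals of left
limits, so the integrands must have left limits. For iterated integrals this is a pathwise induction
(`pathwiseRegular`) in which regularity in time and continuity in the kernel are proved together. -/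

theorem rpow_sub_rpow_le {r u v : ℝ} (hr : 1 ≤ r) (hu : 0 < u) (hv : 0 ≤ v) :
    u ^ r - v ^ r ≤ r * u ^ (r - 1) * (u - v) := by
  have h := one_add_mul_self_le_rpow_one_add (s := v / u - 1) (by linarith [div_nonneg hv hu.le]) hr
  have e : (1 + (v / u - 1)) ^ r = v ^ r / u ^ r := by
    rw [show 1 + (v / u - 1) = v / u by ring, Real.div_rpow hv hu.le]
  rw [e, le_div_iff₀ (by positivity)] at h
  have e2 : u ^ r = u ^ (r - 1) * u := by
    rw [← Real.rpow_add_one hu.ne']; ring_nf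
  have : (1 + r * (v / u - 1)) * u ^ r = u ^ r - r * u ^ (r - 1) * (u - v) := by
    rw [e2]; field_simp; ring
  linarith

/-- If x ≤ 2|d|, every term is comparable to |d|^p, with |x + d| ≤ 3|d| producing 3^p. Otherwise x +
d ≥ x/2 > 0; convexity at x + d leaves a difference of derivatives times d, which is of order
x^(p-2) d². -/
theorem abs_add_rpow_le_of_nonneg {p x d : ℝ} (hp : 2 ≤ p) (hx : 0 ≤ x) :
    |x + d| ^ p ≤ x ^ p + p * x ^ (p - 1) * d
      + (3 ^ p + p ^ 2 * 2 ^ p) * (x ^ (p - 2) * d ^ 2 + |d| ^ p) := by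
  have hp0 : 0 < p := by linarith
  rcases le_or_gt x (2 * |d|) with h | h
  · have h1 : |x + d| ^ p ≤ 3 ^ p * |d| ^ p := by
      rw [← Real.mul_rpow (by norm_num) (abs_nonneg _)]
      refine Real.rpow_le_rpow (abs_nonneg _) ?_ hp0.le
      calc |x + d| ≤ |x| + |d| := abs_add_le _ _
        _ ≤ 3 * |d| := by rw [abs_of_nonneg hx]; linarith
    have h2 : -(p * x ^ (p - 1) * d) ≤ p ^ 2 * 2 ^ p * |d| ^ p := by
      have h3 : x ^ (p - 1) ≤ 2 ^ p * |d| ^ (p - 1) := by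
        calc x ^ (p - 1) ≤ (2 * |d|) ^ (p - 1) := Real.rpow_le_rpow hx h (by linarith)
          _ = 2 ^ (p - 1) * |d| ^ (p - 1) := Real.mul_rpow (by norm_num) (abs_nonneg _)
          _ ≤ 2 ^ p * |d| ^ (p - 1) := by
            gcongr <;> linarith
      have h4 : |d| ^ p = |d| ^ (p - 1) * |d| := by
        rcases (abs_nonneg d).eq_or_lt with h0 | h0
        · rw [← h0, Real.zero_rpow hp0.ne', mul_zero]
        · rw [← Real.rpow_add_one h0.ne']; ring_nf
      calc -(p * x ^ (p - 1) * d) = p * x ^ (p - 1) * (-d) := by ring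
        _ ≤ p * x ^ (p - 1) * |d| := by gcongr; exact neg_le_abs d
        _ ≤ p * (2 ^ p * |d| ^ (p - 1)) * |d| := by gcongr
        _ = p * (2 ^ p * |d| ^ p) := by rw [h4]; ring
        _ ≤ p ^ 2 * (2 ^ p * |d| ^ p) := by
          have : 0 ≤ (2:ℝ) ^ p * |d| ^ p := by positivity
          have hpp : p ≤ p ^ 2 := by nlinarith
          exact mul_le_mul_of_nonneg_right hpp this
        _ = _ := by ring
    have h5 : 0 ≤ (3 ^ p + p ^ 2 * 2 ^ p) * (x ^ (p - 2) * d ^ 2) := by positivity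
    have h6 : 0 ≤ x ^ p := by positivity
    nlinarith
  · have hx0 : 0 < x := by linarith [abs_nonneg d]
    have hd := abs_le.1 (show |d| ≤ x / 2 by linarith)
    have hy : 0 < x + d := by linarith
    rw [abs_of_pos hy]
    have h1 := rpow_sub_rpow_le (r := p) (by linarith) hy hx
    have h2 : (p * (x + d) ^ (p - 1) - p * x ^ (p - 1)) * d ≤ p ^ 2 * 2 ^ p * (x ^ (p - 2) * d ^ 2) := by
      -- The tangent inequality is one-sided, so it is applied with both orders of the two points to
      -- control the absolute value.
      have key : ∀ u v : ℝ, 0 < u → 0 < v → u ≤ 2 * x → v ≤ 2 * x →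
          u ^ (p - 1) - v ^ (p - 1) ≤ (p - 1) * (2 * x) ^ (p - 2) * |u - v| := by
        intro u v hu hv hu2 _
        have := rpow_sub_rpow_le (r := p - 1) (by linarith) hu hv.le
        rw [show p - 1 - 1 = p - 2 by ring] at this
        refine this.trans ?_
        calc (p - 1) * u ^ (p - 2) * (u - v) ≤ (p - 1) * u ^ (p - 2) * |u - v| := by
              have : 0 ≤ (p - 1) * u ^ (p - 2) := mul_nonneg (by linarith) (by positivity)
              exact mul_le_mul_of_nonneg_left (le_abs_self _) this
          _ ≤ _ := by
              have : u ^ (p - 2) ≤ (2 * x) ^ (p - 2) := Real.rpow_le_rpow hu.le hu2 (by linarith)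
              have h0 : 0 ≤ p - 1 := by linarith
              gcongr
      have k1 := key (x + d) x hy hx0 (by linarith) (by linarith)
      have k2 := key x (x + d) hx0 hy (by linarith) (by linarith)
      rw [show x + d - x = d by ring] at k1
      rw [show x - (x + d) = -d by ring, abs_neg] at k2
      have k3 : |(x + d) ^ (p - 1) - x ^ (p - 1)| ≤ (p - 1) * (2 * x) ^ (p - 2) * |d| :=
        abs_le.2 ⟨by linarith, k1⟩
      have e : (2 * x) ^ (p - 2) ≤ 2 ^ p * x ^ (p - 2) := by
        rw [Real.mul_rpow (by norm_num) hx]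
        gcongr <;> linarith
      calc (p * (x + d) ^ (p - 1) - p * x ^ (p - 1)) * d
          = p * (((x + d) ^ (p - 1) - x ^ (p - 1)) * d) := by ring
        _ ≤ p * (|(x + d) ^ (p - 1) - x ^ (p - 1)| * |d|) := by
            refine mul_le_mul_of_nonneg_left ?_ hp0.le
            rw [← abs_mul]; exact le_abs_self _
        _ ≤ p * (((p - 1) * (2 * x) ^ (p - 2) * |d|) * |d|) := by gcongr
        _ = p * (p - 1) * (2 * x) ^ (p - 2) * d ^ 2 := by rw [← sq_abs d]; ring
        _ ≤ p * (p - 1) * (2 ^ p * x ^ (p - 2)) * d ^ 2 := by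
            have h0 : 0 ≤ p - 1 := by linarith
            gcongr
        _ ≤ p * p * (2 ^ p * x ^ (p - 2)) * d ^ 2 := by gcongr; linarith
        _ = _ := by ring
    rw [show x + d - x = d by ring] at h1
    have h3 : 0 ≤ 3 ^ p * (x ^ (p - 2) * d ^ 2) := by positivity
    have h4 : 0 ≤ (3 ^ p + p ^ 2 * 2 ^ p) * |d| ^ p := by positivity
    nlinarith

/-- The coefficient of the term linear in d is a function of x alone, so this term has mean zero
when d is a martingale increment after x. -/
theorem abs_add_rpow_le {p : ℝ} (hp : 2 ≤ p) (x d : ℝ) :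
    |x + d| ^ p ≤ |x| ^ p + p * (SignType.sign x * |x| ^ (p - 1)) * d
      + (3 ^ p + p ^ 2 * 2 ^ p) * (|x| ^ (p - 2) * d ^ 2 + |d| ^ p) := by
  rcases lt_trichotomy x 0 with h | h | h
  · have := abs_add_rpow_le_of_nonneg (x := -x) (d := -d) hp (by linarith)
    rw [show -x + -d = -(x + d) by ring, abs_neg, abs_neg, neg_sq] at this
    rw [abs_of_neg h, sign_neg h]
    simp only [SignType.coe_neg_one]
    linarith
  · subst h
    have := abs_add_rpow_le_of_nonneg (x := 0) (d := d) hp le_rfl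
    rw [Real.zero_rpow (by linarith : p - 1 ≠ 0)] at this
    simpa using this
  · have := abs_add_rpow_le_of_nonneg (d := d) hp h.le
    rw [abs_of_pos h, sign_pos h]
    simpa using this

/-! ### The maximal inequality along a path -/

/-- For v ≤ u both sides vanish. For u ≤ v the claim is Young's inequality for v · u^(p-1) with
exponents p and p/(p-1). -/
theorem rpow_max_sub_le {p u v : ℝ} (hp : 2 ≤ p) (hu : 0 ≤ u) (hv : 0 ≤ v) :
    (max u v) ^ p - u ^ p ≤ p / (p - 1) * (v * ((max u v) ^ (p - 1) - u ^ (p - 1))) := by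
  rcases le_total v u with h | h
  · simp [max_eq_left h]
  rw [max_eq_right h]
  rcases hv.eq_or_lt with h0 | h0
  · have : u = 0 := le_antisymm (h0 ▸ h) hu
    simp [this, ← h0]
  have hq : p.HolderConjugate (p / (p - 1)) := Real.HolderConjugate.conjExponent (by linarith)
  have y := Real.young_inequality_of_nonneg hv (Real.rpow_nonneg hu (p - 1)) hq
  have hp1 : 0 < p - 1 := by linarith
  have e : (u ^ (p - 1)) ^ (p / (p - 1)) = u ^ p := by
    rw [← Real.rpow_mul hu]; congr 1; field_simp
  rw [e] at y
  have e2 : v * v ^ (p - 1) = v ^ p := by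
    rw [mul_comm, ← Real.rpow_add_one h0.ne']; ring_nf
  rw [mul_sub, e2]
  have e3 : p / (p - 1) * (v ^ p / p + u ^ p / (p / (p - 1))) = v ^ p * (1 / (p - 1)) + u ^ p := by
    field_simp
  have e4 : p / (p - 1) * v ^ p = v ^ p + v ^ p * (1 / (p - 1)) := by field_simp; ring
  have : p / (p - 1) * (v * u ^ (p - 1)) ≤ v ^ p * (1 / (p - 1)) + u ^ p := by
    rw [← e3]; gcongr
  rw [mul_sub, e4]; linarith

/-- Summation by parts rewrites the bracket on the right as the initial term plus the sum of a (k+1)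
times the increment of the (p-1)-st power of the running maximum. `rpow_max_sub_le` bounds each
increment of the p-th power by such a term. -/
theorem partialSups_rpow_le {p : ℝ} (hp : 2 ≤ p) (a : ℕ → ℝ) (ha : ∀ k, 0 ≤ a k) (m : ℕ) :
    (partialSups a m) ^ p ≤ p / (p - 1) * ((partialSups a m) ^ (p - 1) * a m
      - ∑ k ∈ Finset.range m, (partialSups a k) ^ (p - 1) * (a (k + 1) - a k)) := by
  have hp1 : 0 < p - 1 := by linarith
  have hs : ∀ k, 0 ≤ partialSups a k := fun k => (ha k).trans (le_partialSups a k)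
  induction m with
  | zero =>
    simp only [partialSups_zero, Finset.range_zero, Finset.sum_empty, sub_zero]
    have : a 0 ^ (p - 1) * a 0 = a 0 ^ p := by
      rcases (ha 0).eq_or_lt with h0 | h0
      · rw [← h0, Real.zero_rpow (by linarith), Real.zero_rpow (by linarith), mul_zero]
      · rw [← Real.rpow_add_one h0.ne']; ring_nf
    rw [this]
    have h1 : 1 ≤ p / (p - 1) := by rw [le_div_iff₀ hp1]; linarith
    nlinarith [Real.rpow_nonneg (ha 0) p]
  | succ m ih =>
    rw [Finset.sum_range_succ]
    have := rpow_max_sub_le hp (hs m) (ha (m + 1))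
    rw [partialSups_add_one]
    have e : p / (p - 1) * ((partialSups a m ⊔ a (m + 1)) ^ (p - 1) * a (m + 1)
        - (∑ k ∈ Finset.range m, (partialSups a k) ^ (p - 1) * (a (k + 1) - a k)
          + (partialSups a m) ^ (p - 1) * (a (m + 1) - a m)))
        = p / (p - 1) * ((partialSups a m) ^ (p - 1) * a m
      - ∑ k ∈ Finset.range m, (partialSups a k) ^ (p - 1) * (a (k + 1) - a k))
        + p / (p - 1) * (a (m + 1) * ((partialSups a m ⊔ a (m + 1)) ^ (p - 1)
          - (partialSups a m) ^ (p - 1))) := by ring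
    rw [e]
    linarith

/-- A pathwise form of the maximal inequality of Doob. -/
theorem partialSups_abs_rpow_le {p : ℝ} (hp : 2 ≤ p) (x : ℕ → ℝ) (m : ℕ) :
    (partialSups (fun k => |x k|) m) ^ p ≤ 4 ^ p * |x m| ^ p
      - 2 * (p / (p - 1)) * ∑ k ∈ Finset.range m,
        (SignType.sign (x k) * (partialSups (fun k => |x k|) k) ^ (p - 1)) * (x (k + 1) - x k) := by
  set a : ℕ → ℝ := fun k => |x k|
  have ha : ∀ k, 0 ≤ a k := fun k => abs_nonneg _
  have hs : ∀ k, 0 ≤ partialSups a k := fun k => (ha k).trans (le_partialSups a k)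
  have hp1 : 0 < p - 1 := by linarith
  set q := p / (p - 1)
  have hq1 : 1 ≤ q := by rw [le_div_iff₀ hp1]; linarith
  have hq2 : q ≤ 2 := by rw [div_le_iff₀ hp1]; linarith
  have h1 := partialSups_rpow_le hp a ha m
  -- Absorption of the maximum: either it is at least 4 times the last value, and half of its p-th
  -- power suffices, or it is comparable to the last value.
  have h2 : q * ((partialSups a m) ^ (p - 1) * a m)
      ≤ (partialSups a m) ^ p / 2 + 4 ^ p / 2 * a m ^ p := by
    set s := partialSups a m
    have hsm : 0 ≤ s := hs m
    rcases le_or_gt (4 * a m) s with h | h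
    · have : s ^ (p - 1) * s = s ^ p := by
        rcases hsm.eq_or_lt with h0 | h0
        · rw [← h0, Real.zero_rpow (by linarith), mul_zero, Real.zero_rpow (by linarith)]
        · rw [← Real.rpow_add_one h0.ne']; ring_nf
      have h3 : q * (s ^ (p - 1) * a m) ≤ 2 * (s ^ (p - 1) * (s / 4)) := by
        have : 0 ≤ s ^ (p - 1) := by positivity
        have := ha m
        gcongr
        linarith
      have h4 : 0 ≤ (4:ℝ) ^ p / 2 * a m ^ p := by have := ha m; positivity
      nlinarith
    · have ham : 0 < a m := by linarith
      have h3 : s ^ (p - 1) ≤ 4 ^ (p - 1) * a m ^ (p - 1) := by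
        rw [← Real.mul_rpow (by norm_num) ham.le]
        exact Real.rpow_le_rpow hsm h.le hp1.le
      have e1 : a m ^ (p - 1) * a m = a m ^ p := by rw [← Real.rpow_add_one ham.ne']; ring_nf
      have e2 : (4:ℝ) ^ p = 4 ^ (p - 1) * 4 := by
        rw [← Real.rpow_add_one (by norm_num)]; ring_nf
      have h4 : q * (s ^ (p - 1) * a m) ≤ 2 * ((4 ^ (p - 1) * a m ^ (p - 1)) * a m) := by
        gcongr
      have h5 : 0 ≤ s ^ p := by positivity
      rw [mul_assoc, e1] at h4
      rw [e2]
      linarith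
  have h3 : ∑ k ∈ Finset.range m,
        (SignType.sign (x k) * (partialSups a k) ^ (p - 1)) * (x (k + 1) - x k)
      ≤ ∑ k ∈ Finset.range m, (partialSups a k) ^ (p - 1) * (a (k + 1) - a k) := by
    refine Finset.sum_le_sum fun k _ => ?_
    -- The sign is a subgradient of the absolute value. Increments of |x| are thereby replaced by
    -- increments of x itself, which integrate to zero for a martingale.
    have h4 : SignType.sign (x k) * (x (k + 1) - x k) ≤ a (k + 1) - a k := by
      simp only [a]
      rcases lt_trichotomy (x k) 0 with h | h | h
      · rw [sign_neg h, abs_of_neg h]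
        simp only [SignType.coe_neg_one]
        linarith [neg_le_abs (x (k + 1))]
      · rw [h]; simp
      · rw [sign_pos h, abs_of_pos h]
        simp only [SignType.coe_one]
        linarith [le_abs_self (x (k + 1))]
    have := mul_le_mul_of_nonneg_left h4 (Real.rpow_nonneg (hs k) (p - 1))
    linarith
  have h4 : q * (∑ k ∈ Finset.range m,
        (SignType.sign (x k) * (partialSups a k) ^ (p - 1)) * (x (k + 1) - x k))
      ≤ q * ∑ k ∈ Finset.range m, (partialSups a k) ^ (p - 1) * (a (k + 1) - a k) :=
    mul_le_mul_of_nonneg_left h3 (by linarith)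
  rw [mul_sub] at h1
  linarith

/-! ### Discrete martingales -/

/-- A discrete `L^p` inequality of Burkholder type for bounded martingales started at zero, with
the martingale property expressed through bounded test functions. -/
theorem integral_partialSups_rpow_le {Ω : Type*} {mΩ : MeasurableSpace Ω} (P : Measure Ω)
    [IsProbabilityMeasure P] {p : ℝ} (hp : 2 ≤ p) (m : ℕ) (ℱ : ℕ → MeasurableSpace Ω)
    (hmono : Monotone ℱ) (hℱ : ∀ k, ℱ k ≤ mΩ) (x : ℕ → Ω → ℝ) (hx : ∀ k, Measurable[ℱ k] (x k))
    (hb : ∀ k, ∃ b, ∀ ω, |x k ω| ≤ b) (hx0 : ∀ ω, x 0 ω = 0)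
    (hmart : ∀ k < m, ∀ Z : Ω → ℝ, Measurable[ℱ k] Z → (∃ b, ∀ ω, |Z ω| ≤ b) →
      ∫ ω, Z ω * (x (k + 1) ω - x k ω) ∂P = 0) :
    ∫ ω, (partialSups (fun k => |x k ω|) m) ^ p ∂P ≤ 4 ^ p * (3 ^ p + p ^ 2 * 2 ^ p) *
      ∑ k ∈ Finset.range m, (∫ ω, |x k ω| ^ (p - 2) * (x (k + 1) ω - x k ω) ^ 2 ∂P
        + ∫ ω, |x (k + 1) ω - x k ω| ^ p ∂P) := by
  choose b hb using hb
  have hp0 : 0 < p := by linarith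
  have hxm : ∀ k, Measurable (x k) := fun k => (hx k).mono (hℱ k) le_rfl
  have hs : ∀ k, Measurable[ℱ k] fun ω => partialSups (fun k => |x k ω|) k := by
    intro k
    induction k with
    | zero => simpa [Function.comp_def] using continuous_abs.measurable.comp (hx 0)
    | succ k ih =>
      simp only [partialSups_add_one]
      exact (ih.mono (hmono (Nat.le_succ k)) le_rfl).sup (continuous_abs.measurable.comp (hx (k + 1)))
  have hsm : ∀ k, Measurable fun ω => partialSups (fun k => |x k ω|) k :=
    fun k => (hs k).mono (hℱ k) le_rfl
  have hs0 : ∀ k ω, 0 ≤ partialSups (fun k => |x k ω|) k :=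
    fun k ω => (abs_nonneg _).trans (le_partialSups (fun k => |x k ω|) k)
  have hsb : ∀ k, ∃ B, ∀ ω, partialSups (fun k => |x k ω|) k ≤ B := by
    intro k
    refine ⟨partialSups b k, fun ω => ?_⟩
    exact partialSups_le _ _ _ fun i hi => (hb i ω).trans (le_partialSups_of_le b hi)
  have int_of_bdd : ∀ f : Ω → ℝ, Measurable f → (∃ B, ∀ ω, |f ω| ≤ B) → Integrable f P := by
    rintro f hf ⟨B, hB⟩
    exact Integrable.of_bound hf.aestronglyMeasurable B (Eventually.of_forall hB)
  have hdb : ∀ k, ∃ B, ∀ ω, |x (k + 1) ω - x k ω| ≤ B := fun k =>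
    ⟨b (k + 1) + b k, fun ω => (abs_sub _ _).trans (add_le_add (hb _ ω) (hb _ ω))⟩
  -- powers of bounded nonnegative functions are bounded
  have pow_bdd : ∀ (f : Ω → ℝ) (r : ℝ), 0 ≤ r → (∀ ω, 0 ≤ f ω) → (∃ B, ∀ ω, f ω ≤ B) →
      ∃ B, ∀ ω, |f ω ^ r| ≤ B := by
    rintro f r hr hf ⟨B, hB⟩
    refine ⟨B ^ r, fun ω => ?_⟩
    rw [abs_of_nonneg (Real.rpow_nonneg (hf ω) r)]
    exact Real.rpow_le_rpow (hf ω) (hB ω) hr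
  have sgn_bdd : ∀ y : ℝ, |(SignType.sign y : ℝ)| ≤ 1 := by
    intro y
    rcases lt_trichotomy y 0 with h | h | h <;> simp [h]
  have sgn_meas : Measurable fun y : ℝ => ((SignType.sign y : SignType) : ℝ) := by
    have : (fun y : ℝ => ((SignType.sign y : SignType) : ℝ))
        = fun y => if 0 < y then 1 else if y < 0 then -1 else 0 := by
      funext y
      rcases lt_trichotomy y 0 with h | h | h
      · simp [h, not_lt.2 h.le]
      · simp [h]
      · simp [h]
    rw [this]
    exact Measurable.ite measurableSet_Ioi measurable_const
      (Measurable.ite measurableSet_Iio measurable_const measurable_const)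
  have mul_bdd : ∀ f g : Ω → ℝ, (∃ B, ∀ ω, |f ω| ≤ B) → (∃ B, ∀ ω, |g ω| ≤ B) →
      ∃ B, ∀ ω, |f ω * g ω| ≤ B := by
    rintro f g ⟨B, hB⟩ ⟨B', hB'⟩
    refine ⟨B * B', fun ω => ?_⟩
    rw [abs_mul]
    exact mul_le_mul (hB ω) (hB' ω) (abs_nonneg _) ((abs_nonneg _).trans (hB ω))
  -- the maximal inequality
  have step1 : ∫ ω, (partialSups (fun k => |x k ω|) m) ^ p ∂P ≤ 4 ^ p * ∫ ω, |x m ω| ^ p ∂P := by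
    have hZ : ∀ k, Measurable[ℱ k] fun ω => (SignType.sign (x k ω) : ℝ)
        * (partialSups (fun k => |x k ω|) k) ^ (p - 1) := fun k =>
      (sgn_meas.comp (hx k)).mul ((hs k).pow_const _)
    have hZb : ∀ k, ∃ B, ∀ ω, |(SignType.sign (x k ω) : ℝ)
        * (partialSups (fun k => |x k ω|) k) ^ (p - 1)| ≤ B := fun k =>
      mul_bdd _ _ ⟨1, fun ω => sgn_bdd _⟩ (pow_bdd _ _ (by linarith) (hs0 k) (hsb k))
    have hint : ∀ k, Integrable (fun ω => ((SignType.sign (x k ω) : ℝ)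
        * (partialSups (fun k => |x k ω|) k) ^ (p - 1)) * (x (k + 1) ω - x k ω)) P := fun k =>
      int_of_bdd _ (((hZ k).mono (hℱ k) le_rfl).mul ((hxm _).sub (hxm _)))
        (mul_bdd _ _ (hZb k) (hdb k))
    have hint2 : Integrable (fun ω => |x m ω| ^ p) P :=
      int_of_bdd _ ((hxm m).abs.pow_const _)
        (pow_bdd _ _ hp0.le (fun ω => abs_nonneg _) ⟨b m, hb m⟩)
    have hint3 : Integrable (fun ω => 2 * (p / (p - 1)) * ∑ k ∈ Finset.range m,
        ((SignType.sign (x k ω) : ℝ) * (partialSups (fun k => |x k ω|) k) ^ (p - 1))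
          * (x (k + 1) ω - x k ω)) P := (integrable_finsetSum _ fun k _ => hint k).const_mul _
    calc ∫ ω, (partialSups (fun k => |x k ω|) m) ^ p ∂P
        ≤ ∫ ω, (4 ^ p * |x m ω| ^ p - 2 * (p / (p - 1)) * ∑ k ∈ Finset.range m,
          ((SignType.sign (x k ω) : ℝ) * (partialSups (fun k => |x k ω|) k) ^ (p - 1))
            * (x (k + 1) ω - x k ω)) ∂P := by
          refine integral_mono (int_of_bdd _ ((hsm m).pow_const _)
            (pow_bdd _ _ hp0.le (hs0 m) (hsb m))) ((hint2.const_mul _).sub hint3) fun ω => ?_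
          exact partialSups_abs_rpow_le hp (fun k => x k ω) m
      _ = 4 ^ p * ∫ ω, |x m ω| ^ p ∂P := by
          rw [integral_sub (hint2.const_mul _) hint3, integral_const_mul, integral_const_mul,
            integral_finsetSum _ fun k _ => hint k,
            Finset.sum_eq_zero fun k hk => hmart k (Finset.mem_range.1 hk) _ (hZ k) (hZb k)]
          simp
  -- Taylor expansion of the power
  have step2 : ∀ j ≤ m, ∫ ω, |x j ω| ^ p ∂P ≤ (3 ^ p + p ^ 2 * 2 ^ p) *
      ∑ k ∈ Finset.range j, (∫ ω, |x k ω| ^ (p - 2) * (x (k + 1) ω - x k ω) ^ 2 ∂P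
        + ∫ ω, |x (k + 1) ω - x k ω| ^ p ∂P) := by
    intro j
    induction j with
    | zero =>
      intro _
      simp [hx0, Real.zero_rpow hp0.ne']
    | succ k ih =>
      intro hk
      have hZ : Measurable[ℱ k] fun ω => p * ((SignType.sign (x k ω) : ℝ) * |x k ω| ^ (p - 1)) :=
        ((sgn_meas.comp (hx k)).mul ((continuous_abs.measurable.comp (hx k)).pow_const _)).const_mul _
      have hZb : ∃ B, ∀ ω, |p * ((SignType.sign (x k ω) : ℝ) * |x k ω| ^ (p - 1))| ≤ B :=
        mul_bdd _ _ ⟨|p|, fun _ => le_rfl⟩ (mul_bdd _ _ ⟨1, fun ω => sgn_bdd _⟩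
          (pow_bdd _ _ (by linarith) (fun ω => abs_nonneg _) ⟨b k, hb k⟩))
      have i0 : ∀ k, Integrable (fun ω => |x k ω| ^ p) P := fun k =>
        int_of_bdd _ ((hxm k).abs.pow_const _)
          (pow_bdd _ _ hp0.le (fun ω => abs_nonneg _) ⟨b k, hb k⟩)
      have i1 : Integrable (fun ω => p * ((SignType.sign (x k ω) : ℝ) * |x k ω| ^ (p - 1))
          * (x (k + 1) ω - x k ω)) P :=
        int_of_bdd _ ((hZ.mono (hℱ k) le_rfl).mul ((hxm _).sub (hxm _))) (mul_bdd _ _ hZb (hdb k))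
      have i2 : Integrable (fun ω => |x k ω| ^ (p - 2) * (x (k + 1) ω - x k ω) ^ 2) P := by
        refine int_of_bdd _ (((hxm k).abs.pow_const _).mul (((hxm _).sub (hxm _)).pow_const 2))
          (mul_bdd _ _ (pow_bdd _ _ (by linarith) (fun ω => abs_nonneg _) ⟨b k, hb k⟩) ?_)
        simp only [sq]
        exact mul_bdd _ _ (hdb k) (hdb k)
      have i3 : Integrable (fun ω => |x (k + 1) ω - x k ω| ^ p) P :=
        int_of_bdd _ (((hxm _).sub (hxm _)).abs.pow_const _)
          (pow_bdd _ _ hp0.le (fun ω => abs_nonneg _) (hdb k))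
      rw [Finset.sum_range_succ, mul_add]
      calc ∫ ω, |x (k + 1) ω| ^ p ∂P
          ≤ ∫ ω, (|x k ω| ^ p + p * ((SignType.sign (x k ω) : ℝ) * |x k ω| ^ (p - 1))
              * (x (k + 1) ω - x k ω) + (3 ^ p + p ^ 2 * 2 ^ p) * (|x k ω| ^ (p - 2)
              * (x (k + 1) ω - x k ω) ^ 2 + |x (k + 1) ω - x k ω| ^ p)) ∂P := by
            refine integral_mono (i0 _) (((i0 k).add i1).add ((i2.add i3).const_mul _)) fun ω => ?_
            have := abs_add_rpow_le hp (x k ω) (x (k + 1) ω - x k ω)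
            rwa [add_sub_cancel] at this
        _ = ∫ ω, |x k ω| ^ p ∂P + (3 ^ p + p ^ 2 * 2 ^ p) *
              (∫ ω, |x k ω| ^ (p - 2) * (x (k + 1) ω - x k ω) ^ 2 ∂P
              + ∫ ω, |x (k + 1) ω - x k ω| ^ p ∂P) := by
            have e1 := integral_add ((i0 k).add i1) ((i2.add i3).const_mul (3 ^ p + p ^ 2 * 2 ^ p))
            have e2 := integral_add (i0 k) i1
            have e3 := integral_add i2 i3
            simp only [Pi.add_apply] at e1 e2 e3
            rw [e1, e2, hmart k hk _ hZ hZb, integral_const_mul, e3, add_zero]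
        _ ≤ _ := by linarith [ih (by omega)]
  calc _ ≤ _ := step1
    _ ≤ 4 ^ p * _ := mul_le_mul_of_nonneg_left (step2 m le_rfl) (by positivity)
    _ = _ := (mul_assoc _ _ _).symm

/-! ### Discretising a time from the left -/

/-- The largest multiple of `h` that is strictly smaller than `s`. -/
noncomputable def gridBelow (h s : ℝ) : ℝ := h * (⌈s / h⌉ - 1)

theorem gridBelow_lt {h : ℝ} (hh : 0 < h) (s : ℝ) : gridBelow h s < s := by
  have := Int.ceil_lt_add_one (s / h)
  calc gridBelow h s < h * (s / h) := by
        unfold gridBelow; gcongr; linarith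
    _ = s := by field_simp

theorem le_gridBelow_add {h : ℝ} (hh : 0 < h) (s : ℝ) : s ≤ gridBelow h s + h := by
  have := Int.le_ceil (s / h)
  calc s = h * (s / h) := by field_simp
    _ ≤ h * ⌈s / h⌉ := by gcongr
    _ = _ := by unfold gridBelow; ring

theorem gridBelow_nonneg {h s : ℝ} (hh : 0 < h) (hs : 0 < s) : 0 ≤ gridBelow h s := by
  have : 0 < ⌈s / h⌉ := Int.ceil_pos.2 (by positivity)
  have : (1 : ℝ) ≤ ⌈s / h⌉ := by exact_mod_cast this
  exact mul_nonneg hh.le (by linarith)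

theorem gridBelow_eq {h s : ℝ} (hh : 0 < h) {k : ℕ} (hs : s ∈ Ioc (k * h) ((k + 1) * h)) :
    gridBelow h s = k * h := by
  have : ⌈s / h⌉ = k + 1 := by
    rw [Int.ceil_eq_iff]
    push_cast
    constructor
    · rw [lt_div_iff₀ hh]; linarith [hs.1]
    · rw [div_le_iff₀ hh]; exact hs.2
  rw [gridBelow, this]; push_cast; ring

/-- The grid point is strictly below s, hence the filter 𝓝[<] s: along the grid a regulated function
converges to its left limit, never to its value at s. -/
theorem tendsto_gridBelow {T : ℝ} (hT : 0 < T) (s : ℝ) :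
    Tendsto (fun m : ℕ => gridBelow (T / m) s) atTop (𝓝[<] s) := by
  refine tendsto_nhdsWithin_iff.2 ⟨?_, ?_⟩
  · have h0 : Tendsto (fun m : ℕ => s - T / m) atTop (𝓝 s) := by
      simpa using tendsto_const_nhds.sub (tendsto_const_div_atTop_nhds_zero_nat T)
    refine tendsto_of_tendsto_of_tendsto_of_le_of_le' h0 tendsto_const_nhds ?_ ?_
    · filter_upwards [eventually_gt_atTop 0] with m hm
      have := le_gridBelow_add (h := T / m) (by positivity) s
      linarith
    · filter_upwards [eventually_gt_atTop 0] with m hm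
      exact (gridBelow_lt (by positivity) s).le
  · filter_upwards [eventually_gt_atTop 0] with m hm
    exact gridBelow_lt (by positivity) s

/-- No measurability of `G` is needed, since `gridBelow h` factors through ℤ. -/
theorem measurable_comp_gridBelow {α : Type*} [MeasurableSpace α] (G : ℝ → α) (h : ℝ) :
    Measurable fun s => G (gridBelow h s) := by
  have h1 : Measurable fun k : ℤ => G (h * (k - 1)) := measurable_of_countable _
  exact h1.comp (Int.measurable_ceil.comp (measurable_id.div_const h))

/-! ### Regulated functions and drivers -/

/-- Functions on `[0, ∞)` that have left limits and are bounded on bounded sets. -/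
structure Regulated (G : ℝ → ℝ) : Prop where
  tendsto : ∀ s, 0 < s → Tendsto G (𝓝[<] s) (𝓝 (Function.leftLim G s))
  bdd : ∀ T, ∃ B, ∀ s ∈ Icc 0 T, |G s| ≤ B

/-- Right-continuous paths on `[0, ∞)` of locally bounded variation. -/
structure IsDriver (m : ℝ → ℝ) : Prop where
  bv : ∀ t, BoundedVariationOn (fun s => m (max 0 (min s t))) univ
  rc : ∀ t, 0 ≤ t → ContinuousWithinAt m (Ici t) t

theorem tendsto_leftLim_of_exists {G : ℝ → ℝ} {s l : ℝ} (h : Tendsto G (𝓝[<] s) (𝓝 l)) :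
    Tendsto G (𝓝[<] s) (𝓝 (Function.leftLim G s)) := by
  rwa [leftLim_eq_of_tendsto h]

theorem abs_leftLim_le {G : ℝ → ℝ} {s B : ℝ} (hs : 0 < s)
    (h : Tendsto G (𝓝[<] s) (𝓝 (Function.leftLim G s))) (hB : ∀ u ∈ Icc 0 s, |G u| ≤ B) :
    |Function.leftLim G s| ≤ B := by
  refine le_of_tendsto h.abs ?_
  filter_upwards [Ioo_mem_nhdsLT hs] with u hu using hB u ⟨hu.1.le, hu.2.le⟩

/-- The left limit is a pointwise limit of step functions built on `gridBelow`. The indicator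
removes times s ≤ 0, where nothing is known. -/
theorem Regulated.measurable {G : ℝ → ℝ} (hG : Regulated G) :
    Measurable ((Ioi 0).indicator (Function.leftLim G)) := by
  refine measurable_of_tendsto_metrizable
    (f := fun m : ℕ => (Ioi 0).indicator fun s => G (gridBelow (1 / m) s))
    (fun m => (measurable_comp_gridBelow G _).indicator measurableSet_Ioi) ?_
  rw [tendsto_pi_nhds]
  intro s
  by_cases hs : 0 < s
  · simp only [indicator_of_mem (mem_Ioi.2 hs)]
    exact (hG.tendsto s hs).comp (tendsto_gridBelow one_pos s)
  · simp [indicator_of_notMem (show s ∉ Ioi (0:ℝ) from hs)]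

instance isFiniteMeasure_variation_signedMeasure (μ : VectorMeasure ℝ ℝ) :
    IsFiniteMeasure μ.variation := by
  have := SignedMeasure.totalVariation_eq_variation (μ := μ)
  rw [← this, SignedMeasure.totalVariation]
  infer_instance

/-- The measure of a half-open interval is a difference of right limits of the stopped path;
right-continuity turns these into values of `m`. -/
theorem IsDriver.exists_measure {m : ℝ → ℝ} (hm : IsDriver m) (T : ℝ) :
    ∃ μ : VectorMeasure ℝ ℝ, (∀ a b, 0 ≤ a → a ≤ b → b ≤ T → μ (Ioc a b) = m b - m a) ∧
      ∀ g, stieltjesIntegral m g T = ∫ᵛ s in Ioc 0 T, g s ∂•μ := by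
  refine ⟨(hm.bv T).vectorMeasure, fun a b ha hab hb => ?_, fun g => ?_⟩
  · have hrc : ∀ s, ContinuousWithinAt (fun s => m (max 0 (min s T))) (Ici s) s := by
      intro s
      refine ContinuousWithinAt.comp (t := Ici (max 0 (min s T))) (hm.rc _ (le_max_left _ _))
        (by fun_prop) ?_
      intro u hu
      exact max_le_max le_rfl (min_le_min_right _ (mem_Ici.1 hu))
    rw [(hm.bv T).vectorMeasure_Ioc hab]
    have e : ∀ s, Function.rightLim (fun s => m (max 0 (min s T))) s = m (max 0 (min s T)) :=
      fun s => (hrc s).rightLim_eq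
    rw [e, e, min_eq_left hb, min_eq_left (hab.trans hb), max_eq_right ha,
      max_eq_right (ha.trans hab)]
  · unfold stieltjesIntegral
    exact dif_pos (hm.bv T)

/-! ### Riemann sums -/

theorem integrableOn_of_bdd (μ : VectorMeasure ℝ ℝ) {f : ℝ → ℝ} {s : Set ℝ} (hs : MeasurableSet s)
    (hf : Measurable f) {B : ℝ} (hB : ∀ x ∈ s, |f x| ≤ B) : μ.IntegrableOn f s := by
  change Integrable f (μ.restrict s).variation
  rw [VectorMeasure.variation_restrict hs]
  refine Integrable.of_bound hf.aestronglyMeasurable B ?_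
  filter_upwards [ae_restrict_mem hs] with x hx using hB x hx

theorem setIntegral_comp_gridBelow (μ : VectorMeasure ℝ ℝ) (G : ℝ → ℝ) {h : ℝ} (hh : 0 < h)
    (n : ℕ) {B : ℝ} (hB : ∀ s ∈ Icc 0 (n * h), |G s| ≤ B) :
    ∫ᵛ s in Ioc 0 (n * h), G (gridBelow h s) ∂•μ
      = ∑ k ∈ Finset.range n, G (k * h) * μ (Ioc (k * h) ((k + 1) * h)) := by
  induction n with
  | zero => simp
  | succ n ih =>
    have hn : (n : ℝ) * h ≤ ((n : ℝ) + 1) * h := by nlinarith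
    have hn0 : 0 ≤ (n : ℝ) * h := by positivity
    push_cast at hB ⊢
    have hB' : ∀ s ∈ Ioc 0 (((n : ℝ) + 1) * h), |G (gridBelow h s)| ≤ B := fun s hs =>
      hB _ ⟨gridBelow_nonneg hh hs.1, (gridBelow_lt hh s).le.trans hs.2⟩
    have hmeas := measurable_comp_gridBelow G h
    rw [← Ioc_union_Ioc_eq_Ioc hn0 hn, VectorMeasure.setIntegral_union
      (Ioc_disjoint_Ioc_of_le le_rfl) measurableSet_Ioc measurableSet_Ioc
      (integrableOn_of_bdd μ measurableSet_Ioc hmeas fun x hx => hB' x ⟨hx.1, hx.2.trans hn⟩)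
      (integrableOn_of_bdd μ measurableSet_Ioc hmeas fun x hx => hB' x ⟨hn0.trans_lt hx.1, hx.2⟩),
      ih fun s hs => hB s ⟨hs.1, hs.2.trans hn⟩, Finset.sum_range_succ]
    congr 1
    rw [VectorMeasure.setIntegral_congr_fun (g := fun _ => G (n * h))
      (fun s hs => by simp only [gridBelow_eq hh hs]),
      VectorMeasure.setIntegral_const]
    simp

/-- The sum is the integral of `G (gridBelow (T / m) s)` up to the first grid point at or after t,
so dominated convergence applies. The mesh depends on T and not on t: one partition then serves all
t ≤ T, as a supremum over t requires. -/
theorem tendsto_riemannSum (μ : VectorMeasure ℝ ℝ) {G : ℝ → ℝ} (hG : Regulated G) {T t : ℝ}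
    (hT : 0 < T) (ht : t ∈ Icc 0 T) :
    Tendsto (fun m : ℕ => ∑ k ∈ Finset.range ⌈t / (T / m)⌉₊,
      G (k * (T / m)) * μ (Ioc (k * (T / m)) ((k + 1) * (T / m)))) atTop
      (𝓝 (∫ᵛ s in Ioc 0 t, Function.leftLim G s ∂•μ)) := by
  -- The last cell may extend beyond t by one mesh size, which is at most T.
  obtain ⟨B, hB⟩ := hG.bdd (T + T)
  have hB0 : 0 ≤ B := (abs_nonneg _).trans (hB 0 ⟨le_rfl, by linarith⟩)
  have hup : ∀ m : ℕ, 0 < m → (⌈t / (T / m)⌉₊ : ℝ) * (T / m) < t + T / m := by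
    intro m hm
    have := Nat.ceil_lt_add_one (a := t / (T / m)) (div_nonneg ht.1 (by positivity))
    calc (⌈t / (T / m)⌉₊ : ℝ) * (T / m) < (t / (T / m) + 1) * (T / m) := by gcongr
      _ = t + T / m := by field_simp
  have hlow : ∀ m : ℕ, 0 < m → t ≤ (⌈t / (T / m)⌉₊ : ℝ) * (T / m) := by
    intro m hm
    rw [← div_le_iff₀ (by positivity)]
    exact Nat.le_ceil _
  have hTm : ∀ m : ℕ, 0 < m → T / m ≤ T := fun m hm =>
    div_le_self hT.le (by exact_mod_cast hm)
  have key : Tendsto (fun m : ℕ => ∫ᵛ s, (Ioc 0 ((⌈t / (T / m)⌉₊ : ℝ) * (T / m))).indicator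
      (fun s => G (gridBelow (T / m) s)) s ∂•μ) atTop
      (𝓝 (∫ᵛ s, (Ioc 0 t).indicator (Function.leftLim G) s ∂•μ)) := by
    refine VectorMeasure.tendsto_integral_filter_of_dominated_convergence (fun _ => B) ?_ ?_
      (integrable_const _) ?_
    · exact Eventually.of_forall fun m =>
        ((measurable_comp_gridBelow G _).indicator measurableSet_Ioc).aestronglyMeasurable
    · filter_upwards [eventually_gt_atTop 0] with m hm
      refine Eventually.of_forall fun s => ?_
      by_cases hs : s ∈ Ioc 0 ((⌈t / (T / m)⌉₊ : ℝ) * (T / m))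
      · rw [indicator_of_mem hs]
        have h1 := hup m hm
        have h2 := hTm m hm
        exact hB _ ⟨gridBelow_nonneg (by positivity) hs.1,
          (gridBelow_lt (by positivity) s).le.trans (by linarith [hs.2, ht.2])⟩
      · rw [indicator_of_notMem hs]; simpa using hB0
    · refine Eventually.of_forall fun s => ?_
      rcases le_or_gt s 0 with hs0 | hs0
      · have e : ∀ b : ℝ, s ∉ Ioc 0 b := fun b hb => absurd hb.1 (not_lt.2 hs0)
        simp [indicator_of_notMem (e _)]
      rcases le_or_gt s t with hst | hst
      · rw [indicator_of_mem (show s ∈ Ioc 0 t from ⟨hs0, hst⟩)]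
        refine Tendsto.congr' ?_ ((hG.tendsto s hs0).comp (tendsto_gridBelow hT s))
        filter_upwards [eventually_gt_atTop 0] with m hm
        exact (indicator_of_mem (show s ∈ Ioc 0 ((⌈t / (T / m)⌉₊ : ℝ) * (T / m)) from
          ⟨hs0, hst.trans (hlow m hm)⟩) (fun s => G (gridBelow (T / m) s))).symm
      · rw [indicator_of_notMem (fun h : s ∈ Ioc 0 t => absurd h.2 (not_le.2 hst))]
        refine Tendsto.congr' ?_ tendsto_const_nhds
        have h0 : Tendsto (fun m : ℕ => t + T / m) atTop (𝓝 (t + 0)) :=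
          tendsto_const_nhds.add (tendsto_const_div_atTop_nhds_zero_nat T)
        rw [add_zero] at h0
        filter_upwards [eventually_gt_atTop 0, h0.eventually_lt_const hst] with m hm hm2
        rw [indicator_of_notMem]
        exact fun h => absurd h.2 (not_le.2 ((hup m hm).trans hm2))
  rw [VectorMeasure.integral_indicator measurableSet_Ioc] at key
  refine Tendsto.congr' ?_ key
  filter_upwards [eventually_gt_atTop 0] with m hm
  rw [VectorMeasure.integral_indicator measurableSet_Ioc,
    setIntegral_comp_gridBelow μ G (by positivity) _ (B := B)]
  intro s hs
  have h1 := hup m hm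
  have h2 := hTm m hm
  exact hB s ⟨hs.1, by linarith [hs.2, ht.2]⟩

/-! ### Stieltjes integrals of left limits -/

theorem stieltjesIntegral_zero_time (m g : ℝ → ℝ) : stieltjesIntegral m g 0 = 0 := by
  unfold stieltjesIntegral
  split_ifs <;> simp

theorem tendsto_riemannSum_eq {m G : ℝ → ℝ} {μ : VectorMeasure ℝ ℝ} (hG : Regulated G) {T : ℝ}
    (hT : 0 < T) (hμ : ∀ a b, 0 ≤ a → a ≤ b → b ≤ T → μ (Ioc a b) = m b - m a) :
    Tendsto (fun n : ℕ => ∑ k ∈ Finset.range n,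
      G (k * (T / n)) * (m ((k + 1) * (T / n)) - m (k * (T / n)))) atTop
      (𝓝 (∫ᵛ s in Ioc 0 T, Function.leftLim G s ∂•μ)) := by
  refine Tendsto.congr' ?_ (tendsto_riemannSum μ hG hT ⟨hT.le, le_rfl⟩)
  filter_upwards [eventually_gt_atTop 0] with n hn
  have e : ⌈T / (T / n)⌉₊ = n := by
    rw [show T / (T / n) = (n : ℝ) by field_simp]; exact Nat.ceil_natCast n
  rw [e]
  refine Finset.sum_congr rfl fun k hk => ?_
  have hk' : (k : ℝ) + 1 ≤ n := by exact_mod_cast Finset.mem_range.1 hk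
  rw [hμ _ _ (by positivity) (by gcongr; linarith)]
  calc ((k : ℝ) + 1) * (T / n) ≤ n * (T / n) := by gcongr
    _ = T := by field_simp

theorem IsDriver.tendsto_riemannSum {m G : ℝ → ℝ} (hm : IsDriver m) (hG : Regulated G) {T : ℝ}
    (hT : 0 ≤ T) :
    Tendsto (fun n : ℕ => ∑ k ∈ Finset.range n,
      G (k * (T / n)) * (m ((k + 1) * (T / n)) - m (k * (T / n)))) atTop
      (𝓝 (stieltjesIntegral m (Function.leftLim G) T)) := by
  rcases hT.eq_or_lt with rfl | hT
  · simp [stieltjesIntegral_zero_time]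
  · obtain ⟨μ, h1, h2⟩ := hm.exists_measure T
    rw [h2]
    exact tendsto_riemannSum_eq hG hT h1

/-- On `[0, T]`, all the Stieltjes integrals are given by the same signed measure. -/
theorem IsDriver.exists_measure_forall {m : ℝ → ℝ} (hm : IsDriver m) (T : ℝ) :
    ∃ μ : VectorMeasure ℝ ℝ, (∀ a b, 0 ≤ a → a ≤ b → b ≤ T → μ (Ioc a b) = m b - m a) ∧
      ∀ G, Regulated G → ∀ t ∈ Icc 0 T,
        stieltjesIntegral m (Function.leftLim G) t = ∫ᵛ s in Ioc 0 t, Function.leftLim G s ∂•μ := by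
  obtain ⟨μ, h1, -⟩ := hm.exists_measure T
  refine ⟨μ, h1, fun G hG t ht => ?_⟩
  rcases ht.1.eq_or_lt with rfl | ht0
  · simp [stieltjesIntegral_zero_time]
  -- By definition the integral up to t uses the measure of the path stopped at t rather than at T.
  -- The two measures give the same Riemann sums, hence the same integral.
  · exact tendsto_nhds_unique (hm.tendsto_riemannSum hG ht.1)
      (tendsto_riemannSum_eq hG ht0 fun a b ha hab hb => h1 a b ha hab (hb.trans ht.2))

theorem IsDriver.tendsto_riemannSum_ceil {m G : ℝ → ℝ} (hm : IsDriver m) (hG : Regulated G)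
    {T t : ℝ} (hT : 0 < T) (ht : t ∈ Icc 0 T) :
    Tendsto (fun n : ℕ => ∑ k ∈ Finset.range ⌈t / (T / n)⌉₊,
      G (k * (T / n)) * (m ((k + 1) * (T / n)) - m (k * (T / n)))) atTop
      (𝓝 (stieltjesIntegral m (Function.leftLim G) t)) := by
  obtain ⟨μ, h1, h2⟩ := hm.exists_measure_forall T
  rw [h2 G hG t ht]
  refine Tendsto.congr' ?_ (IsingKac.tendsto_riemannSum μ hG hT ht)
  filter_upwards [eventually_gt_atTop 0] with n hn
  refine Finset.sum_congr rfl fun k hk => ?_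
  have hk' : (k : ℝ) + 1 ≤ n := by
    have h3 : ⌈t / (T / n)⌉₊ ≤ n := by
      refine Nat.ceil_le.2 ?_
      rw [div_le_iff₀ (by positivity)]
      calc t ≤ T := ht.2
        _ = n * (T / n) := by field_simp
    exact_mod_cast (Nat.succ_le_of_lt (Finset.mem_range.1 hk)).trans h3
  rw [h1 _ _ (by positivity) (by gcongr; linarith)]
  calc ((k : ℝ) + 1) * (T / n) ≤ n * (T / n) := by gcongr
    _ = T := by field_simp

/-- `V` is a total variation of the measure of `m` stopped at T, so one constant serves all
integrands. -/
theorem IsDriver.exists_abs_le {m : ℝ → ℝ} (hm : IsDriver m) (T : ℝ) :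
    ∃ V, 0 ≤ V ∧ ∀ G, Regulated G → ∀ B, (∀ s ∈ Icc 0 T, |G s| ≤ B) → ∀ t ∈ Icc 0 T,
      |stieltjesIntegral m (Function.leftLim G) t| ≤ V * B := by
  obtain ⟨μ, -, h2⟩ := hm.exists_measure_forall T
  refine ⟨μ.variation.real univ, measureReal_nonneg, fun G hG B hB t ht => ?_⟩
  have hB0 : 0 ≤ B := (abs_nonneg _).trans (hB 0 ⟨le_rfl, ht.1.trans ht.2⟩)
  rw [h2 G hG t ht, ← VectorMeasure.integral_indicator measurableSet_Ioc]
  have h3 : ∀ s, ‖(Ioc 0 t).indicator (Function.leftLim G) s‖ ≤ B := by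
    intro s
    by_cases hs : s ∈ Ioc 0 t
    · rw [indicator_of_mem hs]
      exact abs_leftLim_le hs.1 (hG.tendsto s hs.1)
        fun u hu => hB u ⟨hu.1, hu.2.trans (hs.2.trans ht.2)⟩
    · rw [indicator_of_notMem hs]; simpa using hB0
  have h4 : ∫ s, ‖(Ioc 0 t).indicator (Function.leftLim G) s‖ ∂μ.variation
      ≤ B * μ.variation.real univ := by
    refine (integral_mono_of_nonneg (Eventually.of_forall fun s => norm_nonneg _)
      (integrable_const B) (Eventually.of_forall h3)).trans ?_
    simp [mul_comm]
  have h5 : ‖(ContinuousLinearMap.lsmul ℝ ℝ : ℝ →L[ℝ] ℝ →L[ℝ] ℝ)‖ ≤ 1 :=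
    ContinuousLinearMap.opNorm_lsmul_le
  calc _ ≤ ‖(ContinuousLinearMap.lsmul ℝ ℝ : ℝ →L[ℝ] ℝ →L[ℝ] ℝ)‖ * _ :=
        VectorMeasure.norm_integral_le_integral_norm (B := ContinuousLinearMap.lsmul ℝ ℝ)
    _ ≤ 1 * ∫ s, ‖(Ioc 0 t).indicator (Function.leftLim G) s‖ ∂μ.variation := by gcongr
    _ ≤ _ := by rw [one_mul, mul_comm]; exact h4

/-- Dominated convergence for integrals of left limits over varying intervals. -/
theorem tendsto_integral_leftLim (μ : VectorMeasure ℝ ℝ) {s T : ℝ} {G : ℝ → ℝ → ℝ}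
    {D : ℝ → Set ℝ} {D₀ : Set ℝ} {g : ℝ → ℝ} {B : ℝ}
    (hG : ∀ᶠ u in 𝓝[<] s, Regulated (G u)) (hDm : ∀ u, MeasurableSet (D u))
    (hDm₀ : MeasurableSet D₀)
    (hD : ∀ᶠ u in 𝓝[<] s, D u ⊆ Ioc 0 T) (hD₀ : D₀ ⊆ Ioc 0 T)
    (hB : ∀ᶠ u in 𝓝[<] s, ∀ v ∈ Icc 0 T, |G u v| ≤ B)
    (hDlim : ∀ v, ∀ᶠ u in 𝓝[<] s, v ∈ D u ↔ v ∈ D₀)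
    (hlim : ∀ v, 0 < v → Tendsto (fun u => Function.leftLim (G u) v) (𝓝[<] s) (𝓝 (g v))) :
    Tendsto (fun u => ∫ᵛ v in D u, Function.leftLim (G u) v ∂•μ) (𝓝[<] s)
      (𝓝 (∫ᵛ v in D₀, g v ∂•μ)) := by
  simp_rw [← VectorMeasure.integral_indicator (hDm _)]
  rw [← VectorMeasure.integral_indicator hDm₀]
  refine VectorMeasure.tendsto_integral_filter_of_dominated_convergence (fun _ => |B|) ?_ ?_
    (integrable_const _) ?_
  · filter_upwards [hG, hD] with u hu hu2
    have : (D u).indicator (Function.leftLim (G u))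
        = (D u).indicator ((Ioi 0).indicator (Function.leftLim (G u))) := by
      have hsub : D u ⊆ Ioi 0 := fun v hv => mem_Ioi.2 (hu2 hv).1
      rw [indicator_indicator, inter_eq_left.2 hsub]
    rw [this]
    exact (hu.measurable.indicator (hDm u)).aestronglyMeasurable
  · filter_upwards [hG, hD, hB] with u hu hu2 hu3
    refine Eventually.of_forall fun v => ?_
    by_cases hv : v ∈ D u
    · rw [indicator_of_mem hv]
      refine le_trans ?_ (le_abs_self B)
      exact abs_leftLim_le (hu2 hv).1 (hu.tendsto v (hu2 hv).1)
        fun w hw => hu3 w ⟨hw.1, hw.2.trans (hu2 hv).2⟩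
    · rw [indicator_of_notMem hv]; simp
  · refine Eventually.of_forall fun v => ?_
    by_cases hv : v ∈ D₀
    · rw [indicator_of_mem hv]
      refine Tendsto.congr' ?_ (hlim v (hD₀ hv).1)
      filter_upwards [hDlim v] with u hu
      exact (indicator_of_mem (hu.2 hv) _).symm
    · rw [indicator_of_notMem hv]
      refine Tendsto.congr' ?_ tendsto_const_nhds
      filter_upwards [hDlim v] with u hu
      exact (indicator_of_notMem (fun h => hv (hu.1 h)) _).symm

/-- As u increases to s, the intervals (0,u] exhaust the open interval (0,s). The atom at s is lost,
which is why left limits of integrals are integrals over open intervals. -/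
theorem eventually_mem_Ioc_iff (s v : ℝ) : ∀ᶠ u in 𝓝[<] s, v ∈ Ioc 0 u ↔ v ∈ Ioo 0 s := by
  rcases lt_or_ge v s with h | h
  · filter_upwards [Ioo_mem_nhdsLT h] with u hu
    exact ⟨fun h1 => ⟨h1.1, h⟩, fun h1 => ⟨h1.1, hu.1.le⟩⟩
  · filter_upwards [self_mem_nhdsWithin] with u hu
    exact ⟨fun h1 => absurd (h1.2.trans_lt hu) (not_lt.2 h), fun h1 => absurd h1.2 (not_lt.2 h)⟩

theorem eventually_Ioc_subset {s : ℝ} : ∀ᶠ u in 𝓝[<] s, Ioc 0 u ⊆ Ioc 0 s := by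
  filter_upwards [self_mem_nhdsWithin] with u hu
  exact Ioc_subset_Ioc_right (le_of_lt hu)

/-- The second clause allows any representing measure, so that left limits of several integrals can
later be computed with the same one. -/
theorem IsDriver.regulated_stieltjesIntegral {m G : ℝ → ℝ} (hm : IsDriver m) (hG : Regulated G) :
    Regulated (stieltjesIntegral m (Function.leftLim G)) ∧
    ∀ s, 0 < s → ∀ μ : VectorMeasure ℝ ℝ, (∀ G, Regulated G → ∀ t ∈ Icc 0 s,
        stieltjesIntegral m (Function.leftLim G) t = ∫ᵛ s in Ioc 0 t, Function.leftLim G s ∂•μ) →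
      Function.leftLim (stieltjesIntegral m (Function.leftLim G)) s
        = ∫ᵛ v in Ioo 0 s, Function.leftLim G v ∂•μ := by
  have key : ∀ s, 0 < s → ∀ μ : VectorMeasure ℝ ℝ, (∀ G, Regulated G → ∀ t ∈ Icc 0 s,
        stieltjesIntegral m (Function.leftLim G) t = ∫ᵛ s in Ioc 0 t, Function.leftLim G s ∂•μ) →
      Tendsto (stieltjesIntegral m (Function.leftLim G)) (𝓝[<] s)
        (𝓝 (∫ᵛ v in Ioo 0 s, Function.leftLim G v ∂•μ)) := by
    intro s hs μ hμ
    obtain ⟨B, hB⟩ := hG.bdd s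
    have := tendsto_integral_leftLim μ (s := s) (T := s) (G := fun _ => G) (D := fun u => Ioc 0 u)
      (D₀ := Ioo 0 s) (g := Function.leftLim G) (B := B) (Eventually.of_forall fun _ => hG)
      (fun _ => measurableSet_Ioc) measurableSet_Ioo eventually_Ioc_subset Ioo_subset_Ioc_self
      (Eventually.of_forall fun _ => hB) (eventually_mem_Ioc_iff s) (fun v _ => tendsto_const_nhds)
    refine Tendsto.congr' ?_ this
    filter_upwards [Ioo_mem_nhdsLT hs] with u hu using (hμ G hG u ⟨hu.1.le, hu.2.le⟩).symm
  refine ⟨⟨fun s hs => ?_, fun T => ?_⟩, fun s hs μ hμ => leftLim_eq_of_tendsto (key s hs μ hμ)⟩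
  · obtain ⟨μ, -, hμ⟩ := hm.exists_measure_forall s
    exact tendsto_leftLim_of_exists (key s hs μ hμ)
  · obtain ⟨V, -, hV⟩ := hm.exists_abs_le T
    obtain ⟨B, hB⟩ := hG.bdd T
    exact ⟨V * B, hV G hG B hB⟩

/-- All three limits are dominated convergence with respect to one signed measure. They differ in
the domain of integration: fixed half-open, fixed open, and (0,u] growing to (0,s). The last one
handles a parameter that moves together with the time. -/
theorem IsDriver.tendsto_stieltjesIntegral {m : ℝ → ℝ} (hm : IsDriver m) {G : ℝ → ℝ → ℝ} {s : ℝ}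
    (hs : 0 < s) (hG : ∀ u, 0 ≤ u → Regulated (G u))
    (hB : ∀ T, ∃ B, ∀ u ∈ Icc 0 s, ∀ v ∈ Icc 0 T, |G u v| ≤ B)
    (hlim : ∀ v, 0 < v → Tendsto (fun u => Function.leftLim (G u) v) (𝓝[<] s)
      (𝓝 (Function.leftLim (G s) v))) :
    (∀ t, 0 ≤ t → Tendsto (fun u => stieltjesIntegral m (Function.leftLim (G u)) t) (𝓝[<] s)
      (𝓝 (stieltjesIntegral m (Function.leftLim (G s)) t))) ∧
    (∀ t, 0 < t → Tendsto
      (fun u => Function.leftLim (stieltjesIntegral m (Function.leftLim (G u))) t) (𝓝[<] s)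
      (𝓝 (Function.leftLim (stieltjesIntegral m (Function.leftLim (G s))) t))) ∧
    Tendsto (fun u => stieltjesIntegral m (Function.leftLim (G u)) u) (𝓝[<] s)
      (𝓝 (Function.leftLim (stieltjesIntegral m (Function.leftLim (G s))) s)) := by
  have hpos : ∀ᶠ u in 𝓝[<] s, u ∈ Ioo 0 s := Ioo_mem_nhdsLT hs
  have hGe : ∀ᶠ u in 𝓝[<] s, Regulated (G u) := hpos.mono fun u hu => hG u hu.1.le
  have hBe : ∀ T, ∃ B, ∀ᶠ u in 𝓝[<] s, ∀ v ∈ Icc 0 T, |G u v| ≤ B := fun T => by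
    obtain ⟨B, hB⟩ := hB T
    exact ⟨B, hpos.mono fun u hu => hB u ⟨hu.1.le, hu.2.le⟩⟩
  refine ⟨fun t ht => ?_, fun t ht => ?_, ?_⟩
  · obtain ⟨μ, -, hμ⟩ := hm.exists_measure_forall t
    obtain ⟨B, hB⟩ := hBe t
    rw [hμ _ (hG s hs.le) t ⟨ht, le_rfl⟩]
    refine Tendsto.congr' ?_ (tendsto_integral_leftLim μ (D := fun _ => Ioc 0 t) (D₀ := Ioc 0 t) hGe
      (fun _ => measurableSet_Ioc) measurableSet_Ioc (Eventually.of_forall fun _ => subset_rfl)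
      subset_rfl hB (fun v => Eventually.of_forall fun _ => Iff.rfl) hlim)
    filter_upwards [hGe] with u hu using (hμ _ hu t ⟨ht, le_rfl⟩).symm
  · obtain ⟨μ, -, hμ⟩ := hm.exists_measure_forall t
    obtain ⟨B, hB⟩ := hBe t
    rw [(hm.regulated_stieltjesIntegral (hG s hs.le)).2 t ht μ hμ]
    refine Tendsto.congr' ?_ (tendsto_integral_leftLim μ (D := fun _ => Ioo 0 t) (D₀ := Ioo 0 t) hGe
      (fun _ => measurableSet_Ioo) measurableSet_Ioo
      (Eventually.of_forall fun _ => Ioo_subset_Ioc_self)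
      Ioo_subset_Ioc_self hB (fun v => Eventually.of_forall fun _ => Iff.rfl) hlim)
    filter_upwards [hGe] with u hu using ((hm.regulated_stieltjesIntegral hu).2 t ht μ hμ).symm
  · obtain ⟨μ, -, hμ⟩ := hm.exists_measure_forall s
    obtain ⟨B, hB⟩ := hBe s
    rw [(hm.regulated_stieltjesIntegral (hG s hs.le)).2 s hs μ hμ]
    refine Tendsto.congr' ?_ (tendsto_integral_leftLim μ (D := fun u => Ioc 0 u) (D₀ := Ioo 0 s) hGe
      (fun _ => measurableSet_Ioc) measurableSet_Ioo eventually_Ioc_subset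
      Ioo_subset_Ioc_self hB (eventually_mem_Ioc_iff s) hlim)
    filter_upwards [hGe, hpos] with u hu hu2 using (hμ _ hu u ⟨hu2.1.le, hu2.2.le⟩).symm

section

/-! ### Pathwise properties of iterated integrals -/

/-- The deterministic kernels for which iterated integrals are considered. -/
structure Admissible {N n : ℕ} (F : TimeSpaceKernel N n) : Prop where
  leftContinuous : LeftContinuousInTimes F
  locallyBounded : LocallyBounded F

variable {N n : ℕ}

theorem cons_nonneg {r : ℝ} {rs : Fin n → ℝ} (hr : 0 ≤ r) (hrs : ∀ i, 0 ≤ rs i) (i : Fin (n + 1)) :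
    0 ≤ (Fin.cons r rs : Fin (n + 1) → ℝ) i := by
  cases i using Fin.cases with
  | zero => simpa using hr
  | succ i => simpa using hrs i

theorem cons_mem_Icc {r T : ℝ} {rs : Fin n → ℝ} (hr : r ∈ Icc 0 T) (hrs : ∀ i, rs i ∈ Icc 0 T)
    (i : Fin (n + 1)) : (Fin.cons r rs : Fin (n + 1) → ℝ) i ∈ Icc 0 T := by
  cases i using Fin.cases with
  | zero => simpa using hr
  | succ i => simpa using hrs i

theorem Admissible.freezeFirst {F : TimeSpaceKernel N (n + 1)} (hF : Admissible F) {s : ℝ}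
    (hs : 0 ≤ s) (y : Torus N) : Admissible (freezeFirst F s y) := by
  refine ⟨fun r ys hr i => ?_, fun T => ?_⟩
  · have := hF.leftContinuous (Fin.cons s r) (Fin.cons y ys) (cons_nonneg hs hr) i.succ
    simpa [IsingKac.freezeFirst, Fin.cons_update] using this
  · obtain ⟨B, hB⟩ := hF.locallyBounded (max s T)
    refine ⟨B, fun r ys hr => hB _ _ (cons_mem_Icc ⟨hs, le_max_left _ _⟩ fun i => ?_)⟩
    exact ⟨(hr i).1, (hr i).2.trans (le_max_right _ _)⟩

theorem Admissible.tendsto_freezeFirst {F : TimeSpaceKernel N (n + 1)} (hF : Admissible F) {s : ℝ}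
    (hs : 0 < s) (y : Torus N) {rs : Fin n → ℝ} (hrs : ∀ i, 0 ≤ rs i) (ys : Fin n → Torus N) :
    Tendsto (fun u => IsingKac.freezeFirst F u y rs ys) (𝓝[<] s)
      (𝓝 (IsingKac.freezeFirst F s y rs ys)) := by
  have := hF.leftContinuous (Fin.cons s rs) (Fin.cons y ys) (cons_nonneg hs.le hrs) 0
  simp only [Fin.cons_zero, Fin.update_cons_zero, ContinuousWithinAt] at this
  refine this.mono_left ?_
  refine nhdsWithin_le_of_mem ?_
  filter_upwards [Ioo_mem_nhdsLT hs] with u hu using ⟨hu.1.le, hu.2.le⟩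

theorem Admissible.exists_bound {F : TimeSpaceKernel N (n + 1)} (hF : Admissible F) (s T : ℝ) :
    ∃ B, ∀ u ∈ Icc 0 s, ∀ y, ∀ r : Fin n → ℝ, ∀ ys, (∀ i, r i ∈ Icc 0 T) →
      |IsingKac.freezeFirst F u y r ys| ≤ B := by
  obtain ⟨B, hB⟩ := hF.locallyBounded (max s T)
  refine ⟨B, fun u hu y r ys hr => hB _ _ (cons_mem_Icc ⟨hu.1, hu.2.trans (le_max_left _ _)⟩ ?_)⟩
  exact fun i => ⟨(hr i).1, (hr i).2.trans (le_max_right _ _)⟩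

theorem Regulated.sum {ι : Type*} (s : Finset ι) (c : ι → ℝ) {G : ι → ℝ → ℝ}
    (hG : ∀ i, Regulated (G i)) : Regulated (fun t => ∑ i ∈ s, c i * G i t) := by
  refine ⟨fun t ht => tendsto_leftLim_of_exists
    (tendsto_finsetSum s fun i _ => ((hG i).tendsto t ht).const_mul (c i)), fun T => ?_⟩
  choose B hB using fun i => (hG i).bdd T
  refine ⟨∑ i ∈ s, |c i| * B i, fun t ht => (Finset.abs_sum_le_sum_abs _ _).trans ?_⟩
  refine Finset.sum_le_sum fun i _ => ?_
  rw [abs_mul]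
  exact mul_le_mul_of_nonneg_left (hB i t ht) (abs_nonneg _)

theorem leftLim_sum {ι : Type*} (s : Finset ι) (c : ι → ℝ) {G : ι → ℝ → ℝ} {t : ℝ} (ht : 0 < t)
    (hG : ∀ i, Regulated (G i)) :
    Function.leftLim (fun t => ∑ i ∈ s, c i * G i t) t
      = ∑ i ∈ s, c i * Function.leftLim (G i) t :=
  leftLim_eq_of_tendsto (tendsto_finsetSum s fun i _ => ((hG i).tendsto t ht).const_mul (c i))

/-- The induction hypothesis used to study iterated integrals along a path: bounds, regularity in
time, and continuity with respect to the kernel. -/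
structure PathwiseRegular (ε : ℝ) (M : ℝ → Torus N → ℝ) (n : ℕ) : Prop where
  bound : ∀ T, 0 ≤ T → ∃ V, 0 ≤ V ∧ ∀ F : TimeSpaceKernel N n, Admissible F → ∀ B,
    (∀ r y, (∀ i, r i ∈ Icc 0 T) → |F r y| ≤ B) → ∀ t ∈ Icc 0 T,
      |iteratedIntegral ε M n F t| ≤ V * B
  regulated : ∀ F : TimeSpaceKernel N n, Admissible F → Regulated (iteratedIntegral ε M n F)
  continuous : ∀ (F : ℝ → TimeSpaceKernel N n) (s : ℝ), 0 < s → (∀ u, 0 ≤ u → Admissible (F u)) →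
    (∀ T, ∃ B, ∀ u ∈ Icc 0 s, ∀ r y, (∀ i, r i ∈ Icc 0 T) → |F u r y| ≤ B) →
    (∀ r y, (∀ i, 0 ≤ r i) → Tendsto (fun u => F u r y) (𝓝[<] s) (𝓝 (F s r y))) →
    (∀ t, 0 ≤ t → Tendsto (fun u => iteratedIntegral ε M n (F u) t) (𝓝[<] s)
      (𝓝 (iteratedIntegral ε M n (F s) t))) ∧
    (∀ t, 0 < t → Tendsto (fun u => Function.leftLim (iteratedIntegral ε M n (F u)) t) (𝓝[<] s)
      (𝓝 (Function.leftLim (iteratedIntegral ε M n (F s)) t))) ∧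
    Tendsto (fun u => iteratedIntegral ε M n (F u) u) (𝓝[<] s)
      (𝓝 (Function.leftLim (iteratedIntegral ε M n (F s)) s))

/-- The diagonal process `s ↦ I_n F^{(s,y)}(s)`. -/
noncomputable def diagIntegral (ε : ℝ) (M : ℝ → Torus N → ℝ) (n : ℕ) (F : TimeSpaceKernel N (n + 1))
    (y : Torus N) (s : ℝ) : ℝ := iteratedIntegral ε M n (freezeFirst F s y) s

theorem iteratedIntegral_succ (ε : ℝ) (M : ℝ → Torus N → ℝ) (F : TimeSpaceKernel N (n + 1))
    (t : ℝ) : iteratedIntegral ε M (n + 1) F t = ∑ y : Torus N, ε ^ 2 *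
      stieltjesIntegral (fun s => M s y) (Function.leftLim (diagIntegral ε M n F y)) t := rfl

/-- Kernel parameter and evaluation time move together here, which is the situation of the third
limit in `PathwiseRegular.continuous`; its hypothesis is the left-continuity of `F` in its first
time. -/
theorem PathwiseRegular.tendsto_diag {ε : ℝ} {M : ℝ → Torus N → ℝ} (h : PathwiseRegular ε M n)
    {F : TimeSpaceKernel N (n + 1)} (hF : Admissible F) (y : Torus N) {s : ℝ} (hs : 0 < s) :
    Tendsto (diagIntegral ε M n F y) (𝓝[<] s)
      (𝓝 (Function.leftLim (iteratedIntegral ε M n (freezeFirst F s y)) s)) :=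
  (h.continuous (fun u => freezeFirst F u y) s hs (fun u hu => hF.freezeFirst hu y)
    (fun T => by
      obtain ⟨B, hB⟩ := hF.exists_bound s T
      exact ⟨B, fun u hu r ys hr => hB u hu y r ys hr⟩)
    (fun r ys hr => hF.tendsto_freezeFirst hs y hr ys)).2.2

/-- Freezing the parameter at its limit s does not alter the left limit. The integrand at s is thus
controlled by the process of the single kernel F^{(s,y)}, to which an induction hypothesis can be
applied. -/
theorem PathwiseRegular.leftLim_diag {ε : ℝ} {M : ℝ → Torus N → ℝ} (h : PathwiseRegular ε M n)
    {F : TimeSpaceKernel N (n + 1)} (hF : Admissible F) (y : Torus N) {s : ℝ} (hs : 0 < s) :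
    Function.leftLim (diagIntegral ε M n F y) s
      = Function.leftLim (iteratedIntegral ε M n (freezeFirst F s y)) s :=
  leftLim_eq_of_tendsto (h.tendsto_diag hF y hs)

theorem PathwiseRegular.regulated_diag {ε : ℝ} {M : ℝ → Torus N → ℝ} (h : PathwiseRegular ε M n)
    {F : TimeSpaceKernel N (n + 1)} (hF : Admissible F) (y : Torus N) :
    Regulated (diagIntegral ε M n F y) := by
  refine ⟨fun s hs => tendsto_leftLim_of_exists (h.tendsto_diag hF y hs), fun T => ?_⟩
  rcases lt_or_ge T 0 with hT | hT
  · exact ⟨0, fun s hs => absurd (hs.1.trans hs.2) (not_le.2 hT)⟩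
  obtain ⟨V, -, hV⟩ := h.bound T hT
  obtain ⟨B, hB⟩ := hF.exists_bound T T
  exact ⟨V * B, fun s hs => hV _ (hF.freezeFirst hs.1 y) B (fun r ys hr => hB s hs y r ys hr) s hs⟩

/-- The three properties must be proved simultaneously: continuity in the kernel gives the next
diagonal process its left limits, the bound supplies the domination, and regularity in time makes
the next Stieltjes integral a limit of Riemann sums. -/
theorem pathwiseRegular (ε : ℝ) {M : ℝ → Torus N → ℝ} (hM : ∀ y, IsDriver fun s => M s y) (n : ℕ) :
    PathwiseRegular ε M n := by
  induction n with
  | zero =>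
    have e : ∀ F : TimeSpaceKernel N 0, iteratedIntegral ε M 0 F
        = fun _ => F Fin.elim0 Fin.elim0 := fun F => rfl
    have el : ∀ (F : TimeSpaceKernel N 0) t, Function.leftLim (iteratedIntegral ε M 0 F) t
        = F Fin.elim0 Fin.elim0 := fun F t => by
      rw [e]; exact leftLim_eq_of_tendsto tendsto_const_nhds
    refine ⟨fun T hT => ⟨1, zero_le_one, fun F _ B hB t _ => ?_⟩, fun F _ => ⟨fun s _ => ?_,
      fun T => ⟨|F Fin.elim0 Fin.elim0|, fun s _ => le_rfl⟩⟩, fun F s hs _ _ h => ?_⟩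
    · rw [one_mul]; exact hB _ _ fun i => i.elim0
    · rw [e]; exact tendsto_leftLim_of_exists tendsto_const_nhds
    · have h0 := h Fin.elim0 Fin.elim0 fun i => i.elim0
      refine ⟨fun t _ => h0, fun t _ => ?_, ?_⟩
      · simp only [el]; exact h0
      · simp only [el]; exact h0
  | succ n ih =>
    have bound : ∀ T, 0 ≤ T → ∃ V, 0 ≤ V ∧ ∀ F : TimeSpaceKernel N (n + 1), Admissible F → ∀ B,
        (∀ r y, (∀ i, r i ∈ Icc 0 T) → |F r y| ≤ B) → ∀ t ∈ Icc 0 T,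
        |iteratedIntegral ε M (n + 1) F t| ≤ V * B := by
      intro T hT
      obtain ⟨V, hV0, hV⟩ := ih.bound T hT
      choose W hW0 hW using fun y => (hM y).exists_abs_le T
      refine ⟨∑ y, ε ^ 2 * (W y * V),
        Finset.sum_nonneg fun y _ => mul_nonneg (sq_nonneg _) (mul_nonneg (hW0 y) hV0),
        fun F hF B hB t ht => ?_⟩
      rw [iteratedIntegral_succ, Finset.sum_mul]
      refine (Finset.abs_sum_le_sum_abs _ _).trans (Finset.sum_le_sum fun y _ => ?_)
      rw [abs_mul, abs_of_nonneg (sq_nonneg ε), mul_assoc, mul_assoc]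
      refine mul_le_mul_of_nonneg_left ?_ (sq_nonneg ε)
      refine hW y _ (ih.regulated_diag hF y) (V * B) (fun s hs => ?_) t ht
      exact hV _ (hF.freezeFirst hs.1 y) B (fun r ys hr => hB _ _ (cons_mem_Icc hs hr)) s hs
    have hreg : ∀ F : TimeSpaceKernel N (n + 1), Admissible F → ∀ y, Regulated
        (stieltjesIntegral (fun s => M s y) (Function.leftLim (diagIntegral ε M n F y))) :=
      fun F hF y => ((hM y).regulated_stieltjesIntegral (ih.regulated_diag hF y)).1
    have e : ∀ F : TimeSpaceKernel N (n + 1), iteratedIntegral ε M (n + 1) F = fun t =>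
        ∑ y : Torus N, ε ^ 2 * stieltjesIntegral (fun s => M s y)
          (Function.leftLim (diagIntegral ε M n F y)) t := fun F => rfl
    refine ⟨bound, fun F hF => ?_, fun F s hs hF hB hlim => ?_⟩
    · rw [e]
      exact Regulated.sum _ (fun _ => ε ^ 2) (hreg F hF)
    · have key : ∀ y : Torus N, _ := fun y => (hM y).tendsto_stieltjesIntegral
        (G := fun u => diagIntegral ε M n (F u) y) hs
        (fun u hu => ih.regulated_diag (hF u hu) y)
        (fun T => by
          rcases lt_or_ge T 0 with hT | hT
          · exact ⟨0, fun u _ v hv => absurd (hv.1.trans hv.2) (not_le.2 hT)⟩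
          obtain ⟨V, -, hV⟩ := ih.bound T hT
          obtain ⟨B, hB⟩ := hB T
          exact ⟨V * B, fun u hu v hv => hV _ ((hF u hu.1).freezeFirst hv.1 y) B
            (fun r ys hr => hB u hu _ _ (cons_mem_Icc hv hr)) v hv⟩)
        -- At a fixed inner time v the left limit of the diagonal process is that of the kernel
        -- frozen at v. Its continuity in the outer parameter is the second limit in the induction
        -- hypothesis.
        (fun v hv => by
          have := (ih.continuous (fun u => freezeFirst (F u) v y) s hs
            (fun u hu => (hF u hu).freezeFirst hv.le y)
            (fun T => by
              obtain ⟨B, hB⟩ := hB (max v T)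
              exact ⟨B, fun u hu r ys hr => hB u hu _ _
                (cons_mem_Icc ⟨hv.le, le_max_left _ _⟩ fun i =>
                  ⟨(hr i).1, (hr i).2.trans (le_max_right _ _)⟩)⟩)
            (fun r ys hr => hlim _ _ (cons_nonneg hv.le hr))).2.1 v hv
          rw [ih.leftLim_diag (hF s hs.le) y hv]
          refine Tendsto.congr' ?_ this
          filter_upwards [Ioo_mem_nhdsLT hs] with u hu
          exact (ih.leftLim_diag (hF u hu.1.le) y hv).symm)
      refine ⟨fun t ht => tendsto_finsetSum _ fun y _ => ((key y).1 t ht).const_mul _,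
        fun t ht => ?_, ?_⟩
      · rw [e, leftLim_sum _ _ ht (hreg _ (hF s hs.le))]
        refine Tendsto.congr' ?_
          (tendsto_finsetSum _ fun y _ => ((key y).2.1 t ht).const_mul (ε ^ 2))
        filter_upwards [Ioo_mem_nhdsLT hs] with u hu
        rw [e, leftLim_sum _ _ ht (hreg _ (hF u hu.1.le))]
      · rw [e (F s), leftLim_sum _ _ hs (hreg _ (hF s hs.le))]
        exact tendsto_finsetSum _ fun y _ => (key y).2.2.const_mul _

/-- Iterated integrals are limits of left-point Riemann sums. -/
theorem tendsto_riemannSum_iteratedIntegral (ε : ℝ) {M : ℝ → Torus N → ℝ}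
    (hM : ∀ y, IsDriver fun s => M s y) {F : TimeSpaceKernel N (n + 1)} (hF : Admissible F) {t : ℝ}
    (ht : 0 ≤ t) :
    Tendsto (fun m : ℕ => ∑ y : Torus N, ε ^ 2 * ∑ k ∈ Finset.range m,
      diagIntegral ε M n F y (k * (t / m)) * (M ((k + 1) * (t / m)) y - M (k * (t / m)) y)) atTop
      (𝓝 (iteratedIntegral ε M (n + 1) F t)) :=
  tendsto_finsetSum _ fun y _ => ((hM y).tendsto_riemannSum
    ((pathwiseRegular ε hM n).regulated_diag hF y) ht).const_mul _

/-- The partition is that of [0,T] for every t, so the supremum over t is reached by running maxima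
of one discrete process. -/
theorem tendsto_riemannSum_iteratedIntegral_ceil (ε : ℝ) {M : ℝ → Torus N → ℝ}
    (hM : ∀ y, IsDriver fun s => M s y) {F : TimeSpaceKernel N (n + 1)} (hF : Admissible F)
    {T t : ℝ} (hT : 0 < T) (ht : t ∈ Icc 0 T) :
    Tendsto (fun m : ℕ => ∑ y : Torus N, ε ^ 2 * ∑ k ∈ Finset.range ⌈t / (T / m)⌉₊,
      diagIntegral ε M n F y (k * (T / m)) * (M ((k + 1) * (T / m)) y - M (k * (T / m)) y)) atTop
      (𝓝 (iteratedIntegral ε M (n + 1) F t)) :=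
  tendsto_finsetSum _ fun y _ => ((hM y).tendsto_riemannSum_ceil
    ((pathwiseRegular ε hM n).regulated_diag hF y) hT ht).const_mul _

theorem Admissible.sum {ι : Type*} (s : Finset ι) (c : ι → ℝ) {F : ι → TimeSpaceKernel N n}
    (hF : ∀ i, Admissible (F i)) : Admissible (fun r y => ∑ i ∈ s, c i * F i r y) := by
  refine ⟨fun r y hr j => ?_, fun T => ?_⟩
  · exact tendsto_finsetSum s fun i _ => ((hF i).leftContinuous r y hr j).const_mul (c i)
  · choose B hB using fun i => (hF i).locallyBounded T
    refine ⟨∑ i ∈ s, |c i| * B i, fun r y hr => (Finset.abs_sum_le_sum_abs _ _).trans ?_⟩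
    refine Finset.sum_le_sum fun i _ => ?_
    rw [abs_mul]
    exact mul_le_mul_of_nonneg_left (hB i r y hr) (abs_nonneg _)

/-- Linearity is evident for Riemann sums and passes to the limit, by induction on n. -/
theorem iteratedIntegral_sum (ε : ℝ) {M : ℝ → Torus N → ℝ} (hM : ∀ y, IsDriver fun s => M s y)
    {ι : Type*} (s : Finset ι) (c : ι → ℝ) {F : ι → TimeSpaceKernel N n}
    (hF : ∀ i, Admissible (F i)) {t : ℝ} (ht : 0 ≤ t) :
    iteratedIntegral ε M n (fun r y => ∑ i ∈ s, c i * F i r y) t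
      = ∑ i ∈ s, c i * iteratedIntegral ε M n (F i) t := by
  induction n generalizing t with
  | zero => rfl
  | succ n ih =>
    refine tendsto_nhds_unique
      (tendsto_riemannSum_iteratedIntegral ε hM (Admissible.sum s c hF) ht)
      (Tendsto.congr (fun m => ?_) (tendsto_finsetSum s fun i _ =>
        (tendsto_riemannSum_iteratedIntegral ε hM (hF i) ht).const_mul (c i)))
    have e : ∀ y u, 0 ≤ u → diagIntegral ε M n (fun r y => ∑ i ∈ s, c i * F i r y) y u
        = ∑ i ∈ s, c i * diagIntegral ε M n (F i) y u := fun y u hu =>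
      ih (F := fun i => freezeFirst (F i) u y) (fun i => (hF i).freezeFirst hu y) hu
    simp_rw [fun (y : Torus N) (k : ℕ) => e y (k * (t / m)) (by positivity), Finset.mul_sum,
      Finset.sum_mul, Finset.mul_sum]
    rw [Finset.sum_comm]
    refine Finset.sum_congr rfl fun y _ => ?_
    rw [Finset.sum_comm]
    exact Finset.sum_congr rfl fun k _ => Finset.sum_congr rfl fun i _ => by ring

end

/-! ### Pure jump paths -/

/-- Paths on `[0, ∞)` in a discrete space that are right-continuous with left limits. -/
structure IsJumpPath {S : Type*} (x : ℝ → S) : Prop where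
  right : ∀ t, 0 ≤ t → ∀ᶠ s in 𝓝[>] t, x s = x t
  left : ∀ t, 0 < t → ∃ a, ∀ᶠ s in 𝓝[<] t, x s = a

theorem boundedVariationOn_sub {α : Type*} [LinearOrder α] {f g : α → ℝ} {s : Set α}
    (hf : BoundedVariationOn f s) (hg : BoundedVariationOn g s) :
    BoundedVariationOn (fun x => f x - g x) s := by
  refine ne_top_of_le_ne_top (ENNReal.add_ne_top.2 ⟨hf, hg⟩) (iSup_le fun p => ?_)
  refine le_trans ?_ (add_le_add (eVariationOn.sum_le (f := f) (n := p.1) p.2.2.1 p.2.2.2)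
    (eVariationOn.sum_le (f := g) (n := p.1) p.2.2.1 p.2.2.2))
  rw [← Finset.sum_add_distrib]
  refine Finset.sum_le_sum fun i _ => ?_
  simp only [sub_eq_add_neg]
  refine (edist_add_add_le _ _ _ _).trans ?_
  rw [edist_neg_neg]

theorem boundedVariationOn_step {s : Set ℝ} (c a b : ℝ) :
    BoundedVariationOn (fun u => if u < c then a else b) s := by
  have h1 : BoundedVariationOn (fun u => if u < c then (0 : ℝ) else 1) s := by
    refine MonotoneOn.boundedVariationOn (C := 1) (fun u _ v _ huv => ?_) fun u _ => ?_
    · split_ifs <;> linarith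
    · split_ifs <;> simp
  have h2 : LipschitzWith ‖b - a‖₊ fun v : ℝ => a + v * (b - a) := by
    refine LipschitzWith.of_dist_le_mul fun u v => ?_
    rw [Real.dist_eq, Real.dist_eq, coe_nnnorm, Real.norm_eq_abs, ← abs_mul]
    exact le_of_eq (by congr 1; ring)
  have := h2.comp_boundedVariationOn h1
  refine ne_of_eq_of_ne (eVariationOn.congr fun u _ => ?_) this
  simp only [Function.comp]
  split_ifs <;> ring

/-- Near each time the path is a step function with at most one jump. A Lebesgue number for these
neighbourhoods cuts [0,T] into finitely many intervals, each inside one of them. -/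
theorem IsJumpPath.boundedVariationOn {S : Type*} {x : ℝ → S} (hx : IsJumpPath x) (f : S → ℝ)
    (T : ℝ) : BoundedVariationOn (fun u => f (x u)) (Icc 0 T) := by
  rcases lt_or_ge T 0 with hT | hT
  · rw [Icc_eq_empty (not_le.2 hT)]
    exact BoundedVariationOn.of_subsingleton subsingleton_empty
  have hloc : ∀ t ∈ Icc 0 T, ∃ U, IsOpen U ∧ t ∈ U ∧
      BoundedVariationOn (fun u => f (x u)) (U ∩ Icc 0 T) := by
    intro t ht
    have hr : ∃ d > t, ∀ u ∈ Ioo t d, x u = x t := by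
      obtain ⟨d, hd, h⟩ := mem_nhdsGT_iff_exists_Ioo_subset.1 (hx.right t ht.1)
      exact ⟨d, hd, fun u hu => h hu⟩
    have hl : ∃ c < t, ∃ a, ∀ u ∈ Ioo c t ∩ Icc 0 T, x u = a := by
      rcases ht.1.eq_or_lt with h0 | h0
      · refine ⟨t - 1, by linarith, x 0, fun u hu => ?_⟩
        exact absurd hu.1.2 (not_lt.2 (h0 ▸ hu.2.1))
      · obtain ⟨a, ha⟩ := hx.left t h0
        obtain ⟨c, hc, h⟩ := mem_nhdsLT_iff_exists_Ioo_subset.1 ha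
        exact ⟨c, hc, a, fun u hu => h hu.1⟩
    obtain ⟨d, hd, hr⟩ := hr
    obtain ⟨c, hc, a, hl⟩ := hl
    refine ⟨Ioo c d, isOpen_Ioo, ⟨hc, hd⟩, ?_⟩
    refine ne_of_eq_of_ne (eVariationOn.congr fun u hu => ?_) (boundedVariationOn_step t (f a) (f (x t)))
    split_ifs with h
    · rw [hl u ⟨⟨hu.1.1, h⟩, hu.2⟩]
    · rcases (not_lt.1 h).eq_or_lt with h1 | h1
      · rw [h1]
      · rw [hr u ⟨h1, hu.1.2⟩]
  choose! U hUo hUt hU using hloc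
  obtain ⟨δ, hδ, hball⟩ := lebesgue_number_lemma_of_metric (s := Icc 0 T) isCompact_Icc
    (c := fun t : Icc 0 T => U t) (fun t => hUo t t.2)
    (fun t ht => mem_iUnion.2 ⟨⟨t, ht⟩, hUt t ht⟩)
  obtain ⟨n, hn⟩ := exists_nat_gt (T / δ)
  have hn0 : 0 < (n : ℝ) := lt_of_le_of_lt (by positivity) hn
  have hTn : T / n < δ := by rw [div_lt_iff₀ hn0]; rwa [div_lt_iff₀ hδ, mul_comm] at hn
  have hmono : Monotone fun k : ℕ => (k : ℝ) * (T / n) := fun a b hab => by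
    have : (a : ℝ) ≤ b := by exact_mod_cast hab
    simp only; gcongr
  have hsum := eVariationOn.sum' (fun u => f (x u)) hmono (n := n)
  have e : (n : ℝ) * (T / n) = T := by field_simp
  rw [e] at hsum
  simp only [Nat.cast_zero, zero_mul] at hsum
  rw [BoundedVariationOn, ← hsum]
  refine ENNReal.sum_ne_top.2 fun k hk => ?_
  have hk' : (k : ℝ) + 1 ≤ n := by exact_mod_cast Finset.mem_range.1 hk
  have hkT : ((k : ℝ) + 1) * (T / n) ≤ T := by
    calc ((k : ℝ) + 1) * (T / n) ≤ n * (T / n) := by gcongr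
      _ = T := e
  have hTn0 : 0 ≤ T / n := by positivity
  have hk0 : (k : ℝ) * (T / n) ∈ Icc 0 T := ⟨by positivity, by nlinarith⟩
  obtain ⟨i, hi⟩ := hball _ hk0
  refine ne_top_of_le_ne_top (hU i i.2) (eVariationOn.mono _ fun u hu => ⟨hi ?_, ?_, ?_⟩)
  · rw [Metric.mem_ball, Real.dist_eq, abs_of_nonneg (by linarith [hu.1])]
    have := hu.2
    push_cast at this
    linarith
  · exact hk0.1.trans hu.1
  · have := hu.2
    push_cast at this
    linarith

/-- Joint measurability in time and chance of a right-continuous process, along a time change. -/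
theorem measurable_comp_timeChange {Ω S : Type*} [MeasurableSpace Ω] {X : ℝ → Ω → S}
    (hX : ∀ ω, IsJumpPath fun t => X t ω) (f : S → ℝ) {π : ℝ → ℝ} (hπ : Continuous π)
    (hmono : Monotone π) (hπ0 : ∀ u, 0 ≤ π u) (hm : ∀ u, Measurable fun ω => f (X (π u) ω)) :
    Measurable fun q : ℝ × Ω => f (X (π q.1) q.2) := by
  -- Grid points strictly to the right of the time approximate it, so right-continuity gives
  -- pointwise convergence, with countably many times at each stage.
  refine measurable_of_tendsto_metrizable
    (f := fun (m : ℕ) (q : ℝ × Ω) => f (X (π ((⌊q.1 * (m + 1)⌋ + 1) / (m + 1))) q.2)) (fun m => ?_) ?_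
  · have h1 : Measurable fun q : ℤ × Ω => f (X (π ((q.1 + 1) / (m + 1))) q.2) :=
      measurable_from_prod_countable_right fun k => hm (((k : ℝ) + 1) / (m + 1))
    have h2 : Measurable fun q : ℝ × Ω => (⌊q.1 * (m + 1)⌋, q.2) :=
      (Int.measurable_floor.comp (measurable_fst.mul_const _)).prodMk measurable_snd
    exact h1.comp h2
  · rw [tendsto_pi_nhds]
    rintro ⟨u, ω⟩
    have hlim : Tendsto (fun m : ℕ => ((⌊u * (m + 1)⌋ : ℝ) + 1) / (m + 1)) atTop (𝓝 u) := by
      have h1 : Tendsto (fun m : ℕ => u + 1 / ((m : ℝ) + 1)) atTop (𝓝 u) := by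
        simpa using tendsto_const_nhds.add (tendsto_one_div_add_atTop_nhds_zero_nat (𝕜 := ℝ))
      refine tendsto_of_tendsto_of_tendsto_of_le_of_le tendsto_const_nhds h1 (fun m => ?_) fun m => ?_
      · have : 0 < (m : ℝ) + 1 := by positivity
        simp only
        rw [le_div_iff₀ this]; exact (Int.lt_floor_add_one _).le
      · have : 0 < (m : ℝ) + 1 := by positivity
        simp only
        rw [div_le_iff₀ this, add_mul, one_div, inv_mul_cancel₀ this.ne']
        linarith [Int.floor_le (u * (m + 1))]
    have hge : ∀ m : ℕ, u ≤ ((⌊u * (m + 1)⌋ : ℝ) + 1) / (m + 1) := fun m => by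
      have : 0 < (m : ℝ) + 1 := by positivity
      rw [le_div_iff₀ this]; exact (Int.lt_floor_add_one _).le
    have h3 : Tendsto (fun m : ℕ => π (((⌊u * (m + 1)⌋ : ℝ) + 1) / (m + 1))) atTop (𝓝[≥] (π u)) :=
      tendsto_nhdsWithin_iff.2 ⟨(hπ.tendsto u).comp hlim,
        Eventually.of_forall fun m => hmono (hge m)⟩
    have h4 : ∀ᶠ s in 𝓝[≥] (π u), X s ω = X (π u) ω := by
      have := (hX ω).right (π u) (hπ0 u)
      rw [← Ioi_insert, nhdsWithin_insert, eventually_sup]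
      exact ⟨rfl, this⟩
    refine tendsto_const_nhds.congr' ?_
    filter_upwards [h3.eventually h4] with m hm using by rw [hm]

theorem IsJumpPath.measurable {S : Type*} {x : ℝ → S} (hx : IsJumpPath x) (f : S → ℝ) :
    Measurable fun u => f (x (max 0 u)) := by
  have := measurable_comp_timeChange (Ω := Unit) (X := fun t _ => x t) (fun _ => hx) f
    (π := fun u => max 0 u) (by fun_prop) (fun a b h => max_le_max le_rfl h)
    (fun u => le_max_left _ _) (fun u => measurable_const)
  exact this.comp (measurable_id.prodMk (measurable_const (a := ())))

theorem exists_abs_le_of_finite {S : Type*} [Finite S] (f : S → ℝ) : ∃ B, 0 ≤ B ∧ ∀ a, |f a| ≤ B := by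
  obtain ⟨B, hB⟩ := (Set.finite_range fun a => |f a|).bddAbove
  exact ⟨max B 0, le_max_right _ _, fun a => (hB ⟨a, rfl⟩).trans (le_max_left _ _)⟩

theorem IsJumpPath.intervalIntegrable {S : Type*} [Finite S] {x : ℝ → S} (hx : IsJumpPath x)
    (f : S → ℝ) (a b : ℝ) : IntervalIntegrable (fun u => f (x (max 0 u))) volume a b := by
  obtain ⟨B, -, hB⟩ := exists_abs_le_of_finite f
  refine (intervalIntegrable_const (c := B)).mono_fun (hx.measurable f).aestronglyMeasurable ?_
  refine Eventually.of_forall fun u => ?_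
  exact (hB _).trans (le_abs_self B)

/-- Nothing is assumed of paths at negative times; evaluation at `max 0 u` makes the integrands
measurable on the whole line. -/
theorem integral_eq_integral_max {g : ℝ → ℝ} {a b : ℝ} (ha : 0 ≤ a) (hb : 0 ≤ b) :
    ∫ u in a..b, g u = ∫ u in a..b, g (max 0 u) := by
  refine intervalIntegral.integral_congr fun u hu => ?_
  have : 0 ≤ u := (le_min ha hb).trans hu.1
  simp only [max_eq_right this]

/-! ### Dynkin martingales -/

/-- The process `f(x(t)) - f(x(0)) - ∫₀ᵗ A f(x(s)) ds` along a path. -/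
noncomputable def dynkin {S : Type*} (A : (S → ℝ) → (S → ℝ)) (f : S → ℝ) (x : ℝ → S) (t : ℝ) : ℝ :=
  f (x t) - f (x 0) - ∫ s in (0 : ℝ)..t, A f (x s)

/-- The jump part is right-continuous and of bounded variation; the drift is Lipschitz because `A f`
is bounded on a finite space. -/
theorem IsJumpPath.isDriver_dynkin {S : Type*} [Finite S] {x : ℝ → S} (hx : IsJumpPath x)
    (A : (S → ℝ) → (S → ℝ)) (f : S → ℝ) : IsDriver (dynkin A f x) := by
  obtain ⟨B, hB0, hB⟩ := exists_abs_le_of_finite (A f)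
  have hprim : LipschitzWith ⟨B, hB0⟩ fun t => ∫ s in (0 : ℝ)..t, A f (x (max 0 s)) := by
    refine LipschitzWith.of_dist_le_mul fun s t => ?_
    rw [Real.dist_eq, intervalIntegral.integral_interval_sub_left
      (hx.intervalIntegrable _ _ _) (hx.intervalIntegrable _ _ _), Real.dist_eq, abs_sub_comm]
    rw [abs_sub_comm]
    exact intervalIntegral.norm_integral_le_of_norm_le_const (f := fun u => A f (x (max 0 u)))
      fun u _ => hB _
  have e : ∀ t, 0 ≤ t → dynkin A f x t
      = f (x t) - (f (x 0) + ∫ s in (0 : ℝ)..t, A f (x (max 0 s))) := fun t ht => by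
    rw [dynkin, integral_eq_integral_max le_rfl ht]; ring
  have hprim' : LipschitzWith ⟨B, hB0⟩ fun t => f (x 0) + ∫ s in (0 : ℝ)..t, A f (x (max 0 s)) := by
    refine LipschitzWith.of_dist_le_mul fun s t => ?_
    rw [dist_add_left]
    exact hprim.dist_le_mul s t
  refine ⟨fun t => ?_, fun t ht => ?_⟩
  · have hbv : BoundedVariationOn (dynkin A f x) (Icc 0 (max 0 t)) := by
      have h1 := boundedVariationOn_sub (hx.boundedVariationOn f (max 0 t))
        (((hprim'.locallyBoundedVariationOn (Icc 0 (max 0 t))) 0 (max 0 t)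
          ⟨le_rfl, le_max_left _ _⟩ ⟨le_max_left _ _, le_rfl⟩).mono (t := Icc 0 (max 0 t))
          (fun u hu => ⟨hu, hu⟩))
      exact ne_of_eq_of_ne (eVariationOn.congr fun u hu => e u hu.1) h1
    refine ne_top_of_le_ne_top hbv
      (eVariationOn.comp_le_of_monotoneOn (dynkin A f x) (fun s => max 0 (min s t)) ?_ ?_)
    · exact fun a _ b _ hab => max_le_max le_rfl (min_le_min_right _ hab)
    · exact fun s _ => ⟨le_max_left _ _, max_le_max le_rfl (min_le_right _ _)⟩
  · have h1 : ContinuousWithinAt (fun s => f (x s)) (Ici t) t := by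
      rw [← Ioi_insert, continuousWithinAt_insert_self]
      refine tendsto_const_nhds.congr' ?_
      filter_upwards [hx.right t ht] with s hs using by rw [hs]
    refine (h1.sub hprim'.continuous.continuousWithinAt).congr (fun u hu => ?_) ?_
    · exact e u (ht.trans hu)
    · exact e t ht

/-! ### Finite Markov jump processes -/

/-- A jump process on a finite space, Markov with generator `A` for the filtration `ℱ`. -/
structure IsMarkovJump {Ω : Type*} [mΩ : MeasurableSpace Ω] (P : Measure Ω) {S : Type*} [Fintype S]
    (A : (S → ℝ) →L[ℝ] (S → ℝ)) (ℱ : ℝ → MeasurableSpace Ω) (X : ℝ → Ω → S) : Prop where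
  mono : Monotone ℱ
  le : ∀ t, ℱ t ≤ mΩ
  adapted : ∀ t, 0 ≤ t → ∀ f : S → ℝ, Measurable[ℱ t] fun ω => f (X t ω)
  path : ∀ ω, IsJumpPath fun t => X t ω
  markov : ∀ s t, 0 ≤ s → 0 ≤ t → ∀ f : S → ℝ,
    P[fun ω => f (X (s + t) ω) | ℱ s] =ᵐ[P] fun ω => NormedSpace.exp (t • A) f (X s ω)

/-- Meant for random `g`: measurability and conditioning are reduced to the deterministic functions
`Pi.single b 1`. -/
theorem clm_apply_eq_sum {S : Type*} [Fintype S] [DecidableEq S] (L : (S → ℝ) →L[ℝ] (S → ℝ))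
    (g : S → ℝ) (a : S) : L g a = ∑ b, g b * L (Pi.single b 1) a := by
  have h : g = ∑ b, g b • (Pi.single b 1 : S → ℝ) := by
    funext a
    simp [Finset.sum_apply, Pi.single_apply]
  conv_lhs => rw [h]
  simp [map_sum, Finset.sum_apply]

/-- Second order estimate for the semigroup generated by a bounded operator. -/
theorem exists_norm_exp_sub_le {E : Type*} [NormedRing E] [NormedAlgebra ℝ E] [CompleteSpace E]
    (A : E) : ∃ K, 0 ≤ K ∧ ∀ h ∈ Icc (0 : ℝ) 1,
      ‖NormedSpace.exp (h • A) - 1 - h • A‖ ≤ K * h ^ 2 := by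
  have hd : ∀ t : ℝ, HasDerivAt (fun u : ℝ => NormedSpace.exp (u • A)) (NormedSpace.exp (t • A) * A) t :=
    fun t => hasDerivAt_exp_smul_const A t
  have hcont : Continuous fun u : ℝ => NormedSpace.exp (u • A) :=
    continuous_iff_continuousAt.2 fun t => (hd t).continuousAt
  obtain ⟨C, hC⟩ := isCompact_Icc.exists_bound_of_continuousOn (s := Icc (0 : ℝ) 1)
    hcont.continuousOn
  have hC0 : 0 ≤ C := (norm_nonneg _).trans (hC 0 ⟨le_rfl, zero_le_one⟩)
  have h1 : ∀ h ∈ Icc (0 : ℝ) 1, ‖NormedSpace.exp (h • A) - 1‖ ≤ C * ‖A‖ * h := by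
    intro h hh
    have := norm_image_sub_le_of_norm_deriv_le_segment' (a := 0) (b := 1) (C := C * ‖A‖)
      (fun x _ => (hd x).hasDerivWithinAt)
      (fun x hx => (norm_mul_le _ _).trans (by gcongr; exact hC x ⟨hx.1, hx.2.le⟩)) h hh
    simpa using this
  refine ⟨C * ‖A‖ * ‖A‖, by positivity, fun h hh => ?_⟩
  have hd2 : ∀ t : ℝ, HasDerivAt (fun u : ℝ => NormedSpace.exp (u • A) - 1 - u • A)
      (NormedSpace.exp (t • A) * A - A) t := fun t => by
    have := ((hd t).sub_const 1).fun_sub ((hasDerivAt_id t).smul_const A)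
    simpa using this
  have := norm_image_sub_le_of_norm_deriv_le_segment' (a := 0) (b := h) (C := C * ‖A‖ * h * ‖A‖)
    (fun x _ => (hd2 x).hasDerivWithinAt) (fun x hx => by
      calc ‖NormedSpace.exp (x • A) * A - A‖ = ‖(NormedSpace.exp (x • A) - 1) * A‖ := by
            rw [sub_mul, one_mul]
        _ ≤ ‖NormedSpace.exp (x • A) - 1‖ * ‖A‖ := norm_mul_le _ _
        _ ≤ C * ‖A‖ * x * ‖A‖ := by gcongr; exact h1 x ⟨hx.1, hx.2.le.trans hh.2⟩
        _ ≤ _ := by gcongr; exact hx.2.le) h ⟨hh.1, le_rfl⟩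
  simp only [zero_smul, NormedSpace.exp_zero, sub_self, sub_zero] at this
  refine this.trans (le_of_eq (by ring))

/-- Dynkin martingales are jointly measurable in time and chance. -/
theorem measurable_dynkin {Ω S : Type*} [MeasurableSpace Ω] {X : ℝ → Ω → S}
    (hX : ∀ ω, IsJumpPath fun t => X t ω) {T : ℝ} (hT : 0 ≤ T)
    (hm : ∀ t ∈ Icc 0 T, ∀ f : S → ℝ, Measurable fun ω => f (X t ω))
    (A : (S → ℝ) → (S → ℝ)) (f : S → ℝ) :
    Measurable fun q : ℝ × Ω => dynkin A f (fun t => X t q.2) (max 0 (min q.1 T)) := by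
  have h0 : ∀ f : S → ℝ, Measurable fun q : ℝ × Ω => f (X (max 0 (min q.1 T)) q.2) := fun f =>
    measurable_comp_timeChange hX f (π := fun u => max 0 (min u T)) (by fun_prop)
      (fun _ _ h => max_le_max le_rfl (min_le_min_right _ h)) (fun u => le_max_left _ _)
      fun u => hm _ ⟨le_max_left _ _, max_le hT (min_le_right _ _)⟩ f
  have h2 : Measurable fun q : ℝ × Ω => f (X 0 q.2) :=
    (hm 0 ⟨le_rfl, hT⟩ f).comp measurable_snd
  have h4 : Measurable fun q : ℝ × Ω => ∫ u, (Ioc 0 (max 0 (min q.1 T))).indicator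
      (fun u => A f (X (max 0 (min u T)) q.2)) u := by
    have h5 : Measurable fun r : (ℝ × Ω) × ℝ => (Ioc 0 (max 0 (min r.1.1 T))).indicator
        (fun u => A f (X (max 0 (min u T)) r.1.2)) r.2 := by
      have e : (fun r : (ℝ × Ω) × ℝ => (Ioc 0 (max 0 (min r.1.1 T))).indicator
        (fun u => A f (X (max 0 (min u T)) r.1.2)) r.2)
        = {r : (ℝ × Ω) × ℝ | 0 < r.2 ∧ r.2 ≤ max 0 (min r.1.1 T)}.indicator
          (fun r => A f (X (max 0 (min r.2 T)) r.1.2)) := by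
        funext r
        simp only [indicator, mem_Ioc, mem_ofPred_eq]
      rw [e]
      refine Measurable.indicator ((h0 (A f)).comp (measurable_snd.prodMk
        (measurable_snd.comp measurable_fst))) ?_
      refine (measurableSet_lt measurable_const measurable_snd).inter
        (measurableSet_le measurable_snd ?_)
      exact measurable_const.max ((measurable_fst.comp measurable_fst).min measurable_const)
    exact h5.stronglyMeasurable.integral_prod_right'.measurable
  have e : (fun q : ℝ × Ω => dynkin A f (fun t => X t q.2) (max 0 (min q.1 T)))
      = fun q => f (X (max 0 (min q.1 T)) q.2) - f (X 0 q.2)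
        - ∫ u, (Ioc 0 (max 0 (min q.1 T))).indicator
          (fun u => A f (X (max 0 (min u T)) q.2)) u := by
    funext q
    rw [dynkin, intervalIntegral.integral_of_le (le_max_left _ _),
      integral_indicator measurableSet_Ioc]
    congr 1
    refine setIntegral_congr_fun measurableSet_Ioc fun u hu => ?_
    have h6 : u ≤ T := hu.2.trans (max_le hT (min_le_right _ _))
    simp only [min_eq_left h6, max_eq_right hu.1.le]
  rw [e]
  exact ((h0 f).sub h2).sub h4

section Markov

variable {Ω : Type*} [mΩ : MeasurableSpace Ω] {P : Measure Ω}
  {S : Type*} [Fintype S] {A : (S → ℝ) →L[ℝ] (S → ℝ)} {ℱ : ℝ → MeasurableSpace Ω} {X : ℝ → Ω → S}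

theorem IsMarkovJump.adapted_of_le (hX : IsMarkovJump P A ℱ X) {s t : ℝ} (hs : 0 ≤ s) (hst : s ≤ t)
    (f : S → ℝ) : Measurable[ℱ t] fun ω => f (X s ω) :=
  (hX.adapted s hs f).mono (hX.mono hst) le_rfl

theorem IsMarkovJump.measurable (hX : IsMarkovJump P A ℱ X) {s : ℝ} (hs : 0 ≤ s)
    (f : S → ℝ) : Measurable fun ω => f (X s ω) :=
  (hX.adapted s hs f).mono (hX.le s) le_rfl

theorem integrable_of_abs_le [IsProbabilityMeasure P] {f : Ω → ℝ} (hf : Measurable f) {B : ℝ} (hB : ∀ ω, |f ω| ≤ B) :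
    Integrable f P :=
  Integrable.of_bound hf.aestronglyMeasurable B (Eventually.of_forall hB)

theorem abs_mul_le_of_le {a b A' B' : ℝ} (ha : |a| ≤ A') (hb : |b| ≤ B') : |a * b| ≤ A' * B' := by
  rw [abs_mul]
  exact mul_le_mul ha hb (abs_nonneg _) ((abs_nonneg _).trans ha)

/-- This is the form in which the Markov property is used from here on: tested against bounded
functions of the past, without conditional expectations. -/
theorem IsMarkovJump.integral_mul [IsProbabilityMeasure P] (hX : IsMarkovJump P A ℱ X) {s h : ℝ} (hs : 0 ≤ s) (hh : 0 ≤ h)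
    (f : S → ℝ) {Z : Ω → ℝ} (hZ : Measurable[ℱ s] Z) {B : ℝ} (hB : ∀ ω, |Z ω| ≤ B) :
    ∫ ω, Z ω * f (X (s + h) ω) ∂P = ∫ ω, Z ω * NormedSpace.exp (h • A) f (X s ω) ∂P := by
  obtain ⟨C, hC0, hC⟩ := exists_abs_le_of_finite f
  have hm : Measurable fun ω => f (X (s + h) ω) := hX.measurable (by linarith) f
  have hZm : Measurable Z := hZ.mono (hX.le s) le_rfl
  have i1 : Integrable (fun ω => f (X (s + h) ω)) P := integrable_of_abs_le hm fun ω => hC _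
  have i2 : Integrable (fun ω => Z ω * f (X (s + h) ω)) P :=
    integrable_of_abs_le (hZm.mul hm) fun ω => abs_mul_le_of_le (hB ω) (hC _)
  have e1 := condExp_mul_of_stronglyMeasurable_left (m := ℱ s) (μ := P) (f := Z)
    (g := fun ω => f (X (s + h) ω)) hZ.stronglyMeasurable i2 i1
  rw [← integral_condExp (hX.le s)]
  refine integral_congr_ae ?_
  filter_upwards [e1, hX.markov s h hs hh f] with ω h1 h2
  have : (fun ω => Z ω * f (X (s + h) ω)) = Z * fun ω => f (X (s + h) ω) := rfl
  rw [this, h1, Pi.mul_apply, h2]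

theorem IsMarkovJump.measurable_uncurry (hX : IsMarkovJump P A ℱ X) (f : S → ℝ) :
    Measurable fun q : ℝ × Ω => f (X (max 0 q.1) q.2) :=
  measurable_comp_timeChange hX.path f (π := fun u => max 0 u) (by fun_prop)
    (fun _ _ h => max_le_max le_rfl h) (fun u => le_max_left _ _)
    fun u => hX.measurable (le_max_left _ _) f

theorem IsMarkovJump.dynkin_increment (hX : IsMarkovJump P A ℱ X) {s h : ℝ} (hs : 0 ≤ s)
    (hh : 0 ≤ h) (f : S → ℝ) (ω : Ω) :
    dynkin A f (fun t => X t ω) (s + h) - dynkin A f (fun t => X t ω) s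
      = f (X (s + h) ω) - f (X s ω) - ∫ u in (0 : ℝ)..h, A f (X (max 0 (s + u)) ω) := by
  have hi := (hX.path ω).intervalIntegrable (A f)
  simp only [dynkin]
  rw [integral_eq_integral_max le_rfl hs, integral_eq_integral_max le_rfl (by linarith : 0 ≤ s + h)]
  have h1 := intervalIntegral.integral_interval_sub_left (hi 0 (s + h)) (hi 0 s)
  have h2 : ∫ u in s..s + h, A f (X (max 0 u) ω) = ∫ u in (0 : ℝ)..h, A f (X (max 0 (s + u)) ω) := by
    rw [intervalIntegral.integral_comp_add_left (fun u => A f (X (max 0 u) ω)), add_zero]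
  linarith

/-- The increments of Dynkin martingales are orthogonal to the past. -/
theorem IsMarkovJump.integral_mul_dynkin [IsProbabilityMeasure P] (hX : IsMarkovJump P A ℱ X) {s h : ℝ} (hs : 0 ≤ s)
    (hh : 0 ≤ h) (f : S → ℝ) {Z : Ω → ℝ} (hZ : Measurable[ℱ s] Z) {B : ℝ} (hB : ∀ ω, |Z ω| ≤ B) :
    ∫ ω, Z ω * (dynkin A f (fun t => X t ω) (s + h) - dynkin A f (fun t => X t ω) s) ∂P = 0 := by
  classical
  have hZm : Measurable Z := hZ.mono (hX.le s) le_rfl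
  have int : ∀ (g : S → ℝ) t, 0 ≤ t → Integrable (fun ω => Z ω * g (X t ω)) P := fun g t ht => by
    obtain ⟨C, hC0, hC⟩ := exists_abs_le_of_finite g
    exact integrable_of_abs_le (hZm.mul (hX.measurable ht g)) fun ω => abs_mul_le_of_le (hB ω) (hC _)
  -- the linear functional `g ↦ E[Z g(X_s)]`
  set ℓ : S → ℝ := fun a => ∫ ω, Z ω * (Pi.single a 1 : S → ℝ) (X s ω) ∂P with hℓ
  have hℓe : ∀ g : S → ℝ, ∫ ω, Z ω * g (X s ω) ∂P = ∑ a, g a * ℓ a := fun g => by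
    have : ∀ ω, Z ω * g (X s ω) = ∑ a, g a * (Z ω * (Pi.single a 1 : S → ℝ) (X s ω)) := fun ω => by
      simp [Pi.single_apply, mul_comm]
    simp_rw [this]
    rw [integral_finsetSum _ fun a _ => (int _ s hs).const_mul _]
    simp_rw [integral_const_mul, hℓ]
  have hderiv : ∀ t : ℝ, HasDerivAt (fun u : ℝ => ∑ a, NormedSpace.exp (u • A) f a * ℓ a)
      (∑ a, NormedSpace.exp (t • A) (A f) a * ℓ a) t := fun t => by
    have h1 := (hasDerivAt_exp_smul_const A t).clm_apply (hasDerivAt_const t f)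
    simp only [map_zero, add_zero] at h1
    rw [hasDerivAt_pi] at h1
    exact HasDerivAt.fun_sum fun a _ => (h1 a).mul_const (ℓ a)
  have hcont : Continuous fun u : ℝ => ∑ a, NormedSpace.exp (u • A) (A f) a * ℓ a := by
    have h1 : Continuous fun u : ℝ => NormedSpace.exp (u • A) :=
      continuous_iff_continuousAt.2 fun t => (hasDerivAt_exp_smul_const A t).continuousAt
    have h2 : Continuous fun u : ℝ => NormedSpace.exp (u • A) (A f) := h1.clm_apply continuous_const
    exact continuous_finsetSum _ fun a _ => ((continuous_apply a).comp h2).mul continuous_const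
  -- Kolmogorov's equation tested against Z: u ↦ E[Z (e^{uA} f)(X_s)] has derivative E[Z (e^{uA} A
  -- f)(X_s)]. Its integral over [0,h] is the compensator of the increment.
  have hftc := intervalIntegral.integral_eq_sub_of_hasDerivAt (a := 0) (b := h)
    (fun t _ => hderiv t) (hcont.intervalIntegrable _ _)
  obtain ⟨C, hC0, hC⟩ := exists_abs_le_of_finite (A f)
  have hmeas : Measurable fun q : ℝ × Ω => Z q.2 * A f (X (max 0 (s + q.1)) q.2) :=
    (hZm.comp measurable_snd).mul ((hX.measurable_uncurry (A f)).comp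
      ((measurable_const.add measurable_fst).prodMk measurable_snd))
  have hswap := intervalIntegral_integral_swap (a := 0) (b := h) (μ := P)
    (f := fun u ω => Z ω * A f (X (max 0 (s + u)) ω)) (by
      rw [uIoc_of_le hh]
      refine Integrable.of_bound hmeas.aestronglyMeasurable (B * C) (Eventually.of_forall ?_)
      exact fun q => abs_mul_le_of_le (hB q.2) (hC _))
  have e1 : ∫ ω, Z ω * (dynkin A f (fun t => X t ω) (s + h) - dynkin A f (fun t => X t ω) s) ∂P
      = ∫ ω, Z ω * f (X (s + h) ω) ∂P - ∫ ω, Z ω * f (X s ω) ∂P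
        - ∫ ω, (∫ u in (0 : ℝ)..h, Z ω * A f (X (max 0 (s + u)) ω)) ∂P := by
    rw [← integral_sub (int f _ (by linarith)) (int f _ hs), ← integral_sub]
    · refine integral_congr_ae (Eventually.of_forall fun ω => ?_)
      simp only
      rw [hX.dynkin_increment hs hh, intervalIntegral.integral_const_mul]
      ring
    · exact (int f _ (by linarith)).sub (int f _ hs)
    · refine integrable_of_abs_le (B := B * C * |h - 0|) ?_ fun ω => ?_
      · simp_rw [intervalIntegral.integral_of_le hh]
        exact (hmeas.stronglyMeasurable.integral_prod_left' (μ := volume.restrict (Ioc 0 h))).measurable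
      · exact intervalIntegral.norm_integral_le_of_norm_le_const
          (f := fun u => Z ω * A f (X (max 0 (s + u)) ω)) fun u _ => abs_mul_le_of_le (hB ω) (hC _)
  rw [e1, ← hswap, hX.integral_mul hs hh f hZ hB, hℓe, hℓe]
  have e2 : ∀ u ∈ uIcc 0 h, ∫ ω, Z ω * A f (X (max 0 (s + u)) ω) ∂P
      = ∑ a, NormedSpace.exp (u • A) (A f) a * ℓ a := fun u hu => by
    have hu0 : 0 ≤ u := by rw [uIcc_of_le hh] at hu; exact hu.1
    rw [max_eq_right (by linarith : 0 ≤ s + u), hX.integral_mul hs hu0 (A f) hZ hB, hℓe]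
  rw [intervalIntegral.integral_congr e2, hftc]
  simp

end Markov

section

/-! ### One-step moments of increments of Dynkin martingales -/

/-- The `q`-th power of the jump of `∑ c_y f_y` when the state changes from `a` to `b`. -/
noncomputable def jumpPow {S Y : Type*} [Fintype Y] (f : Y → S → ℝ) (q : ℝ) (c : Y → ℝ) (a b : S) :
    ℝ := |∑ y, c y * (f y b - f y a)| ^ q

theorem jumpPow_self {S Y : Type*} [Fintype Y] (f : Y → S → ℝ) {q : ℝ} (hq : 0 < q) (c : Y → ℝ)
    (a : S) : jumpPow f q c a a = 0 := by
  simp [jumpPow, Real.zero_rpow hq.ne']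

/-- Here u is a jump and v a drift over time h. The drift costs only O(h), which is enough because
the estimate is used where the state has changed, an event that contributes a further factor h. -/
theorem add_rpow_le {q u v L R h : ℝ} (hq : 1 ≤ q) (hu : 0 ≤ u) (huL : u ≤ L) (hv : 0 ≤ v)
    (hvR : v ≤ R * h) (hR : 0 ≤ R) (hh : h ∈ Icc (0 : ℝ) 1) :
    (u + v) ^ q ≤ u ^ q + q * (L + R) ^ (q - 1) * R * h := by
  have hL : 0 ≤ L := hu.trans huL
  rcases (add_nonneg hu hv).eq_or_lt with h0 | h0
  · rw [← h0, Real.zero_rpow (by linarith)]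
    have h1 := hh.1
    positivity
  · have h1 := rpow_sub_rpow_le hq h0 hu
    have h2 : (u + v) ^ (q - 1) ≤ (L + R) ^ (q - 1) := by
      refine Real.rpow_le_rpow h0.le ?_ (by linarith)
      have : R * h ≤ R := by nlinarith [hh.2]
      linarith
    have h3 : q * (u + v) ^ (q - 1) * (u + v - u) ≤ q * (L + R) ^ (q - 1) * (R * h) := by
      rw [add_sub_cancel_left]
      gcongr
    linarith

theorem abs_apply_le_norm {S : Type*} [Fintype S] (g : S → ℝ) (a : S) : |g a| ≤ ‖g‖ := norm_le_pi_norm g a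

theorem measurable_jumpPow {Ω S Y : Type*} {m : MeasurableSpace Ω} [Fintype Y] (f : Y → S → ℝ) (q : ℝ)
    {c : Y → Ω → ℝ} (hc : ∀ y, Measurable (c y)) {x : Ω → S} (hx : ∀ g : S → ℝ, Measurable fun ω => g (x ω))
    (b : S) : Measurable fun ω => jumpPow f q (fun y => c y ω) (x ω) b := by
  have h : Measurable fun ω => ∑ y, c y ω * (f y b - f y (x ω)) :=
    Finset.measurable_sum _ fun y _ => (hc y).mul (measurable_const.sub (hx _))
  exact (continuous_abs.measurable.comp h).pow_const q

theorem measurable_clm_apply {Ω S : Type*} {m : MeasurableSpace Ω} [Fintype S] (L : (S → ℝ) →L[ℝ] (S → ℝ))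
    {g : Ω → S → ℝ} (hg : ∀ b, Measurable fun ω => g ω b) {x : Ω → S}
    (hx : ∀ g : S → ℝ, Measurable fun ω => g (x ω)) : Measurable fun ω => L (g ω) (x ω) := by
  classical
  simp_rw [fun ω => clm_apply_eq_sum L (g ω) (x ω)]
  exact Finset.measurable_sum _ fun b _ => (hg b).mul (hx _)

variable {Ω : Type*} [mΩ : MeasurableSpace Ω] {P : Measure Ω}
  {S : Type*} [Fintype S] {A : (S → ℝ) →L[ℝ] (S → ℝ)} {ℱ : ℝ → MeasurableSpace Ω} {X : ℝ → Ω → S}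

/-- Conditioning on the past, for functions of the past and of the present state. -/
theorem IsMarkovJump.integral_mul_random [IsProbabilityMeasure P] (hX : IsMarkovJump P A ℱ X)
    {s h : ℝ} (hs : 0 ≤ s) (hh : 0 ≤ h) {g : Ω → S → ℝ} (hg : ∀ b, Measurable[ℱ s] fun ω => g ω b)
    {C : ℝ} (hC : ∀ ω b, |g ω b| ≤ C) :
    ∫ ω, g ω (X (s + h) ω) ∂P = ∫ ω, NormedSpace.exp (h • A) (g ω) (X s ω) ∂P := by
  classical
  have e1 : ∀ ω, g ω (X (s + h) ω) = ∑ b, g ω b * (Pi.single b 1 : S → ℝ) (X (s + h) ω) := fun ω => by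
    simp [Pi.single_apply]
  have e2 : ∀ ω, NormedSpace.exp (h • A) (g ω) (X s ω)
      = ∑ b, g ω b * NormedSpace.exp (h • A) (Pi.single b 1) (X s ω) :=
    fun ω => clm_apply_eq_sum _ _ _
  have int : ∀ b (f : S → ℝ) t, 0 ≤ t → Integrable (fun ω => g ω b * f (X t ω)) P := fun b f t ht => by
    obtain ⟨D, hD0, hD⟩ := exists_abs_le_of_finite f
    exact integrable_of_abs_le (((hg b).mono (hX.le s) le_rfl).mul (hX.measurable ht f))
      fun ω => abs_mul_le_of_le (hC ω b) (hD _)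
  simp_rw [e1, e2]
  rw [integral_finsetSum _ fun b _ => int b _ _ (by linarith),
    integral_finsetSum _ fun b _ => int b _ _ hs]
  exact Finset.sum_congr rfl fun b _ => hX.integral_mul hs hh _ (hg b) fun ω => hC ω b

/-- The conditional moments of the increments of Dynkin martingales over a short time interval. -/
theorem IsMarkovJump.exists_integral_increment_le {Y : Type*} [Fintype Y] (A : (S → ℝ) →L[ℝ] (S → ℝ))
    (f : Y → S → ℝ) {q : ℝ} (hq : 2 ≤ q) (B : ℝ) : ∃ K, 0 ≤ K ∧
    ∀ {Ω : Type*} [MeasurableSpace Ω] {P : Measure Ω} [IsProbabilityMeasure P]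
      {ℱ : ℝ → MeasurableSpace Ω} {X : ℝ → Ω → S}, IsMarkovJump P A ℱ X →
    ∀ s h : ℝ, 0 ≤ s → h ∈ Icc (0 : ℝ) 1 → ∀ c : Y → Ω → ℝ, (∀ y, Measurable[ℱ s] (c y)) →
    (∀ y ω, |c y ω| ≤ B) → ∀ W : Ω → ℝ, Measurable[ℱ s] W → (∀ ω, 0 ≤ W ω) → (∃ b, ∀ ω, |W ω| ≤ b) →
    ∫ ω, W ω * |∑ y, c y ω * (dynkin A (f y) (fun t => X t ω) (s + h)
        - dynkin A (f y) (fun t => X t ω) s)| ^ q ∂P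
      ≤ h * ∫ ω, W ω * A (jumpPow f q (fun y => c y ω) (X s ω)) (X s ω) ∂P
        + K * h ^ 2 * ∫ ω, W ω ∂P := by
  classical
  choose Bf hBf0 hBf using fun y => exists_abs_le_of_finite (f y)
  choose Ba hBa0 hBa using fun y => exists_abs_le_of_finite (A (f y))
  obtain ⟨K₀, hK₀, hexp⟩ := exists_norm_exp_sub_le A
  set B' := |B| with hB'
  have hB'0 : 0 ≤ B' := abs_nonneg _
  set L := ∑ y, B' * (2 * Bf y) with hL
  set R := ∑ y, B' * Ba y with hR
  have hL0 : 0 ≤ L := Finset.sum_nonneg fun y _ => by have := hBf0 y; positivity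
  have hR0 : 0 ≤ R := Finset.sum_nonneg fun y _ => by have := hBa0 y; positivity
  -- The first summand covers the drift error when the state has changed, the second the pure drift
  -- when it has not.
  set K₁ := q * (L + R) ^ (q - 1) * R + R ^ q with hK₁
  have hq0 : 0 < q := by linarith
  have hK₁0 : 0 ≤ K₁ := by positivity
  set G := L ^ q + K₁ with hG
  have hG0 : 0 ≤ G := by positivity
  refine ⟨K₁ + K₁ * ‖A‖ + K₀ * G, by positivity, ?_⟩
  intro Ω mΩ P _ ℱ X hX s h hs hh c hcm hcB W hWm hW0 ⟨b, hWb⟩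
  -- the jump part and its bound
  have hcB' : ∀ y ω, |c y ω| ≤ B' := fun y ω => (hcB y ω).trans (le_abs_self B)
  have hjump : ∀ ω a a', |∑ y, c y ω * (f y a' - f y a)| ≤ L := fun ω a a' => by
    refine (Finset.abs_sum_le_sum_abs _ _).trans (Finset.sum_le_sum fun y _ => ?_)
    refine abs_mul_le_of_le (hcB' y ω) ((abs_sub _ _).trans ?_)
    linarith [hBf y a, hBf y a']
  have hΦ : ∀ ω a a', |jumpPow f q (fun y => c y ω) a a'| ≤ L ^ q := fun ω a a' => by
    rw [jumpPow, abs_of_nonneg (by positivity)]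
    exact Real.rpow_le_rpow (abs_nonneg _) (hjump ω a a') hq0.le
  have hdrift : ∀ ω, |∑ y, c y ω * ∫ u in (0 : ℝ)..h, A (f y) (X (max 0 (s + u)) ω)| ≤ R * h := by
    intro ω
    rw [hR, Finset.sum_mul]
    refine (Finset.abs_sum_le_sum_abs _ _).trans (Finset.sum_le_sum fun y _ => ?_)
    rw [mul_assoc]
    refine abs_mul_le_of_le (hcB' y ω) ?_
    have := intervalIntegral.norm_integral_le_of_norm_le_const (a := 0) (b := h) (C := Ba y)
      (f := fun u => A (f y) (X (max 0 (s + u)) ω)) fun u _ => hBa y _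
    rwa [sub_zero, abs_of_nonneg hh.1] at this
  -- Indicator of a changed state. The error of order h is charged only there, so that the generator
  -- turns it into an error of order h².
  set ψ : S → S → ℝ := fun a a' => if a' = a then 0 else 1 with hψ
  set g : Ω → S → ℝ := fun ω a' => jumpPow f q (fun y => c y ω) (X s ω) a' + K₁ * h * ψ (X s ω) a'
    with hg
  have hψ0 : ∀ a a', 0 ≤ ψ a a' := fun a a' => by simp only [hψ]; split_ifs <;> norm_num
  have hψ1 : ∀ a a', |ψ a a'| ≤ 1 := fun a a' => by simp only [hψ]; split_ifs <;> simp
  have hh2 : h ^ q ≤ h ^ 2 := by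
    rw [← Real.rpow_two]
    rcases hh.1.eq_or_lt with h0 | h0
    · rw [← h0, Real.zero_rpow hq0.ne', Real.zero_rpow two_ne_zero]
    · exact Real.rpow_le_rpow_of_exponent_ge h0 hh.2 hq
  -- Only the states at the two ends matter. If they agree, the increment is pure drift, of size at
  -- most R h, and h^q ≤ h² because q ≥ 2 and h ≤ 1.
  have path : ∀ ω, |∑ y, c y ω * (dynkin A (f y) (fun t => X t ω) (s + h)
      - dynkin A (f y) (fun t => X t ω) s)| ^ q ≤ g ω (X (s + h) ω) + K₁ * h ^ 2 := by
    intro ω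
    have e : ∑ y, c y ω * (dynkin A (f y) (fun t => X t ω) (s + h)
        - dynkin A (f y) (fun t => X t ω) s)
        = ∑ y, c y ω * (f y (X (s + h) ω) - f y (X s ω))
          - ∑ y, c y ω * ∫ u in (0 : ℝ)..h, A (f y) (X (max 0 (s + u)) ω) := by
      rw [← Finset.sum_sub_distrib]
      refine Finset.sum_congr rfl fun y _ => ?_
      rw [hX.dynkin_increment hs hh.1]; ring
    rw [e]
    set J := ∑ y, c y ω * (f y (X (s + h) ω) - f y (X s ω)) with hJ
    set D := ∑ y, c y ω * ∫ u in (0 : ℝ)..h, A (f y) (X (max 0 (s + u)) ω) with hD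
    have hJD : |J - D| ≤ |J| + |D| := abs_sub _ _
    by_cases hne : X (s + h) ω = X s ω
    · have hJ0 : J = 0 := by simp [hJ, hne]
      have hg0 : g ω (X (s + h) ω) = 0 := by
        simp only [hg, hψ, hne, jumpPow_self f hq0, if_true, mul_zero, add_zero]
      rw [hg0, hJ0, zero_sub, abs_neg, zero_add]
      calc |D| ^ q ≤ (R * h) ^ q := Real.rpow_le_rpow (abs_nonneg _) (hdrift ω) hq0.le
        _ = R ^ q * h ^ q := Real.mul_rpow hR0 hh.1
        _ ≤ R ^ q * h ^ 2 := by gcongr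
        _ ≤ K₁ * h ^ 2 := by
          gcongr
          have : 0 ≤ q * (L + R) ^ (q - 1) * R := by positivity
          linarith
    · have h1 : (|J| + |D|) ^ q ≤ |J| ^ q + q * (L + R) ^ (q - 1) * R * h :=
        add_rpow_le (by linarith) (abs_nonneg _) (hjump ω _ _) (abs_nonneg _) (hdrift ω) hR0 hh
      have h2 : |J - D| ^ q ≤ (|J| + |D|) ^ q := Real.rpow_le_rpow (abs_nonneg _) hJD hq0.le
      have h3 : g ω (X (s + h) ω) = |J| ^ q + K₁ * h := by
        simp only [hg, hψ, hne, if_false, mul_one, jumpPow, hJ]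
      have h4 : q * (L + R) ^ (q - 1) * R * h ≤ K₁ * h := by
        have h5 : 0 ≤ R ^ q := by positivity
        have := hh.1
        gcongr
        linarith
      have h6 : 0 ≤ K₁ * h ^ 2 := by positivity
      rw [h3]; linarith
  have hxm : ∀ f : S → ℝ, Measurable[ℱ s] fun ω => f (X s ω) := hX.adapted s hs
  have hΦm : ∀ a', Measurable[ℱ s] fun ω => jumpPow f q (fun y => c y ω) (X s ω) a' :=
    fun a' => measurable_jumpPow (m := ℱ s) f q hcm hxm a'
  have hψm : ∀ a', Measurable[ℱ s] fun ω => ψ (X s ω) a' := fun a' => hxm fun a => ψ a a'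
  have hgm : ∀ a', Measurable[ℱ s] fun ω => g ω a' := fun a' =>
    (hΦm a').add ((hψm a').const_mul _)
  have hgG : ∀ ω a', |g ω a'| ≤ G := fun ω a' => by
    refine (abs_add_le _ _).trans (add_le_add (hΦ _ _ _) ?_)
    rw [abs_mul, abs_of_nonneg (mul_nonneg hK₁0 hh.1)]
    calc K₁ * h * |ψ (X s ω) a'| ≤ K₁ * 1 * 1 := by gcongr; exacts [hh.2, hψ1 _ _]
      _ = K₁ := by ring
  have hnorm : ∀ (g : S → ℝ) C, 0 ≤ C → (∀ a, |g a| ≤ C) → ‖g‖ ≤ C := fun g C hC h =>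
    (pi_norm_le_iff_of_nonneg hC).2 h
  have hWm' : Measurable W := hWm.mono (hX.le s) le_rfl
  have hb0 : ∀ ω : Ω, 0 ≤ b := fun ω => (abs_nonneg _).trans (hWb ω)
  -- integrability
  have iW : Integrable W P := integrable_of_abs_le hWm' hWb
  have iA : Integrable (fun ω => W ω * A (jumpPow f q (fun y => c y ω) (X s ω)) (X s ω)) P := by
    refine integrable_of_abs_le (B := b * (‖A‖ * L ^ q)) ?_ fun ω => abs_mul_le_of_le (hWb ω) ?_
    · exact hWm'.mul ((measurable_clm_apply (m := ℱ s) A hΦm hxm).mono (hX.le s) le_rfl)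
    · refine (abs_apply_le_norm _ _).trans ((A.le_opNorm _).trans ?_)
      gcongr
      exact hnorm _ _ (by positivity) (hΦ ω _)
  -- conditioning
  have hcond : ∫ ω, W ω * g ω (X (s + h) ω) ∂P
      = ∫ ω, W ω * NormedSpace.exp (h • A) (g ω) (X s ω) ∂P := by
    have := hX.integral_mul_random hs hh.1 (g := fun ω a' => W ω * g ω a')
      (fun a' => hWm.mul (hgm a')) (fun ω a' => abs_mul_le_of_le (hWb ω) (hgG ω a'))
    rw [this]
    refine integral_congr_ae (Eventually.of_forall fun ω => ?_)
    have e : (fun a' => W ω * g ω a') = W ω • g ω := rfl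
    simp only [e, map_smul, Pi.smul_apply, smul_eq_mul]
  -- Expansion of the semigroup to second order. The zeroth-order term vanishes because `g ω` is
  -- zero at the current state.
  have hpt : ∀ ω, NormedSpace.exp (h • A) (g ω) (X s ω)
      ≤ h * A (jumpPow f q (fun y => c y ω) (X s ω)) (X s ω) + (K₁ * ‖A‖ + K₀ * G) * h ^ 2 := by
    intro ω
    have h1 := hexp h hh
    have h2 : |(NormedSpace.exp (h • A) - 1 - h • A) (g ω) (X s ω)| ≤ K₀ * h ^ 2 * G := by
      refine (abs_apply_le_norm _ _).trans ((ContinuousLinearMap.le_opNorm _ _).trans ?_)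
      gcongr
      exact hnorm _ _ hG0 (hgG ω)
    have h3 : (NormedSpace.exp (h • A) - 1 - h • A) (g ω) (X s ω)
        = NormedSpace.exp (h • A) (g ω) (X s ω) - g ω (X s ω) - h * A (g ω) (X s ω) := rfl
    have h4 : g ω (X s ω) = 0 := by
      simp only [hg, hψ, jumpPow_self f hq0, if_true, mul_zero, add_zero]
    have h5 : A (g ω) (X s ω) = A (jumpPow f q (fun y => c y ω) (X s ω)) (X s ω)
        + K₁ * h * A (ψ (X s ω)) (X s ω) := by
      have e : g ω = jumpPow f q (fun y => c y ω) (X s ω) + (K₁ * h) • ψ (X s ω) := rfl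
      rw [e, map_add, map_smul]; rfl
    have h6 : |A (ψ (X s ω)) (X s ω)| ≤ ‖A‖ := by
      refine (abs_apply_le_norm _ _).trans ((A.le_opNorm _).trans ?_)
      have := hnorm (ψ (X s ω)) 1 zero_le_one (hψ1 _)
      calc ‖A‖ * ‖ψ (X s ω)‖ ≤ ‖A‖ * 1 := by gcongr
        _ = ‖A‖ := mul_one _
    have h7 : K₁ * h * A (ψ (X s ω)) (X s ω) * h ≤ K₁ * h * ‖A‖ * h := by
      have := hh.1
      gcongr
      exact (le_abs_self _).trans h6
    rw [h3, h4] at h2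
    have h8 := (le_abs_self _).trans h2
    rw [h5] at h8
    nlinarith
  have iE : Integrable (fun ω => W ω * NormedSpace.exp (h • A) (g ω) (X s ω)) P := by
    refine integrable_of_abs_le (B := b * (‖NormedSpace.exp (h • A)‖ * G)) ?_
      fun ω => abs_mul_le_of_le (hWb ω) ?_
    · exact hWm'.mul ((measurable_clm_apply (m := ℱ s) _ hgm hxm).mono (hX.le s) le_rfl)
    · refine (abs_apply_le_norm _ _).trans ((ContinuousLinearMap.le_opNorm _ _).trans ?_)
      gcongr
      exact hnorm _ _ hG0 (hgG ω)
  have ig : Integrable (fun ω => W ω * g ω (X (s + h) ω)) P := by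
    refine integrable_of_abs_le (B := b * G) (hWm'.mul ?_) fun ω => abs_mul_le_of_le (hWb ω) (hgG ω _)
    have e1 : ∀ ω, g ω (X (s + h) ω) = ∑ a', g ω a' * (Pi.single a' 1 : S → ℝ) (X (s + h) ω) :=
      fun ω => by simp [Pi.single_apply]
    simp_rw [e1]
    exact Finset.measurable_sum _ fun a' _ => ((hgm a').mono (hX.le s) le_rfl).mul
      (hX.measurable (by linarith [hh.1]) _)
  calc ∫ ω, W ω * |∑ y, c y ω * (dynkin A (f y) (fun t => X t ω) (s + h)
        - dynkin A (f y) (fun t => X t ω) s)| ^ q ∂P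
      ≤ ∫ ω, (W ω * g ω (X (s + h) ω) + K₁ * h ^ 2 * W ω) ∂P := by
        refine integral_mono_of_nonneg (Eventually.of_forall fun ω => ?_) (ig.add (iW.const_mul _))
          (Eventually.of_forall fun ω => ?_)
        · exact mul_nonneg (hW0 ω) (by positivity)
        · have := mul_le_mul_of_nonneg_left (path ω) (hW0 ω)
          simp only
          linarith
    _ = ∫ ω, W ω * NormedSpace.exp (h • A) (g ω) (X s ω) ∂P + K₁ * h ^ 2 * ∫ ω, W ω ∂P := by
        rw [integral_add ig (iW.const_mul _), hcond, integral_const_mul]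
    _ ≤ ∫ ω, (h * (W ω * A (jumpPow f q (fun y => c y ω) (X s ω)) (X s ω))
          + (K₁ * ‖A‖ + K₀ * G) * h ^ 2 * W ω) ∂P + K₁ * h ^ 2 * ∫ ω, W ω ∂P := by
        refine add_le_add ?_ le_rfl
        refine integral_mono iE ((iA.const_mul _).add (iW.const_mul _)) fun ω => ?_
        have := mul_le_mul_of_nonneg_left (hpt ω) (hW0 ω)
        simp only
        linarith
    _ = _ := by
        rw [integral_add (iA.const_mul _) (iW.const_mul _), integral_const_mul, integral_const_mul]
        ring

end

section

/-! ### Joint measurability of iterated integrals -/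

variable {N n : ℕ}

/-- A family of admissible kernels which depends measurably on its parameter and on the times. -/
structure MeasurableFamily {α : Type*} [MeasurableSpace α] (F : α → TimeSpaceKernel N n) : Prop where
  admissible : ∀ a, Admissible (F a)
  measurable : ∀ y, Measurable fun q : α × (Fin n → ℝ) => F q.1 (fun i => max 0 (q.2 i)) y

theorem measurable_comp_gridBelow_prod {α β : Type*} [MeasurableSpace α] [MeasurableSpace β]
    {G : ℝ → α → β} (hG : ∀ s, Measurable (G s)) (h : ℝ) :
    Measurable fun q : ℝ × α => G (gridBelow h q.1) q.2 := by
  have h1 : Measurable fun q : ℤ × α => G (h * ((q.1 : ℝ) - 1)) q.2 :=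
    measurable_from_prod_countable_right fun k => hG (h * ((k : ℝ) - 1))
  have h2 : Measurable fun q : ℝ × α => ((⌈q.1 / h⌉ : ℤ), q.2) :=
    ((Int.measurable_ceil.comp (measurable_fst.div_const h))).prodMk measurable_snd
  exact h1.comp h2

theorem max_zero_cons (s : ℝ) (rs : Fin n → ℝ) :
    (fun i => max 0 ((Fin.cons s rs : Fin (n + 1) → ℝ) i))
      = Fin.cons (max 0 s) fun i => max 0 (rs i) := by
  funext i
  cases i using Fin.cases <;> simp

/-- Separate left-continuity implies joint measurability: the first time is discretised from the
left, and the remaining ones are treated by induction. -/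
theorem Admissible.measurable {F : TimeSpaceKernel N n} (hF : Admissible F) (y : Fin n → Torus N) :
    Measurable fun r : Fin n → ℝ => F (fun i => max 0 (r i)) y := by
  induction n with
  | zero =>
    have : (fun r : Fin 0 → ℝ => F (fun i => max 0 (r i)) y) = fun _ => F Fin.elim0 y := by
      funext r
      congr 1
      exact Subsingleton.elim _ _
    rw [this]
    exact measurable_const
  | succ n ih =>
    have e : (fun r : Fin (n + 1) → ℝ => F (fun i => max 0 (r i)) y)
        = (fun q : ℝ × (Fin n → ℝ) =>
            IsingKac.freezeFirst F (max 0 q.1) (y 0) (fun i => max 0 (q.2 i)) (Fin.tail y)) ∘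
          fun r => (r 0, Fin.tail r) := by
      funext r
      simp only [IsingKac.freezeFirst, Function.comp_apply, ← max_zero_cons, Fin.cons_self_tail]
    rw [e]
    have ht : Measurable fun r : Fin (n + 1) → ℝ => (r 0, Fin.tail r) :=
      (measurable_pi_apply 0).prodMk (measurable_pi_lambda _ fun i => measurable_pi_apply _)
    refine Measurable.comp ?_ ht
    refine measurable_of_tendsto_metrizable (f := fun (m : ℕ) (q : ℝ × (Fin n → ℝ)) =>
      IsingKac.freezeFirst F (max 0 (gridBelow (1 / m) q.1)) (y 0) (fun i => max 0 (q.2 i))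
        (Fin.tail y)) (fun m => ?_) ?_
    · exact measurable_comp_gridBelow_prod (G := fun s (rs : Fin n → ℝ) =>
        IsingKac.freezeFirst F (max 0 s) (y 0) (fun i => max 0 (rs i)) (Fin.tail y))
        (fun s => ih (hF.freezeFirst (le_max_left _ _) _) _) _
    · rw [tendsto_pi_nhds]
      rintro ⟨s, rs⟩
      have hg := tendsto_gridBelow one_pos s
      rcases le_or_gt s 0 with hs | hs
      · refine tendsto_const_nhds.congr' ?_
        filter_upwards [hg.eventually self_mem_nhdsWithin] with m hm
        have hm : gridBelow (1 / m) s < s := hm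
        rw [max_eq_left hs, max_eq_left (hm.le.trans hs)]
      · have := (hF.tendsto_freezeFirst hs (y 0) (rs := fun i => max 0 (rs i))
          (fun i => le_max_left _ _) (Fin.tail y)).comp hg
        simp only [max_eq_right hs.le]
        refine this.congr' ?_
        filter_upwards [hg.eventually (Ioo_mem_nhdsLT hs)] with m hm
        simp only [Function.comp_apply]
        rw [max_eq_right hm.1.le]

theorem Admissible.measurableFamily {α : Type*} [MeasurableSpace α] {F : TimeSpaceKernel N n}
    (hF : Admissible F) : MeasurableFamily fun _ : α => F :=
  ⟨fun _ => hF, fun y => (hF.measurable y).comp measurable_snd⟩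

theorem MeasurableFamily.freezeFirst {α : Type*} [MeasurableSpace α]
    {F : α → TimeSpaceKernel N (n + 1)} (hF : MeasurableFamily F) (y : Torus N) :
    MeasurableFamily fun q : α × ℝ => IsingKac.freezeFirst (F q.1) (max 0 q.2) y := by
  refine ⟨fun q => (hF.admissible q.1).freezeFirst (le_max_left _ _) y, fun ys => ?_⟩
  have h1 : Measurable fun q : (α × ℝ) × (Fin n → ℝ) =>
      (q.1.1, (Fin.cons q.1.2 q.2 : Fin (n + 1) → ℝ)) := by
    refine (measurable_fst.comp measurable_fst).prodMk (measurable_pi_lambda _ fun i => ?_)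
    cases i using Fin.cases with
    | zero => simpa using measurable_fst.snd
    | succ i => simpa using (measurable_pi_apply i).fun_comp measurable_snd
  have := (hF.measurable (Fin.cons y ys)).comp h1
  simpa only [Function.comp_def, max_zero_cons, IsingKac.freezeFirst] using this

/-- Induction through Riemann sums. Their times depend on the variables, so freezing a time enlarges
the parameter space from α to α × ℝ; hence the arbitrary parameter space. The σ-algebra on Ω is also
arbitrary: taking the past up to T gives adaptedness, and for this the time is stopped at T. -/
theorem MeasurableFamily.measurable_iteratedIntegral {Ω : Type*} [MeasurableSpace Ω] (ε : ℝ)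
    {M : ℝ → Ω → Torus N → ℝ} (hM : ∀ ω y, IsDriver fun s => M s ω y) {T : ℝ} (hT : 0 ≤ T)
    (hMm : ∀ y, Measurable fun q : ℝ × Ω => M (max 0 (min q.1 T)) q.2 y)
    {α : Type*} [MeasurableSpace α] {F : α → TimeSpaceKernel N n} (hF : MeasurableFamily F) :
    Measurable fun q : α × ℝ × Ω =>
      iteratedIntegral ε (fun s => M s q.2.2) n (F q.1) (max 0 (min q.2.1 T)) := by
  induction n generalizing α with
  | zero =>
    have h := (hF.measurable Fin.elim0).comp
      (measurable_fst.prodMk measurable_const : Measurable fun q : α × ℝ × Ω =>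
        (q.1, (Fin.elim0 : Fin 0 → ℝ)))
    convert h using 1
    funext q
    simp only [Function.comp_apply, iteratedIntegral]
    congr 1
    exact Subsingleton.elim _ _
  | succ n ih =>
    refine measurable_of_tendsto_metrizable (f := fun (m : ℕ) (q : α × ℝ × Ω) =>
      ∑ y : Torus N, ε ^ 2 * ∑ k ∈ Finset.range m,
        diagIntegral ε (fun s => M s q.2.2) n (F q.1) y (k * (max 0 (min q.2.1 T) / m)) *
          (M ((k + 1) * (max 0 (min q.2.1 T) / m)) q.2.2 y
            - M (k * (max 0 (min q.2.1 T) / m)) q.2.2 y)) (fun m => ?_)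
      (tendsto_pi_nhds.2 fun q => tendsto_riemannSum_iteratedIntegral ε (hM q.2.2)
        (hF.admissible q.1) (le_max_left _ _))
    refine Finset.measurable_sum _ fun y _ => Measurable.const_mul
      (Finset.measurable_sum _ fun k hk => ?_) _
    have hk' : k < m := Finset.mem_range.1 hk
    have hm : (0 : ℝ) < m := by exact_mod_cast (Nat.zero_le k).trans_lt hk'
    have hkm : (k : ℝ) + 1 ≤ m := by exact_mod_cast hk'
    have hmem : ∀ u : ℝ, ∀ l : ℝ, 0 ≤ l → l ≤ m →
        max 0 (min (l * (max 0 (min u T) / m)) T) = l * (max 0 (min u T) / m) := by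
      intro u l hl hlm
      have h0 : 0 ≤ max 0 (min u T) := le_max_left _ _
      have h1 : max 0 (min u T) ≤ T := max_le hT (min_le_right _ _)
      have h2 : l * (max 0 (min u T) / m) ≤ T := by
        rw [← mul_div_assoc, div_le_iff₀ hm]
        nlinarith
      rw [min_eq_left h2, max_eq_right (by positivity)]
    have htime : ∀ l : ℝ, Measurable fun q : α × ℝ × Ω => l * (max 0 (min q.2.1 T) / m) := by
      intro l
      fun_prop
    refine Measurable.mul ?_ (Measurable.sub ?_ ?_)
    · have := (ih (hF.freezeFirst y)).comp (((measurable_fst.prodMk (htime k)).prodMk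
        ((htime k).prodMk (measurable_snd.comp measurable_snd))) :
          Measurable fun q : α × ℝ × Ω => (((q.1, k * (max 0 (min q.2.1 T) / m)) : α × ℝ),
            k * (max 0 (min q.2.1 T) / m), q.2.2))
      convert this using 1
      funext q
      have h0 : 0 ≤ (k : ℝ) * (max 0 (min q.2.1 T) / m) :=
        mul_nonneg k.cast_nonneg (div_nonneg (le_max_left _ _) hm.le)
      simp only [Function.comp_apply, diagIntegral]
      rw [hmem _ _ k.cast_nonneg (by linarith), max_eq_right h0]
    · convert (hMm y).comp ((htime (k + 1)).prodMk (measurable_snd.comp measurable_snd)) using 1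
      funext q
      simp only [Function.comp_apply]
      rw [hmem _ _ (by positivity) hkm]
    · convert (hMm y).comp ((htime k).prodMk (measurable_snd.comp measurable_snd)) using 1
      funext q
      simp only [Function.comp_apply]
      rw [hmem _ _ (by positivity) (by linarith)]

end

/-! ### Moments of discrete stochastic integrals -/

/-- Hölder's inequality in the weighted form with weights (p-2)/p and 2/p, which includes p = 2
without an infinite conjugate exponent. -/
theorem integral_rpow_mul_sq_le {Ω : Type*} [MeasurableSpace Ω] {P : Measure Ω}
    [IsProbabilityMeasure P] {p : ℝ} (hp : 2 ≤ p) {a b : Ω → ℝ} (ham : Measurable a)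
    (hbm : Measurable b) (ha : ∃ B, ∀ ω, a ω ∈ Icc 0 B) (hb : ∃ B, ∀ ω, b ω ∈ Icc 0 B) :
    ∫ ω, a ω ^ (p - 2) * b ω ^ 2 ∂P
      ≤ (∫ ω, a ω ^ p ∂P) ^ ((p - 2) / p) * (∫ ω, b ω ^ p ∂P) ^ (2 / p) := by
  obtain ⟨B, hB⟩ := ha
  obtain ⟨D, hD⟩ := hb
  have hp0 : 0 < p := by linarith
  have hθ : 0 ≤ (p - 2) / p := div_nonneg (by linarith) hp0.le
  have hτ : 0 ≤ 2 / p := by positivity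
  have ia : Integrable (fun ω => a ω ^ p) P :=
    integrable_of_abs_le (ham.pow_const p) (B := B ^ p) fun ω => by
      rw [abs_of_nonneg (Real.rpow_nonneg (hB ω).1 _)]
      exact Real.rpow_le_rpow (hB ω).1 (hB ω).2 hp0.le
  have ib : Integrable (fun ω => b ω ^ p) P :=
    integrable_of_abs_le (hbm.pow_const p) (B := D ^ p) fun ω => by
      rw [abs_of_nonneg (Real.rpow_nonneg (hD ω).1 _)]
      exact Real.rpow_le_rpow (hD ω).1 (hD ω).2 hp0.le
  have e1 : ∀ ω, (a ω ^ p) ^ ((p - 2) / p) = a ω ^ (p - 2) := fun ω => by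
    rw [← Real.rpow_mul (hB ω).1, mul_div_cancel₀ _ hp0.ne']
  have e2 : ∀ ω, (b ω ^ p) ^ (2 / p) = b ω ^ 2 := fun ω => by
    rw [← Real.rpow_mul (hD ω).1, mul_div_cancel₀ _ hp0.ne', Real.rpow_two]
  have na : 0 ≤ ∫ ω, a ω ^ p ∂P := integral_nonneg fun ω => Real.rpow_nonneg (hB ω).1 _
  have nb : 0 ≤ ∫ ω, b ω ^ p ∂P := integral_nonneg fun ω => Real.rpow_nonneg (hD ω).1 _
  have h := ENNReal.lintegral_mul_norm_pow_le (μ := P)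
    (f := fun ω => ENNReal.ofReal (a ω ^ p)) (g := fun ω => ENNReal.ofReal (b ω ^ p))
    (ham.pow_const p).ennreal_ofReal.aemeasurable (hbm.pow_const p).ennreal_ofReal.aemeasurable
    hθ hτ (by field_simp; ring)
  rw [← ofReal_integral_eq_lintegral_ofReal ia
      (Eventually.of_forall fun ω => Real.rpow_nonneg (hB ω).1 _),
    ← ofReal_integral_eq_lintegral_ofReal ib
      (Eventually.of_forall fun ω => Real.rpow_nonneg (hD ω).1 _),
    ENNReal.ofReal_rpow_of_nonneg na hθ, ENNReal.ofReal_rpow_of_nonneg nb hτ,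
    ← ENNReal.ofReal_mul (by positivity)] at h
  rw [integral_eq_lintegral_of_nonneg_ae
    (Eventually.of_forall fun ω => mul_nonneg (Real.rpow_nonneg (hB ω).1 _) (sq_nonneg _))
    ((ham.pow_const _).mul (hbm.pow_const _)).aestronglyMeasurable]
  refine ENNReal.toReal_le_of_le_ofReal (by positivity) (le_trans (le_of_eq ?_) h)
  refine lintegral_congr fun ω => ?_
  rw [ENNReal.ofReal_rpow_of_nonneg (Real.rpow_nonneg (hB ω).1 _) hθ,
    ENNReal.ofReal_rpow_of_nonneg (Real.rpow_nonneg (hD ω).1 _) hτ, e1, e2,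
    ENNReal.ofReal_mul (Real.rpow_nonneg (hB ω).1 _)]

theorem integral_rpow_sub_two_le {Ω : Type*} [MeasurableSpace Ω] {P : Measure Ω}
    [IsProbabilityMeasure P] {p : ℝ} (hp : 2 ≤ p) {a : Ω → ℝ} (ham : Measurable a)
    (ha : ∃ B, ∀ ω, a ω ∈ Icc 0 B) :
    ∫ ω, a ω ^ (p - 2) ∂P ≤ (∫ ω, a ω ^ p ∂P) ^ ((p - 2) / p) := by
  have := integral_rpow_mul_sq_le (P := P) hp ham (measurable_const (a := (1 : ℝ))) ha
    ⟨1, fun _ => ⟨zero_le_one, le_rfl⟩⟩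
  simpa using this

/-- Absorption: the inequality satisfied by moments in the discrete Burkholder inequality. -/
theorem rpow_two_div_le_of_le {p C x b d ρ : ℝ} (hp : 2 ≤ p) (hC : 0 ≤ C) (hx : 0 ≤ x) (hb : 0 ≤ b)
    (hd : 0 ≤ d) (hρ : 0 ≤ ρ)
    (h : x ≤ C * (x ^ ((p - 2) / p) * (b + ρ) + d ^ ((p - 2) / p) * b + ρ)) :
    x ^ (2 / p) ≤ (3 * C + 1) * (b + d ^ (2 / p) + ρ + ρ ^ (2 / p)) := by
  have hp0 : 0 < p := by linarith
  set θ := (p - 2) / p with hθ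
  set τ := 2 / p with hτ
  have hθ0 : 0 ≤ θ := div_nonneg (by linarith) hp0.le
  have hτ0 : 0 < τ := by positivity
  have hθτ : θ + τ = 1 := by rw [hθ, hτ]; field_simp; ring
  -- If x^τ exceeded the bound, it would dominate b, d^τ, ρ and ρ^τ. Each of the three groups on the
  -- right of the hypothesis is then at most x^θ Z, and x = x^θ x^τ gives a contradiction.
  by_contra! hlt
  set Z := b + d ^ τ + ρ + ρ ^ τ with hZ
  have hdτ : 0 ≤ d ^ τ := Real.rpow_nonneg hd _
  have hρτ : 0 ≤ ρ ^ τ := Real.rpow_nonneg hρ _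
  have hZ0 : 0 ≤ Z := by positivity
  have hx0 : 0 < x := by
    rcases hx.eq_or_lt with h0 | h0
    · rw [← h0, Real.zero_rpow hτ0.ne'] at hlt
      nlinarith
    · exact h0
  have split : ∀ u : ℝ, 0 ≤ u → u = u ^ θ * u ^ τ := fun u hu => by
    rw [← Real.rpow_add_of_nonneg hu hθ0 hτ0.le, hθτ, Real.rpow_one]
  have hxθ : 0 < x ^ θ := Real.rpow_pos_of_pos hx0 _
  have hZx : Z ≤ x ^ τ := by nlinarith
  have hle : ∀ u : ℝ, 0 ≤ u → u ^ τ ≤ Z → u ^ θ ≤ x ^ θ := fun u hu hu' => by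
    refine Real.rpow_le_rpow hu ?_ hθ0
    exact (Real.rpow_le_rpow_iff hu hx hτ0).1 (hu'.trans hZx)
  have h1 : x ^ θ * (b + ρ) ≤ x ^ θ * Z := by
    gcongr; rw [hZ]; linarith
  have h2 : d ^ θ * b ≤ x ^ θ * Z :=
    mul_le_mul (hle d hd (by rw [hZ]; linarith)) (by rw [hZ]; linarith) hb hxθ.le
  have h3 : ρ ≤ x ^ θ * Z := by
    conv_lhs => rw [split ρ hρ]
    exact mul_le_mul (hle ρ hρ (by rw [hZ]; linarith)) (by rw [hZ]; linarith) hρτ hxθ.le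
  have h4 : x ≤ C * (3 * (x ^ θ * Z)) := h.trans (by gcongr; linarith)
  have h5 : x = x ^ θ * x ^ τ := split x hx
  have h6 : x ^ θ * ((3 * C + 1) * Z) < x ^ θ * x ^ τ := mul_lt_mul_of_pos_left hlt hxθ
  have h7 : 0 ≤ x ^ θ * Z := by positivity
  nlinarith

theorem IsMarkovJump.measurable_dynkin_adapted {Ω : Type*} [mΩ : MeasurableSpace Ω] {P : Measure Ω}
    {S : Type*} [Fintype S] {A : (S → ℝ) →L[ℝ] (S → ℝ)} {ℱ : ℝ → MeasurableSpace Ω} {X : ℝ → Ω → S}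
    (hX : IsMarkovJump P A ℱ X) {T : ℝ} (hT : 0 ≤ T) (f : S → ℝ) :
    Measurable[@Prod.instMeasurableSpace _ _ _ (ℱ T)] fun q : ℝ × Ω =>
      dynkin A f (fun t => X t q.2) (max 0 (min q.1 T)) :=
  @measurable_dynkin Ω S (ℱ T) X hX.path T hT (fun _ ht => hX.adapted_of_le ht.1 ht.2) A f

theorem IsMarkovJump.measurable_dynkin_of_le {Ω : Type*} [mΩ : MeasurableSpace Ω] {P : Measure Ω}
    {S : Type*} [Fintype S] {A : (S → ℝ) →L[ℝ] (S → ℝ)} {ℱ : ℝ → MeasurableSpace Ω} {X : ℝ → Ω → S}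
    (hX : IsMarkovJump P A ℱ X) {s t : ℝ} (hs : 0 ≤ s) (hst : s ≤ t) (f : S → ℝ) :
    Measurable[ℱ t] fun ω => dynkin A f (fun t => X t ω) s := by
  have h1 : Measurable[ℱ t, @Prod.instMeasurableSpace _ _ _ (ℱ t)] fun ω : Ω => (s, ω) :=
    @measurable_prodMk_left ℝ Ω _ (ℱ t) s
  have := @Measurable.comp _ _ _ (ℱ t) (@Prod.instMeasurableSpace _ _ _ (ℱ t)) _ _ _
    (hX.measurable_dynkin_adapted (hs.trans hst) f) h1
  simpa only [Function.comp_def, min_eq_left hst, max_eq_right hs] using this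

theorem IsJumpPath.exists_abs_dynkin_le {S : Type*} [Finite S] (A : (S → ℝ) → (S → ℝ)) (f : S → ℝ)
    (T : ℝ) : ∃ B, ∀ x : ℝ → S, ∀ t ∈ Icc 0 T, |dynkin A f x t| ≤ B := by
  obtain ⟨B, hB0, hB⟩ := exists_abs_le_of_finite f
  obtain ⟨D, hD0, hD⟩ := exists_abs_le_of_finite (A f)
  refine ⟨B + B + D * T, fun x t ht => ?_⟩
  have h := intervalIntegral.norm_integral_le_of_norm_le_const (a := 0) (b := t) (C := D)
    (f := fun u => A f (x u)) fun u _ => hD _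
  rw [Real.norm_eq_abs, sub_zero, abs_of_nonneg ht.1] at h
  refine (abs_sub _ _).trans (add_le_add ((abs_sub _ _).trans (add_le_add (hB _) (hB _))) (h.trans ?_))
  exact mul_le_mul_of_nonneg_left ht.2 hD0

/-- The convolution of `g` with the reflected kernel, `∑_y ε² K(y - z) g(y)`. -/
noncomputable def conv {N : ℕ} (ε : ℝ) (K : Torus N → ℝ) (g : Torus N → ℝ) (z : Torus N) : ℝ :=
  ∑ y, ε ^ 2 * K (y - z) * g y

/-- The jumps of `∑_y ε² g(y) f_y` are controlled by the convolution of `g` with `K`. -/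
def JumpBound {N : ℕ} {S : Type*} (A : (S → ℝ) → (S → ℝ)) (f : Torus N → S → ℝ) (ε : ℝ)
    (K : Torus N → ℝ) (a b : ℝ) : Prop :=
  ∀ q : ℝ, 2 ≤ q → ∀ (g : Torus N → ℝ) (s : S),
    A (jumpPow f q (fun y => ε ^ 2 * g y) s) s ≤ a * ∑ z, |b * conv ε K g z| ^ q

/-- The constant in the discrete Burkholder inequality. -/
noncomputable def bdgConst (p : ℝ) : ℝ := 4 ^ p * (3 ^ p + p ^ 2 * 2 ^ p)

theorem bdgConst_nonneg (p : ℝ) : 0 ≤ bdgConst p := by unfold bdgConst; positivity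

/-- The discrete stochastic integral `∑_{i<k} ∑_y ε² c_i(y) (M((i+1)h, y) - M(ih, y))`. -/
noncomputable def discreteIntegral {N : ℕ} (ε : ℝ) (M : ℝ → Torus N → ℝ) (h : ℝ)
    (c : ℕ → Torus N → ℝ) (k : ℕ) : ℝ :=
  ∑ i ∈ Finset.range k, ∑ y, ε ^ 2 * c i y * (M ((i + 1) * h) y - M (i * h) y)

theorem discreteIntegral_succ {N : ℕ} (ε : ℝ) (M : ℝ → Torus N → ℝ) (h : ℝ)
    (c : ℕ → Torus N → ℝ) (k : ℕ) : discreteIntegral ε M h c (k + 1) - discreteIntegral ε M h c k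
      = ∑ y, ε ^ 2 * c k y * (M (k * h + h) y - M (k * h) y) := by
  simp only [discreteIntegral, Finset.sum_range_succ, add_sub_cancel_left, add_mul, one_mul]

theorem partialSups_mem_Icc {x : ℕ → ℝ} (m : ℕ) {B : ℝ} (hx : ∀ k ≤ m, x k ∈ Icc 0 B) :
    partialSups x m ∈ Icc 0 B :=
  ⟨(hx 0 (Nat.zero_le _)).1.trans (le_partialSups_of_le x (Nat.zero_le _)),
    partialSups_le x m B fun k hk => (hx k hk).2⟩

theorem measurable_partialSups {Ω : Type*} [MeasurableSpace Ω] {x : ℕ → Ω → ℝ}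
    (hx : ∀ k, Measurable (x k)) (m : ℕ) : Measurable fun ω => partialSups (fun k => x k ω) m := by
  induction m with
  | zero => simpa using hx 0
  | succ m ih =>
    simp_rw [partialSups_add_one]
    exact ih.sup (hx _)

theorem mem_Icc_rpow {x B p : ℝ} (hp : 0 ≤ p) (hx : x ∈ Icc 0 B) : |x ^ p| ≤ B ^ p := by
  rw [abs_of_nonneg (Real.rpow_nonneg hx.1 _)]
  exact Real.rpow_le_rpow hx.1 hx.2 hp

/-- The discrete Burkholder inequality leaves two kinds of moments. The quadratic ones, weighted by
|x_k|^(p-2), give by Hölder a power of the moment of the maximum times the bracket. For those of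
order p, |bg|^p ≤ (bD)^(p-2) (bg)² reduces to the same bracket with a power of the maximal jump.
Both powers are then absorbed. `R` is chosen before the mesh, so the terms in R m h² disappear on
refinement. -/
theorem IsMarkovJump.exists_discreteIntegral_le {Ω : Type*} [mΩ : MeasurableSpace Ω] {P : Measure Ω}
    [IsProbabilityMeasure P] {S : Type*} [Fintype S] {A : (S → ℝ) →L[ℝ] (S → ℝ)}
    {ℱ : ℝ → MeasurableSpace Ω} {X : ℝ → Ω → S} (hX : IsMarkovJump P A ℱ X) {N : ℕ}
    {f : Torus N → S → ℝ} {ε : ℝ} {K : Torus N → ℝ} {a b : ℝ} (hJ : JumpBound A f ε K a b)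
    (ha : 0 ≤ a) (hb : 0 ≤ b) {p : ℝ} (hp : 2 ≤ p) (B : ℝ) : ∃ R, 0 ≤ R ∧
    ∀ (m : ℕ) (h : ℝ), h ∈ Icc (0 : ℝ) 1 → ∀ c : ℕ → Torus N → Ω → ℝ,
    (∀ (k : ℕ) y, Measurable[ℱ (k * h)] (c k y)) → (∀ k y ω, |c k y ω| ≤ B) →
    ∀ D : Ω → ℝ, Measurable D → (∃ b, ∀ ω, D ω ∈ Icc 0 b) →
    (∀ k < m, ∀ ω z, |conv ε K (fun y => c k y ω) z| ≤ D ω) →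
    Integrable (fun ω => (partialSups (fun k => |discreteIntegral ε
        (fun t y => dynkin A (f y) (fun t => X t ω) t) h (fun k y => c k y ω) k|) m) ^ p) P ∧
    (∫ ω, (partialSups (fun k => |discreteIntegral ε
        (fun t y => dynkin A (f y) (fun t => X t ω) t) h (fun k y => c k y ω) k|) m) ^ p ∂P) ^ (2 / p)
      ≤ (3 * bdgConst p + 1) * ((∑ k ∈ Finset.range m, h * ∑ z, a * b ^ 2 *
          (∫ ω, |conv ε K (fun y => c k y ω) z| ^ p ∂P) ^ (2 / p))
        + (b ^ p * ∫ ω, D ω ^ p ∂P) ^ (2 / p) + R * (m * h ^ 2) + (R * (m * h ^ 2)) ^ (2 / p)) := by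
  -- The increment estimate is needed with exponents 2 and p, for coefficients ε² c bounded by ε² B.
  obtain ⟨R₂, hR₂, h₂⟩ := IsMarkovJump.exists_integral_increment_le A f (le_refl (2 : ℝ)) (ε ^ 2 * B)
  obtain ⟨R₁, hR₁, h₁⟩ := IsMarkovJump.exists_integral_increment_le A f hp (ε ^ 2 * B)
  refine ⟨R₂ + R₁, by positivity, ?_⟩
  intro m h hh c hcm hcB D hDm ⟨Db, hDb⟩ hcD
  have hp0 : 0 < p := by linarith
  set M : Ω → ℝ → Torus N → ℝ := fun ω t y => dynkin A (f y) (fun t => X t ω) t with hM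
  set x : ℕ → Ω → ℝ := fun k ω => discreteIntegral ε (M ω) h (fun k y => c k y ω) k with hx
  have hkh : ∀ k : ℕ, 0 ≤ (k : ℝ) * h := fun k => mul_nonneg k.cast_nonneg hh.1
  have hle : ∀ {i k : ℕ}, i ≤ k → (i : ℝ) * h ≤ k * h := fun {i k} hik =>
    mul_le_mul_of_nonneg_right (by exact_mod_cast hik) hh.1
  have hmono : Monotone fun k : ℕ => ℱ (k * h) := fun i k hik => hX.mono (hle hik)
  have hxm : ∀ k : ℕ, Measurable[ℱ (k * h)] (x k) := fun k => by
    refine Finset.measurable_fun_sum _ fun i hi => Finset.measurable_fun_sum _ fun y _ => ?_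
    have hik : i + 1 ≤ k := Finset.mem_range.1 hi
    have h1 := hle hik
    push_cast at h1
    refine Measurable.mul (((hcm i y).mono (hmono (by omega)) le_rfl).const_mul _) (.sub ?_ ?_)
    · exact hX.measurable_dynkin_of_le (by have := hkh i; nlinarith [hh.1]) h1 _
    · exact hX.measurable_dynkin_of_le (hkh i) (hle (by omega)) _
  have hxm' : ∀ k, Measurable (x k) := fun k => (hxm k).mono (hX.le _) le_rfl
  have hxb : ∀ k, ∃ b, ∀ ω, |x k ω| ≤ b := fun k => by
    choose L hL using fun y => IsJumpPath.exists_abs_dynkin_le A (f y) (k * h)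
    refine ⟨∑ i ∈ Finset.range k, ∑ y, |ε ^ 2| * B * (L y + L y), fun ω => ?_⟩
    refine (Finset.abs_sum_le_sum_abs _ _).trans (Finset.sum_le_sum fun i hi =>
      (Finset.abs_sum_le_sum_abs _ _).trans (Finset.sum_le_sum fun y _ => ?_))
    have hik : i + 1 ≤ k := Finset.mem_range.1 hi
    have h1 := hle hik
    push_cast at h1
    refine abs_mul_le_of_le (abs_mul_le_of_le le_rfl (hcB i y ω)) ((abs_sub _ _).trans (add_le_add ?_ ?_))
    · exact hL y _ _ ⟨by have := hkh i; nlinarith [hh.1], h1⟩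
    · exact hL y _ _ ⟨hkh i, hle (by omega)⟩
  choose xb hxb using hxb
  have hinc : ∀ k ω, x (k + 1) ω - x k ω
      = ∑ y, ε ^ 2 * c k y ω * (M ω (k * h + h) y - M ω (k * h) y) := fun k ω =>
    discreteIntegral_succ _ _ _ _ _
  set C := ∑ k ∈ Finset.range (m + 1), |xb k| with hC
  have hxC : ∀ k ≤ m, ∀ ω, |x k ω| ∈ Icc 0 C := fun k hk ω =>
    ⟨abs_nonneg _, ((hxb k ω).trans (le_abs_self _)).trans
      (Finset.single_le_sum (f := fun k => |xb k|) (fun _ _ => abs_nonneg _)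
        (Finset.mem_range.2 (by omega)))⟩
  set s : Ω → ℝ := fun ω => partialSups (fun k => |x k ω|) m with hs
  have hsC : ∀ ω, s ω ∈ Icc 0 C := fun ω => partialSups_mem_Icc m fun k hk => hxC k hk ω
  have hsm : Measurable s := measurable_partialSups (fun k => continuous_abs.measurable.comp (hxm' k)) m
  set 𝔛 := ∫ ω, s ω ^ p ∂P with h𝔛
  have is : Integrable (fun ω => s ω ^ p) P :=
    integrable_of_abs_le (hsm.pow_const p) fun ω => mem_Icc_rpow hp0.le (hsC ω)
  have h𝔛0 : 0 ≤ 𝔛 := integral_nonneg fun ω => Real.rpow_nonneg (hsC ω).1 _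
  set θ := (p - 2) / p with hθ
  have hθ0 : 0 ≤ θ := div_nonneg (by linarith) hp0.le
  have hxs : ∀ k ≤ m, (∫ ω, |x k ω| ^ p ∂P) ^ θ ≤ 𝔛 ^ θ := fun k hk => by
    refine Real.rpow_le_rpow (integral_nonneg fun ω => Real.rpow_nonneg (abs_nonneg _) _) ?_ hθ0
    refine integral_mono_of_nonneg (Eventually.of_forall fun ω => Real.rpow_nonneg (abs_nonneg _) _)
      is (Eventually.of_forall fun ω => ?_)
    exact Real.rpow_le_rpow (abs_nonneg _) (le_partialSups_of_le (fun k => |x k ω|) hk) hp0.le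
  set g : ℕ → Torus N → Ω → ℝ := fun k z ω => |conv ε K (fun y => c k y ω) z| with hg
  have hcm' : ∀ k y, Measurable (c k y) := fun k y => (hcm k y).mono (hX.le _) le_rfl
  have hgm : ∀ k z, Measurable (g k z) := fun k z => continuous_abs.measurable.comp
    (Finset.measurable_fun_sum _ fun y _ => (hcm' k y).const_mul _)
  have hgD : ∀ k < m, ∀ z ω, g k z ω ∈ Icc 0 Db := fun k hk z ω =>
    ⟨abs_nonneg _, (hcD k hk ω z).trans (hDb ω).2⟩
  set φ : ℕ → Torus N → ℝ := fun k z => (∫ ω, g k z ω ^ p ∂P) ^ (2 / p) with hφ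
  have hφ0 : ∀ k z, 0 ≤ φ k z := fun k z => Real.rpow_nonneg (integral_nonneg fun ω =>
    Real.rpow_nonneg (abs_nonneg _) _) _
  have hcε : ∀ k y ω, |ε ^ 2 * c k y ω| ≤ ε ^ 2 * B := fun k y ω => by
    rw [abs_mul, abs_of_nonneg (sq_nonneg ε)]
    exact mul_le_mul_of_nonneg_left (hcB k y ω) (sq_nonneg ε)
  have hcεm : ∀ (k : ℕ) y, Measurable[ℱ (k * h)] fun ω => ε ^ 2 * c k y ω := fun k y => (hcm k y).const_mul _
  have hjm : ∀ (k : ℕ) (q : ℝ), Measurable[ℱ (k * h)] fun ω =>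
      A (jumpPow f q (fun y => ε ^ 2 * c k y ω) (X (k * h) ω)) (X (k * h) ω) := fun k q =>
    measurable_clm_apply (m := ℱ (k * h)) A (fun s => measurable_jumpPow (m := ℱ (k * h)) f q
      (hcεm k) (hX.adapted _ (hkh k)) s) (hX.adapted _ (hkh k))
  set 𝔡 := b ^ p * ∫ ω, D ω ^ p ∂P with h𝔡
  have hD0 : 0 ≤ ∫ ω, D ω ^ p ∂P := integral_nonneg fun ω => Real.rpow_nonneg (hDb ω).1 _
  have h𝔡0 : 0 ≤ 𝔡 := by positivity
  -- the quadratic increments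
  have quad : ∀ k < m, ∫ ω, |x k ω| ^ (p - 2) * (x (k + 1) ω - x k ω) ^ 2 ∂P
      ≤ 𝔛 ^ θ * (h * ∑ z, a * b ^ 2 * φ k z) + R₂ * h ^ 2 * 𝔛 ^ θ := by
    intro k hk
    have hW : Measurable[ℱ (k * h)] fun ω => |x k ω| ^ (p - 2) :=
      (continuous_abs.measurable.comp (hxm k)).pow_const _
    have hWb : ∀ ω, |(|x k ω| ^ (p - 2))| ≤ C ^ (p - 2) := fun ω =>
      mem_Icc_rpow (by linarith) (hxC k hk.le ω)
    have h3 := h₂ hX (k * h) h (hkh k) hh (fun y ω => ε ^ 2 * c k y ω) (hcεm k) (hcε k)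
      (fun ω => |x k ω| ^ (p - 2)) hW (fun ω => Real.rpow_nonneg (abs_nonneg _) _) ⟨_, hWb⟩
    have e : ∀ ω, |∑ y, ε ^ 2 * c k y ω * (dynkin A (f y) (fun t => X t ω) (k * h + h)
        - dynkin A (f y) (fun t => X t ω) (k * h))| ^ (2 : ℝ) = (x (k + 1) ω - x k ω) ^ 2 := fun ω => by
      rw [hinc, Real.rpow_two, sq_abs]
    simp_rw [e] at h3
    refine h3.trans (add_le_add ?_ ?_)
    · have h4 : ∫ ω, |x k ω| ^ (p - 2) *
            A (jumpPow f 2 (fun y => ε ^ 2 * c k y ω) (X (k * h) ω)) (X (k * h) ω) ∂P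
          ≤ ∫ ω, ∑ z, a * b ^ 2 * (|x k ω| ^ (p - 2) * g k z ω ^ 2) ∂P := by
        refine integral_mono_ae ?_ ?_ (Eventually.of_forall fun ω => ?_)
        · obtain ⟨Q, hQ⟩ : ∃ Q, ∀ ω,
              |A (jumpPow f 2 (fun y => ε ^ 2 * c k y ω) (X (k * h) ω)) (X (k * h) ω)| ≤ Q := by
            choose Bf hBf0 hBf using fun y => exists_abs_le_of_finite (f y)
            refine ⟨‖A‖ * (∑ y, ε ^ 2 * B * (Bf y + Bf y)) ^ (2 : ℝ), fun ω =>
              (abs_apply_le_norm _ _).trans ((A.le_opNorm _).trans ?_)⟩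
            refine mul_le_mul_of_nonneg_left ?_ (norm_nonneg _)
            refine (pi_norm_le_iff_of_nonneg (Real.rpow_nonneg (Finset.sum_nonneg fun y _ => ?_) _)).2
              fun s => ?_
            · have := (abs_nonneg _).trans (hcε k y ω)
              have := hBf0 y
              positivity
            · rw [Real.norm_eq_abs, jumpPow]
              refine mem_Icc_rpow two_pos.le ⟨abs_nonneg _, (Finset.abs_sum_le_sum_abs _ _).trans
                (Finset.sum_le_sum fun y _ => abs_mul_le_of_le (hcε k y ω) ?_)⟩
              exact (abs_sub _ _).trans (add_le_add (hBf _ _) (hBf _ _))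
          exact integrable_of_abs_le (((hW.mul (hjm k 2))).mono (hX.le _) le_rfl)
            fun ω => abs_mul_le_of_le (hWb ω) (hQ ω)
        · refine integrable_finsetSum _ fun z _ => Integrable.const_mul ?_ _
          refine integrable_of_abs_le ((hW.mono (hX.le _) le_rfl).mul ((hgm k z).pow_const 2))
            (B := C ^ (p - 2) * Db ^ 2) fun ω => abs_mul_le_of_le (hWb ω) ?_
          rw [abs_of_nonneg (sq_nonneg _)]
          exact pow_le_pow_left₀ (hgD k hk z ω).1 (hgD k hk z ω).2 2
        · have := mul_le_mul_of_nonneg_left (hJ 2 le_rfl (fun y => c k y ω) (X (k * h) ω))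
            (Real.rpow_nonneg (abs_nonneg (x k ω)) (p - 2))
          refine this.trans (le_of_eq ?_)
          rw [Finset.mul_sum, Finset.mul_sum]
          refine Finset.sum_congr rfl fun z _ => ?_
          rw [Real.rpow_two, hg, sq_abs, sq_abs]
          ring
      have h5 : ∫ ω, ∑ z, a * b ^ 2 * (|x k ω| ^ (p - 2) * g k z ω ^ 2) ∂P
          ≤ ∑ z, a * b ^ 2 * (𝔛 ^ θ * φ k z) := by
        rw [integral_finsetSum]
        · refine Finset.sum_le_sum fun z _ => ?_
          rw [integral_const_mul]
          refine mul_le_mul_of_nonneg_left ?_ (by positivity)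
          refine (integral_rpow_mul_sq_le hp (continuous_abs.measurable.comp (hxm' k)) (hgm k z)
            ⟨C, hxC k hk.le⟩ ⟨Db, hgD k hk z⟩).trans ?_
          exact mul_le_mul_of_nonneg_right (hxs k hk.le) (hφ0 k z)
        · refine fun z _ => Integrable.const_mul ?_ _
          refine integrable_of_abs_le ((hW.mono (hX.le _) le_rfl).mul ((hgm k z).pow_const 2))
            (B := C ^ (p - 2) * Db ^ 2) fun ω => abs_mul_le_of_le (hWb ω) ?_
          rw [abs_of_nonneg (sq_nonneg _)]
          exact pow_le_pow_left₀ (hgD k hk z ω).1 (hgD k hk z ω).2 2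
      refine (mul_le_mul_of_nonneg_left (h4.trans h5) hh.1).trans (le_of_eq ?_)
      rw [Finset.mul_sum, Finset.mul_sum, Finset.mul_sum]
      refine Finset.sum_congr rfl fun z _ => ?_
      ring
    · refine mul_le_mul_of_nonneg_left ?_ (by have := hh.1; positivity)
      exact (integral_rpow_sub_two_le hp (continuous_abs.measurable.comp (hxm' k))
        ⟨C, hxC k hk.le⟩).trans (hxs k hk.le)
  -- the increments of order `p`
  have high : ∀ k < m, ∫ ω, |x (k + 1) ω - x k ω| ^ p ∂P
      ≤ 𝔡 ^ θ * (h * ∑ z, a * b ^ 2 * φ k z) + R₁ * h ^ 2 := by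
    intro k hk
    have h3 := h₁ hX (k * h) h (hkh k) hh (fun y ω => ε ^ 2 * c k y ω) (hcεm k) (hcε k)
      (fun _ => 1) measurable_const (fun _ => zero_le_one) ⟨1, fun _ => by simp⟩
    simp only [one_mul, integral_const, probReal_univ, smul_eq_mul, mul_one] at h3
    have e : ∀ ω, |∑ y, ε ^ 2 * c k y ω * (dynkin A (f y) (fun t => X t ω) (k * h + h)
        - dynkin A (f y) (fun t => X t ω) (k * h))| ^ p = |x (k + 1) ω - x k ω| ^ p := fun ω => by
      rw [hinc]
    simp_rw [e] at h3
    refine h3.trans (add_le_add ?_ le_rfl)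
    have hbD : Measurable fun ω => b * D ω := hDm.const_mul b
    have hbDb : ∀ ω, b * D ω ∈ Icc 0 (b * Db) := fun ω =>
      ⟨mul_nonneg hb (hDb ω).1, mul_le_mul_of_nonneg_left (hDb ω).2 hb⟩
    have iz : ∀ z, Integrable (fun ω => a * b ^ 2 * ((b * D ω) ^ (p - 2) * g k z ω ^ 2)) P := fun z => by
      refine Integrable.const_mul ?_ _
      refine integrable_of_abs_le ((hbD.pow_const _).mul ((hgm k z).pow_const 2))
        (B := (b * Db) ^ (p - 2) * Db ^ 2) fun ω =>
          abs_mul_le_of_le (mem_Icc_rpow (by linarith) (hbDb ω)) ?_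
      rw [abs_of_nonneg (sq_nonneg _)]
      exact pow_le_pow_left₀ (hgD k hk z ω).1 (hgD k hk z ω).2 2
    have hpt : ∀ ω, A (jumpPow f p (fun y => ε ^ 2 * c k y ω) (X (k * h) ω)) (X (k * h) ω)
        ≤ ∑ z, a * b ^ 2 * ((b * D ω) ^ (p - 2) * g k z ω ^ 2) := fun ω => by
      refine (hJ p hp (fun y => c k y ω) (X (k * h) ω)).trans ?_
      rw [Finset.mul_sum]
      refine Finset.sum_le_sum fun z _ => ?_
      rw [mul_assoc a]
      refine mul_le_mul_of_nonneg_left ?_ ha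
      have hg0 := (hgD k hk z ω).1
      rw [abs_mul, abs_of_nonneg hb]
      calc (b * g k z ω) ^ p = (b * g k z ω) ^ (p - 2) * (b * g k z ω) ^ (2 : ℝ) := by
            rw [← Real.rpow_add_of_nonneg (mul_nonneg hb hg0) (by linarith) two_pos.le,
              sub_add_cancel]
        _ ≤ (b * D ω) ^ (p - 2) * (b * g k z ω) ^ (2 : ℝ) := by
            gcongr
            exact hcD k hk ω z
        _ = _ := by rw [Real.rpow_two]; ring
    have h4 : ∫ ω, A (jumpPow f p (fun y => ε ^ 2 * c k y ω) (X (k * h) ω)) (X (k * h) ω) ∂P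
        ≤ ∫ ω, ∑ z, a * b ^ 2 * ((b * D ω) ^ (p - 2) * g k z ω ^ 2) ∂P := by
      -- Integrability of the left side need not be shown: otherwise its integral is 0 by
      -- convention, and the right side is nonnegative.
      by_cases hi : Integrable (fun ω =>
          A (jumpPow f p (fun y => ε ^ 2 * c k y ω) (X (k * h) ω)) (X (k * h) ω)) P
      · exact integral_mono_ae hi (integrable_finsetSum _ fun z _ => iz z)
          (Eventually.of_forall hpt)
      · rw [integral_undef hi]
        refine integral_nonneg fun ω => Finset.sum_nonneg fun z _ => ?_
        have := Real.rpow_nonneg (hbDb ω).1 (p - 2)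
        positivity
    have h5 : ∫ ω, ∑ z, a * b ^ 2 * ((b * D ω) ^ (p - 2) * g k z ω ^ 2) ∂P
        ≤ ∑ z, a * b ^ 2 * (𝔡 ^ θ * φ k z) := by
      rw [integral_finsetSum _ fun z _ => iz z]
      refine Finset.sum_le_sum fun z _ => ?_
      rw [integral_const_mul]
      refine mul_le_mul_of_nonneg_left ?_ (by positivity)
      refine (integral_rpow_mul_sq_le hp hbD (hgm k z) ⟨_, hbDb⟩ ⟨Db, hgD k hk z⟩).trans ?_
      refine mul_le_mul_of_nonneg_right (le_of_eq ?_) (hφ0 k z)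
      simp_rw [fun ω => Real.mul_rpow (z := p) hb (hDb ω).1]
      rw [integral_const_mul]
    refine (mul_le_mul_of_nonneg_left (h4.trans h5) hh.1).trans (le_of_eq ?_)
    rw [Finset.mul_sum, Finset.mul_sum, Finset.mul_sum]
    refine Finset.sum_congr rfl fun z _ => ?_
    ring
  have hbdg := integral_partialSups_rpow_le P hp m (fun k => ℱ (k * h)) hmono (fun k => hX.le _) x
    hxm (fun k => ⟨xb k, hxb k⟩) (fun ω => by simp [hx, discreteIntegral]) (fun k hk Z hZ ⟨Zb, hZb⟩ => by
      simp_rw [hinc, Finset.mul_sum]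
      have e : ∀ y, ∫ ω, Z ω * (ε ^ 2 * c k y ω * (M ω (k * h + h) y - M ω (k * h) y)) ∂P = 0 := fun y => by
        -- The coefficient c_k is known at time k h, so its product with the test function is again
        -- an admissible test function.
        have := hX.integral_mul_dynkin (hkh k) hh.1 (f y) (hZ.mul (hcεm k y))
          (fun ω => abs_mul_le_of_le (hZb ω) (hcε k y ω))
        simpa only [mul_assoc, Pi.mul_apply] using this
      rw [integral_finsetSum]
      · exact Finset.sum_eq_zero fun y _ => e y
      · intro y _
        obtain ⟨L, hL⟩ := IsJumpPath.exists_abs_dynkin_le A (f y) (k * h + h)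
        refine integrable_of_abs_le (B := Zb * (ε ^ 2 * B * (L + L))) ?_ fun ω =>
          abs_mul_le_of_le (hZb ω) (abs_mul_le_of_le (hcε k y ω) ((abs_sub _ _).trans (add_le_add ?_ ?_)))
        · refine (hZ.mono (hX.le _) le_rfl).mul (((hcm' k y).const_mul _).mul (.sub ?_ ?_))
          · exact (hX.measurable_dynkin_of_le (add_nonneg (hkh k) hh.1) le_rfl _).mono (hX.le _) le_rfl
          · exact (hX.measurable_dynkin_of_le (hkh k) le_rfl _).mono (hX.le _) le_rfl
        · exact hL _ _ ⟨add_nonneg (hkh k) hh.1, le_rfl⟩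
        · exact hL _ _ ⟨hkh k, by linarith [hh.1]⟩)
  have hbdg' : 𝔛 ≤ bdgConst p * ∑ k ∈ Finset.range m,
      (∫ ω, |x k ω| ^ (p - 2) * (x (k + 1) ω - x k ω) ^ 2 ∂P
        + ∫ ω, |x (k + 1) ω - x k ω| ^ p ∂P) := hbdg
  set 𝔟 := ∑ k ∈ Finset.range m, h * ∑ z, a * b ^ 2 * φ k z with h𝔟
  have h𝔟0 : 0 ≤ 𝔟 := Finset.sum_nonneg fun k _ => mul_nonneg hh.1
    (Finset.sum_nonneg fun z _ => mul_nonneg (by positivity) (hφ0 k z))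
  have hρ0 : 0 ≤ (R₂ + R₁) * (m * h ^ 2) := by positivity
  refine ⟨is, rpow_two_div_le_of_le hp (bdgConst_nonneg p) h𝔛0 h𝔟0 h𝔡0 hρ0 (hbdg'.trans ?_)⟩
  refine mul_le_mul_of_nonneg_left ?_ (bdgConst_nonneg p)
  have hsum : ∑ k ∈ Finset.range m, (∫ ω, |x k ω| ^ (p - 2) * (x (k + 1) ω - x k ω) ^ 2 ∂P
        + ∫ ω, |x (k + 1) ω - x k ω| ^ p ∂P)
      ≤ ∑ k ∈ Finset.range m, ((𝔛 ^ θ + 𝔡 ^ θ) * (h * ∑ z, a * b ^ 2 * φ k z)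
        + (R₂ * h ^ 2 * 𝔛 ^ θ + R₁ * h ^ 2)) := by
    refine Finset.sum_le_sum fun k hk => ?_
    have h6 := quad k (Finset.mem_range.1 hk)
    have h7 := high k (Finset.mem_range.1 hk)
    linarith
  refine hsum.trans ?_
  rw [Finset.sum_add_distrib, ← Finset.mul_sum, Finset.sum_const, Finset.card_range, nsmul_eq_mul,
    ← h𝔟]
  have hX0 : 0 ≤ 𝔛 ^ θ := Real.rpow_nonneg h𝔛0 _
  have h8 : 0 ≤ 𝔛 ^ θ * (R₁ * (m * h ^ 2)) := by positivity
  have h9 : 0 ≤ R₂ * (m * h ^ 2) := by positivity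
  nlinarith

section

/-! ### Convolution in the first variable -/

variable {N n : ℕ}

/-- Convolution of a kernel in its first space variable. -/
noncomputable def convHead (ε : ℝ) (K : Torus N → ℝ) (F : TimeSpaceKernel N (n + 1)) :
    TimeSpaceKernel N (n + 1) :=
  fun r z => ∑ y, ε ^ 2 * K (y - z 0) * F r (Fin.cons y (Fin.tail z))

theorem freezeFirst_convHead (ε : ℝ) (K : Torus N → ℝ) (F : TimeSpaceKernel N (n + 1)) (s : ℝ)
    (z : Torus N) : freezeFirst (convHead ε K F) s z
      = fun rs ys => ∑ y, ε ^ 2 * K (y - z) * freezeFirst F s y rs ys := rfl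

theorem Admissible.convHead {F : TimeSpaceKernel N (n + 1)} (hF : Admissible F) (ε : ℝ)
    (K : Torus N → ℝ) : Admissible (convHead ε K F) := by
  refine ⟨fun r z hr j => ?_, fun T => ?_⟩
  · exact tendsto_finsetSum _ fun y _ =>
      (hF.leftContinuous r (Fin.cons y (Fin.tail z)) hr j).const_mul (ε ^ 2 * K (y - z 0))
  · obtain ⟨B, hB⟩ := hF.locallyBounded T
    refine ⟨∑ z, ∑ y : Torus N, |ε ^ 2 * K (y - z)| * B, fun r z hr => ?_⟩
    have hB0 : 0 ≤ B := (abs_nonneg _).trans (hB r z hr)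
    refine le_trans ((Finset.abs_sum_le_sum_abs _ _).trans (Finset.sum_le_sum fun y _ =>
      abs_mul_le_of_le le_rfl (hB r (Fin.cons y (Fin.tail z)) hr))) ?_
    exact Finset.single_le_sum (f := fun z => ∑ y : Torus N, |ε ^ 2 * K (y - z)| * B)
      (fun z _ => Finset.sum_nonneg fun y _ => mul_nonneg (abs_nonneg _) hB0) (Finset.mem_univ (z 0))

theorem MeasurableFamily.convHead {α : Type*} [MeasurableSpace α]
    {F : α → TimeSpaceKernel N (n + 1)} (hF : MeasurableFamily F) (ε : ℝ) (K : Torus N → ℝ) :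
    MeasurableFamily fun a => IsingKac.convHead ε K (F a) :=
  ⟨fun a => (hF.admissible a).convHead ε K, fun z => Finset.measurable_fun_sum _ fun y _ =>
    (hF.measurable (Fin.cons y (Fin.tail z))).const_mul _⟩

/-- By linearity, convolving the integrand amounts to convolving the kernel. This transfers K from
the jumps of the martingale to F. -/
theorem conv_diagIntegral (ε : ℝ) (K : Torus N → ℝ) {M : ℝ → Torus N → ℝ}
    (hM : ∀ y, IsDriver fun s => M s y) {F : TimeSpaceKernel N (n + 1)} (hF : Admissible F) {s : ℝ}
    (hs : 0 ≤ s) (z : Torus N) : conv ε K (fun y => diagIntegral ε M n F y s) z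
      = diagIntegral ε M n (convHead ε K F) z s :=
  (iteratedIntegral_sum ε hM Finset.univ (fun y => ε ^ 2 * K (y - z))
    (fun y => hF.freezeFirst hs y) hs).symm

/-! ### Riemann sums of lower integrals -/

/-- The integrand is constant on each cell, so `g` can be arbitrary. -/
theorem lintegral_comp_gridBelow (g : ℝ → ℝ≥0∞) {h : ℝ} (hh : 0 < h) (m : ℕ) :
    ∫⁻ s in Ioc 0 (m * h), g (gridBelow h s) = ∑ k ∈ Finset.range m, ENNReal.ofReal h * g (k * h) := by
  induction m with
  | zero => simp
  | succ m ih =>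
    have h0 : (0 : ℝ) ≤ m * h := by positivity
    have h1 : (m : ℝ) * h ≤ (m + 1 : ℕ) * h := by push_cast; nlinarith
    rw [← Ioc_union_Ioc_eq_Ioc h0 h1, lintegral_union measurableSet_Ioc
      (Ioc_disjoint_Ioc_of_le le_rfl), ih, Finset.sum_range_succ]
    congr 1
    rw [setLIntegral_congr_fun (g := fun _ => g (m * h)) measurableSet_Ioc fun s hs => ?_,
      setLIntegral_const, Real.volume_Ioc, mul_comm]
    · push_cast
      ring_nf
    · rw [gridBelow_eq hh (by simpa using hs)]

/-- The lemma of Fatou for a double sequence. -/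
theorem lintegral_le_of_le_liminf_liminf {Ω : Type*} [MeasurableSpace Ω] {P : Measure Ω}
    {Z : Ω → ℝ≥0∞} {Y : ℕ → ℕ → Ω → ℝ≥0∞} (hY : ∀ B m, Measurable (Y B m)) {V : ℕ → ℕ → ℝ≥0∞}
    {W : ℝ≥0∞} (hZ : ∀ ω, Z ω ≤ liminf (fun B => liminf (fun m => Y B m ω) atTop) atTop)
    (hYV : ∀ B, ∀ᶠ m in atTop, ∫⁻ ω, Y B m ω ∂P ≤ V B m)
    (hV : ∀ B, ∃ W' ≤ W, Tendsto (V B) atTop (𝓝 W')) : ∫⁻ ω, Z ω ∂P ≤ W := by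
  calc ∫⁻ ω, Z ω ∂P ≤ ∫⁻ ω, liminf (fun B => liminf (fun m => Y B m ω) atTop) atTop ∂P :=
        lintegral_mono hZ
    _ ≤ liminf (fun B => ∫⁻ ω, liminf (fun m => Y B m ω) atTop ∂P) atTop :=
        lintegral_liminf_le fun B => Measurable.liminf fun m => hY B m
    _ ≤ liminf (fun _ : ℕ => W) atTop := by
        refine liminf_le_liminf (Eventually.of_forall fun B => ?_)
        obtain ⟨W', hW', hlim⟩ := hV B
        calc ∫⁻ ω, liminf (fun m => Y B m ω) atTop ∂P
            ≤ liminf (fun m => ∫⁻ ω, Y B m ω ∂P) atTop := lintegral_liminf_le fun m => hY B m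
          _ ≤ liminf (V B) atTop := liminf_le_liminf (hYV B)
          _ = W' := hlim.liminf_eq
          _ ≤ W := hW'
    _ = W := by simp

theorem ofReal_abs_rpow {p : ℝ} (hp : 0 ≤ p) (x : ℝ) : ENNReal.ofReal (|x| ^ p) = ‖x‖ₑ ^ p := by
  rw [Real.enorm_eq_ofReal_abs, ENNReal.ofReal_rpow_of_nonneg (abs_nonneg _) hp]

/-! ### Adaptedness and moments of iterated integrals against Dynkin martingales -/

section Markov

variable {Ω : Type*} [mΩ : MeasurableSpace Ω] {P : Measure Ω}
  {S : Type*} [Fintype S] {A : (S → ℝ) →L[ℝ] (S → ℝ)} {ℱ : ℝ → MeasurableSpace Ω} {X : ℝ → Ω → S}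

/-- The Dynkin martingales of a family of functions of a process. -/
noncomputable def dynkinFamily (A : (S → ℝ) →L[ℝ] (S → ℝ)) (f : Torus N → S → ℝ) (X : ℝ → Ω → S)
    (ω : Ω) (t : ℝ) (y : Torus N) : ℝ := dynkin A (f y) (fun t => X t ω) t

theorem IsMarkovJump.isDriver (hX : IsMarkovJump P A ℱ X) (f : Torus N → S → ℝ) (ω : Ω)
    (y : Torus N) : IsDriver fun s => dynkinFamily A f X ω s y :=
  (hX.path ω).isDriver_dynkin A (f y)

/-- The general measurability statement is instantiated at the σ-algebra `ℱ T` instead of the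
ambient one. -/
theorem IsMarkovJump.measurable_iteratedIntegral (hX : IsMarkovJump P A ℱ X) (f : Torus N → S → ℝ)
    (ε : ℝ) {T : ℝ} (hT : 0 ≤ T) {α : Type*} [MeasurableSpace α] {F : α → TimeSpaceKernel N n}
    (hF : MeasurableFamily F) :
    Measurable[@Prod.instMeasurableSpace _ _ _ (@Prod.instMeasurableSpace _ _ _ (ℱ T))]
      fun q : α × ℝ × Ω =>
        iteratedIntegral ε (dynkinFamily A f X q.2.2) n (F q.1) (max 0 (min q.2.1 T)) :=
  @MeasurableFamily.measurable_iteratedIntegral N n Ω (ℱ T) ε (fun s ω y => dynkinFamily A f X ω s y)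
    (fun ω y => hX.isDriver f ω y) T hT (fun y => hX.measurable_dynkin_adapted hT (f y)) α _ F hF

theorem IsMarkovJump.measurable_iteratedIntegral_of_le (hX : IsMarkovJump P A ℱ X)
    (f : Torus N → S → ℝ) (ε : ℝ) {F : TimeSpaceKernel N n} (hF : Admissible F) {s T : ℝ}
    (hs : 0 ≤ s) (hsT : s ≤ T) :
    Measurable[ℱ T] fun ω => iteratedIntegral ε (dynkinFamily A f X ω) n F s := by
  have h0 : Measurable[ℱ T, @Prod.instMeasurableSpace _ _ _ (ℱ T)] fun ω : Ω => (s, ω) :=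
    @measurable_prodMk_left ℝ Ω _ (ℱ T) s
  have h1 : Measurable[ℱ T, @Prod.instMeasurableSpace _ _ _ (@Prod.instMeasurableSpace _ _ _ (ℱ T))]
      fun ω : Ω => (((), s, ω) : Unit × ℝ × Ω) :=
    @Measurable.comp _ _ _ (ℱ T) (@Prod.instMeasurableSpace _ _ _ (ℱ T))
      (@Prod.instMeasurableSpace _ _ _ (@Prod.instMeasurableSpace _ _ _ (ℱ T))) _ _
      (@measurable_prodMk_left Unit (ℝ × Ω) _ (@Prod.instMeasurableSpace _ _ _ (ℱ T)) ()) h0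
  have := @Measurable.comp _ _ _ (ℱ T)
    (@Prod.instMeasurableSpace _ _ _ (@Prod.instMeasurableSpace _ _ _ (ℱ T))) _ _ _
    (hX.measurable_iteratedIntegral f ε (hs.trans hsT) (hF.measurableFamily (α := Unit))) h1
  simpa only [Function.comp_def, min_eq_left hsT, max_eq_right hs] using this

theorem IsMarkovJump.measurable_diagIntegral (hX : IsMarkovJump P A ℱ X)
    (f : Torus N → S → ℝ) (ε : ℝ) {F : TimeSpaceKernel N (n + 1)} (hF : Admissible F) (y : Torus N)
    {s : ℝ} (hs : 0 ≤ s) :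
    Measurable[ℱ s] fun ω => diagIntegral ε (dynkinFamily A f X ω) n F y s :=
  hX.measurable_iteratedIntegral_of_le f ε (hF.freezeFirst hs y) hs le_rfl

/-- The `p`-th moment of the maximum of an iterated integral, raised to the power `2 / p`. -/
noncomputable def supMoment (P : Measure Ω) (ε p : ℝ) (M : Ω → ℝ → Torus N → ℝ) (n : ℕ)
    (F : TimeSpaceKernel N n) (t : ℝ) : ℝ≥0∞ :=
  (∫⁻ ω, ⨆ r ∈ Icc 0 t, ‖iteratedIntegral ε (M ω) n F r‖ₑ ^ p ∂P) ^ (2 / p)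

/-- The `p`-th moment of the maximal jump of an iterated integral, raised to the power `2 / p`, up
to a constant. The maximum is taken over rational proportions of `t`, for measurability. -/
noncomputable def diagMoment (P : Measure Ω) (ε p : ℝ) (M : Ω → ℝ → Torus N → ℝ) (n : ℕ)
    (F : TimeSpaceKernel N (n + 1)) (t : ℝ) : ℝ≥0∞ :=
  (∫⁻ ω, ⨆ q : ℚ, ⨆ z, ‖diagIntegral ε (M ω) n F z (max 0 (min (q : ℝ) 1) * t)‖ₑ ^ p ∂P) ^ (2 / p)

end Markov

end

section

/-! ### The moment bound for one stochastic integral -/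

variable {N n : ℕ}

/-- The diagonal process, set to zero where one of its components exceeds `B`. -/
noncomputable def cutDiag (ε : ℝ) (M : ℝ → Torus N → ℝ) (n : ℕ) (F : TimeSpaceKernel N (n + 1))
    (B s : ℝ) (y : Torus N) : ℝ :=
  if ∀ z, |diagIntegral ε M n F z s| ≤ B then diagIntegral ε M n F y s else 0

theorem abs_cutDiag_le (ε : ℝ) (M : ℝ → Torus N → ℝ) (F : TimeSpaceKernel N (n + 1)) {B : ℝ}
    (hB : 0 ≤ B) (s : ℝ) (y : Torus N) : |cutDiag ε M n F B s y| ≤ B := by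
  unfold cutDiag
  split_ifs with h
  · exact h y
  · simpa using hB

/-- The truncation kills all components at once, so its convolution is either the full one or zero.
A componentwise truncation would not have this property. -/
theorem abs_conv_cutDiag_le (ε : ℝ) (K : Torus N → ℝ) {M : ℝ → Torus N → ℝ}
    (hM : ∀ y, IsDriver fun s => M s y) {F : TimeSpaceKernel N (n + 1)} (hF : Admissible F) (B : ℝ)
    {s : ℝ} (hs : 0 ≤ s) (z : Torus N) :
    |conv ε K (cutDiag ε M n F B s) z| ≤ |diagIntegral ε M n (convHead ε K F) z s| := by
  rw [← conv_diagIntegral ε K hM hF hs]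
  by_cases h : ∀ z, |diagIntegral ε M n F z s| ≤ B
  · simp only [conv, cutDiag, if_pos h, le_refl]
  · simp only [conv, cutDiag, if_neg h, mul_zero, Finset.sum_const_zero, abs_zero]
    exact abs_nonneg _

theorem abs_conv_le (ε : ℝ) (K : Torus N → ℝ) {g : Torus N → ℝ} {B : ℝ} (hg : ∀ y, |g y| ≤ B)
    (z : Torus N) : |conv ε K g z| ≤ ∑ z, ∑ y : Torus N, |ε ^ 2 * K (y - z)| * B := by
  have hB0 : 0 ≤ B := (abs_nonneg _).trans (hg z)
  refine ((Finset.abs_sum_le_sum_abs _ _).trans (Finset.sum_le_sum fun y _ =>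
      abs_mul_le_of_le le_rfl (hg y))).trans ?_
  exact Finset.single_le_sum (f := fun z => ∑ y : Torus N, |ε ^ 2 * K (y - z)| * B)
    (fun z _ => Finset.sum_nonneg fun y _ => mul_nonneg (abs_nonneg _) hB0) (Finset.mem_univ z)

/-- Once B exceeds the path's own bound on [0,t] the truncation is inactive, and the Riemann sum at
r is one of the values in the running maximum. -/
theorem enorm_iteratedIntegral_rpow_le_liminf (ε : ℝ) {M : ℝ → Torus N → ℝ}
    (hM : ∀ y, IsDriver fun s => M s y) {F : TimeSpaceKernel N (n + 1)} (hF : Admissible F)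
    {p : ℝ} (hp : 0 < p) {r t : ℝ} (ht : 0 < t) (hr : r ∈ Icc 0 t) :
    ‖iteratedIntegral ε M (n + 1) F r‖ₑ ^ p ≤ liminf (fun B : ℕ => liminf (fun m : ℕ =>
      ENNReal.ofReal ((partialSups (fun k => |discreteIntegral ε M (t / m)
        (fun k => cutDiag ε M n F B (k * (t / m))) k|) m) ^ p)) atTop) atTop := by
  choose B hB using fun y => ((pathwiseRegular ε hM n).regulated_diag hF y).bdd t
  refine le_liminf_of_le (by isBoundedDefault) ?_
  -- The threshold depends on the path, which forces the liminf in B outside the liminf in the mesh.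
  filter_upwards [eventually_ge_atTop ⌈∑ y, |B y|⌉₊] with b hb
  have hbB : ∀ y, ∀ s ∈ Icc 0 t, |diagIntegral ε M n F y s| ≤ b := fun y s hs => by
    refine ((hB y s hs).trans (le_abs_self _)).trans
      ((Finset.single_le_sum (f := fun y => |B y|) (fun _ _ => abs_nonneg _)
        (Finset.mem_univ y)).trans (Nat.ceil_le.1 hb))
  have hlim := (((continuous_abs.tendsto _).comp
    (tendsto_riemannSum_iteratedIntegral_ceil ε hM hF ht hr)).rpow_const (p := p) (Or.inr hp.le))
  have hlim' := (ENNReal.continuous_ofReal.tendsto _).comp hlim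
  rw [ofReal_abs_rpow hp.le] at hlim'
  rw [← hlim'.liminf_eq]
  refine liminf_le_liminf ?_
  filter_upwards [eventually_gt_atTop 0] with m hm
  have hm' : (0 : ℝ) < m := by exact_mod_cast hm
  have hh : 0 < t / m := by positivity
  have hle : ⌈r / (t / m)⌉₊ ≤ m := by
    rw [Nat.ceil_le, div_le_iff₀ hh, mul_div_cancel₀ _ hm'.ne']
    exact hr.2
  refine ENNReal.ofReal_le_ofReal (Real.rpow_le_rpow (abs_nonneg _) ?_ hp.le)
  have e : ∑ y : Torus N, ε ^ 2 * ∑ k ∈ Finset.range ⌈r / (t / m)⌉₊,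
      diagIntegral ε M n F y (k * (t / m)) * (M ((k + 1) * (t / m)) y - M (k * (t / m)) y)
      = discreteIntegral ε M (t / m) (fun k => cutDiag ε M n F b (k * (t / m))) ⌈r / (t / m)⌉₊ := by
    simp only [discreteIntegral, Finset.mul_sum]
    rw [Finset.sum_comm]
    refine Finset.sum_congr rfl fun k hk => Finset.sum_congr rfl fun y _ => ?_
    have hkm : (k : ℝ) ≤ m := by exact_mod_cast ((Finset.mem_range.1 hk).trans_le hle).le
    have hkt : (k : ℝ) * (t / m) ∈ Icc 0 t := by
      refine ⟨by positivity, ?_⟩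
      calc (k : ℝ) * (t / m) ≤ m * (t / m) := by gcongr
        _ = t := mul_div_cancel₀ _ hm'.ne'
    rw [cutDiag, if_pos fun z => hbB z _ hkt, mul_assoc]
  simp only [Function.comp_apply]
  rw [e]
  exact le_partialSups_of_le (fun k => |discreteIntegral ε M (t / m)
    (fun k => cutDiag ε M n F b (k * (t / m))) k|) hle

/-- Dominated convergence, in ω at fixed s and then in s; the minimum with B supplies the
domination. Measurability in s of the approximations is free because they live on a grid. -/
theorem tendsto_lintegral_gridBelow {Ω : Type*} [MeasurableSpace Ω] {P : Measure Ω}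
    [IsProbabilityMeasure P] {ι : Type*} [Fintype ι] {g : ι → ℝ → Ω → ℝ}
    (hgm : ∀ i s, 0 ≤ s → Measurable (g i s)) (hg : ∀ i ω, Regulated fun s => g i s ω)
    {p B : ℝ} (hp : 0 < p) (hB : 0 ≤ B) (c : ℝ) {t : ℝ} (ht : 0 < t) :
    Tendsto (fun m : ℕ => ∫⁻ s in Ioc 0 t, ∑ i, ENNReal.ofReal c *
        (∫⁻ ω, ENNReal.ofReal ((min |g i (gridBelow (t / m) s) ω| B) ^ p) ∂P) ^ (2 / p)) atTop
      (𝓝 (∫⁻ s in Ioc 0 t, ∑ i, ENNReal.ofReal c *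
        (∫⁻ ω, ENNReal.ofReal ((min |Function.leftLim (fun s => g i s ω) s| B) ^ p) ∂P) ^ (2 / p))) := by
  have hbd : ∀ x : ℝ, ENNReal.ofReal ((min |x| B) ^ p) ≤ ENNReal.ofReal (B ^ p) := fun x =>
    ENNReal.ofReal_le_ofReal (Real.rpow_le_rpow (le_min (abs_nonneg _) hB) (min_le_right _ _) hp.le)
  have hτ : 0 ≤ 2 / p := by positivity
  refine tendsto_lintegral_of_dominated_convergence
    (fun _ => ∑ _ : ι, ENNReal.ofReal c * ENNReal.ofReal (B ^ p) ^ (2 / p)) (fun m => ?_)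
    (fun m => Eventually.of_forall fun s => ?_) ?_ ?_
  · exact measurable_comp_gridBelow (fun s => ∑ i, ENNReal.ofReal c *
        (∫⁻ ω, ENNReal.ofReal ((min |g i s ω| B) ^ p) ∂P) ^ (2 / p)) (t / m)
  · refine Finset.sum_le_sum fun i _ => ?_
    gcongr
    refine (lintegral_mono fun ω => hbd _).trans ?_
    simp
  · rw [setLIntegral_const]
    refine ENNReal.mul_ne_top (ENNReal.sum_ne_top.2 fun i _ => ENNReal.mul_ne_top
      ENNReal.ofReal_ne_top (ENNReal.rpow_ne_top_of_nonneg hτ ENNReal.ofReal_ne_top)) ?_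
    simp
  · refine (ae_restrict_iff' measurableSet_Ioc).2 (Eventually.of_forall fun s hs => ?_)
    refine tendsto_finsetSum _ fun i _ => ENNReal.Tendsto.const_mul ?_ (Or.inr ENNReal.ofReal_ne_top)
    refine (ENNReal.continuous_rpow_const.tendsto _).comp ?_
    refine tendsto_lintegral_of_dominated_convergence (fun _ => ENNReal.ofReal (B ^ p))
      (fun m => ?_) (fun m => Eventually.of_forall fun ω => hbd _) (by simp) ?_
    · have h0 : 0 ≤ gridBelow (t / m) s := by
        rcases Nat.eq_zero_or_pos m with rfl | hm
        · simp [gridBelow]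
        · exact gridBelow_nonneg (by positivity) hs.1
      have := hgm i _ h0
      exact (((continuous_abs.measurable.comp this).min measurable_const).pow_const p).ennreal_ofReal
    · refine Eventually.of_forall fun ω => (ENNReal.continuous_ofReal.tendsto _).comp ?_
      have h1 := ((hg i ω).tendsto s hs.1).comp (tendsto_gridBelow ht s)
      exact ((h1.abs).min tendsto_const_nhds).rpow_const (Or.inr hp.le)

/-- After `leftLim_diag` the time parameter is frozen at s, and a left limit of one process is
bounded by its supremum up to s. -/
theorem leftLim_rpow_le_iSup (ε : ℝ) {M : ℝ → Torus N → ℝ} (hM : ∀ y, IsDriver fun s => M s y)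
    {F : TimeSpaceKernel N (n + 1)} (hF : Admissible F) {p : ℝ} {s : ℝ} (hs : 0 < s)
    (z : Torus N) : ‖Function.leftLim (diagIntegral ε M n F z) s‖ₑ ^ p
      ≤ ⨆ r ∈ Icc 0 s, ‖iteratedIntegral ε M n (freezeFirst F s z) r‖ₑ ^ p := by
  have hreg := pathwiseRegular ε hM n
  rw [hreg.leftLim_diag hF z hs]
  have h1 := (hreg.regulated _ (hF.freezeFirst hs.le z)).tendsto s hs
  have h2 : Tendsto (fun r => ‖iteratedIntegral ε M n (freezeFirst F s z) r‖ₑ ^ p) (𝓝[<] s)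
      (𝓝 (‖Function.leftLim (iteratedIntegral ε M n (freezeFirst F s z)) s‖ₑ ^ p)) :=
    (ENNReal.continuous_rpow_const.tendsto _).comp ((continuous_enorm.tendsto _).comp h1)
  refine le_of_tendsto h2 ?_
  filter_upwards [Ioo_mem_nhdsLT hs] with r hr
  exact le_iSup₂ (f := fun r (_ : r ∈ Icc 0 s) =>
    ‖iteratedIntegral ε M n (freezeFirst F s z) r‖ₑ ^ p) r ⟨hr.1.le, hr.2.le⟩

section Markov

variable {Ω : Type*} [mΩ : MeasurableSpace Ω] {P : Measure Ω}
  {S : Type*} [Fintype S] {A : (S → ℝ) →L[ℝ] (S → ℝ)} {ℱ : ℝ → MeasurableSpace Ω} {X : ℝ → Ω → S}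

theorem IsMarkovJump.measurable_cutDiag (hX : IsMarkovJump P A ℱ X) (f : Torus N → S → ℝ) (ε : ℝ)
    {F : TimeSpaceKernel N (n + 1)} (hF : Admissible F) (B : ℝ) {s : ℝ} (hs : 0 ≤ s) (y : Torus N) :
    Measurable[ℱ s] fun ω => cutDiag ε (dynkinFamily A f X ω) n F B s y := by
  have hd : ∀ z, Measurable[ℱ s] fun ω => |diagIntegral ε (dynkinFamily A f X ω) n F z s| :=
    fun z => continuous_abs.measurable.comp (hX.measurable_diagIntegral f ε hF z hs)
  have hset : MeasurableSet[ℱ s]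
      {ω | ∀ z, |diagIntegral ε (dynkinFamily A f X ω) n F z s| ≤ B} := by
    rw [ofPred_forall]
    exact MeasurableSet.iInter fun z => hd z measurableSet_Iic
  exact Measurable.ite hset (hX.measurable_diagIntegral f ε hF y hs) measurable_const

/-- The moment bound for the Riemann sums of a stochastic integral with bounded integrand. -/
theorem IsMarkovJump.exists_cut_moment_le [IsProbabilityMeasure P] (hX : IsMarkovJump P A ℱ X)
    {f : Torus N → S → ℝ} {ε : ℝ} {K : Torus N → ℝ} {a b : ℝ} (hJ : JumpBound A f ε K a b)
    (ha : 0 ≤ a) (hb : 0 ≤ b) {p : ℝ} (hp : 2 ≤ p) {F : TimeSpaceKernel N (n + 1)}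
    (hF : Admissible F) {t : ℝ} (ht : 0 < t) {B B' : ℝ} (hB : 0 ≤ B)
    (hB' : B' = ∑ z, ∑ y : Torus N, |ε ^ 2 * K (y - z)| * B) : ∃ R, 0 ≤ R ∧
    ∀ m : ℕ, 0 < m → t ≤ m →
    (∫⁻ ω, ENNReal.ofReal ((partialSups (fun k => |discreteIntegral ε (dynkinFamily A f X ω) (t / m)
      (fun k => cutDiag ε (dynkinFamily A f X ω) n F B (k * (t / m))) k|) m) ^ p) ∂P) ^ (2 / p)
    ≤ ENNReal.ofReal (3 * bdgConst p + 1) * ((∫⁻ s in Ioc 0 t, ∑ z, ENNReal.ofReal (a * b ^ 2) *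
        (∫⁻ ω, ENNReal.ofReal ((min |diagIntegral ε (dynkinFamily A f X ω) n (convHead ε K F) z
          (gridBelow (t / m) s)| B') ^ p) ∂P) ^ (2 / p))
      + ENNReal.ofReal (b ^ 2) * diagMoment P ε p (dynkinFamily A f X) n (convHead ε K F) t
      + ENNReal.ofReal (R * (m * (t / m) ^ 2) + (R * (m * (t / m) ^ 2)) ^ (2 / p))) := by
  have hp0 : 0 < p := by linarith
  have hτ : 0 ≤ 2 / p := by positivity
  set M := dynkinFamily A f X with hM
  set F' := convHead ε K F with hF'
  have hF'a : Admissible F' := hF.convHead ε K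
  have hMd := fun ω => hX.isDriver f ω
  have hC0 : 0 ≤ 3 * bdgConst p + 1 := by have := bdgConst_nonneg p; linarith
  set J : Ω → ℝ≥0∞ := fun ω =>
    ⨆ q : ℚ, ⨆ z, ‖diagIntegral ε (M ω) n F' z (max 0 (min (q : ℝ) 1) * t)‖ₑ ^ p with hJdef
  have hJm : Measurable J := by
    refine Measurable.iSup fun q => Measurable.iSup fun z => ?_
    have h0 : 0 ≤ max 0 (min (q : ℝ) 1) * t := mul_nonneg (le_max_left _ _) ht.le
    have := (hX.measurable_diagIntegral f ε hF'a z h0).mono (hX.le _) le_rfl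
    exact this.enorm.pow_const p
  have hB'0 : 0 ≤ B' := by
    rw [hB']
    exact Finset.sum_nonneg fun z _ => Finset.sum_nonneg fun y _ => by positivity
  -- The maximal jump `J` may be infinite or fail to be integrable. Capping it at B'^p costs
  -- nothing, since B' bounds the convolved truncated integrands anyway.
  set D : Ω → ℝ := fun ω => (min (J ω) (ENNReal.ofReal (B' ^ p))).toReal ^ (1 / p) with hD
  have hDn : ∀ ω, 0 ≤ D ω := fun ω => Real.rpow_nonneg ENNReal.toReal_nonneg _
  have hDp : ∀ ω, D ω ^ p = (min (J ω) (ENNReal.ofReal (B' ^ p))).toReal := fun ω => by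
    simp only [hD]
    rw [← Real.rpow_mul ENNReal.toReal_nonneg, one_div, inv_mul_cancel₀ hp0.ne', Real.rpow_one]
  have hDm : Measurable D := ((hJm.min measurable_const).ennreal_toReal).pow_const _
  have hDb : ∀ ω, D ω ∈ Icc 0 B' := fun ω => by
    refine ⟨hDn ω, (Real.rpow_le_rpow_iff (hDn ω) hB'0 hp0).1 ?_⟩
    rw [hDp]
    exact ENNReal.toReal_le_of_le_ofReal (Real.rpow_nonneg hB'0 _) (min_le_right _ _)
  obtain ⟨R, hR0, hR⟩ := hX.exists_discreteIntegral_le hJ ha hb hp B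
  refine ⟨R, hR0, fun m hm htm => ?_⟩
  have hm' : (0 : ℝ) < m := by exact_mod_cast hm
  have hh0 : 0 < t / m := by positivity
  have hh : t / m ∈ Icc (0 : ℝ) 1 := ⟨hh0.le, (div_le_one hm').2 htm⟩
  set c : ℕ → Torus N → Ω → ℝ := fun k y ω => cutDiag ε (M ω) n F B (k * (t / m)) y with hc
  have hkt : ∀ k : ℕ, 0 ≤ (k : ℝ) * (t / m) := fun k => by positivity
  have hcm : ∀ (k : ℕ) y, Measurable[ℱ (k * (t / m))] (c k y) := fun k y =>
    hX.measurable_cutDiag f ε hF B (hkt k) y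
  have hcm' : ∀ (k : ℕ) y, Measurable (c k y) := fun k y => (hcm k y).mono (hX.le _) le_rfl
  have hcB : ∀ (k : ℕ) y ω, |c k y ω| ≤ B := fun k y ω => abs_cutDiag_le ε (M ω) F hB _ _
  have hconv : ∀ (k : ℕ) ω z, |conv ε K (fun y => c k y ω) z|
      ≤ min |diagIntegral ε (M ω) n F' z (k * (t / m))| B' := fun k ω z =>
    le_min (abs_conv_cutDiag_le ε K (hMd ω) hF B (hkt k) z)
      (hB' ▸ abs_conv_le ε K (fun y => hcB k y ω) z)
  have hcD : ∀ k < m, ∀ ω z, |conv ε K (fun y => c k y ω) z| ≤ D ω := by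
    intro k hk ω z
    refine (Real.rpow_le_rpow_iff (abs_nonneg _) (hDn ω) hp0).1 ?_
    rw [hDp]
    refine (ENNReal.ofReal_le_iff_le_toReal (ne_top_of_le_ne_top ENNReal.ofReal_ne_top
      (min_le_right _ _))).1 (le_min ?_ ?_)
    · rw [ofReal_abs_rpow hp0.le]
      have hkm : (k : ℝ) ≤ m := by exact_mod_cast hk.le
      -- Grid points are the rational proportions k/m of t, so the supremum over rationals sees them
      -- all.
      have e : max 0 (min (((k : ℚ) / m : ℚ) : ℝ) 1) * t = k * (t / m) := by
        push_cast
        rw [min_eq_left ((div_le_one hm').2 hkm), max_eq_right (by positivity)]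
        ring
      have h1 : ‖diagIntegral ε (M ω) n F' z (k * (t / m))‖ₑ ^ p ≤ J ω := by
        rw [← e]
        exact (le_iSup (fun z => ‖diagIntegral ε (M ω) n F' z
          (max 0 (min (((k : ℚ) / m : ℚ) : ℝ) 1) * t)‖ₑ ^ p) z).trans
          (le_iSup (fun q : ℚ => ⨆ z, ‖diagIntegral ε (M ω) n F' z
            (max 0 (min (q : ℝ) 1) * t)‖ₑ ^ p) _)
      refine le_trans (ENNReal.rpow_le_rpow ?_ hp0.le) h1
      rw [Real.enorm_eq_ofReal_abs, Real.enorm_eq_ofReal_abs]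
      exact ENNReal.ofReal_le_ofReal ((hconv k ω z).trans (min_le_left _ _))
    · exact ENNReal.ofReal_le_ofReal (Real.rpow_le_rpow (abs_nonneg _)
        ((hconv k ω z).trans (min_le_right _ _)) hp0.le)
  obtain ⟨hint₀, hmain⟩ := hR m (t / m) hh c hcm hcB D hDm ⟨_, hDb⟩ hcD
  have hint : Integrable (fun ω => (partialSups (fun k => |discreteIntegral ε (M ω) (t / m)
      (fun k y => c k y ω) k|) m) ^ p) P := hint₀
  have hx0 : ∀ ω, 0 ≤ (partialSups (fun k => |discreteIntegral ε (M ω) (t / m)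
      (fun k y => c k y ω) k|) m) ^ p := fun ω =>
    Real.rpow_nonneg ((abs_nonneg _).trans (le_partialSups_of_le (fun k => |discreteIntegral ε (M ω)
      (t / m) (fun k y => c k y ω) k|) (Nat.zero_le m))) _
  have hlhs : (∫⁻ ω, ENNReal.ofReal ((partialSups (fun k => |discreteIntegral ε (M ω) (t / m)
      (fun k y => c k y ω) k|) m) ^ p) ∂P) ^ (2 / p)
      = ENNReal.ofReal ((∫ ω, (partialSups (fun k => |discreteIntegral ε (M ω) (t / m)
        (fun k y => c k y ω) k|) m) ^ p ∂P) ^ (2 / p)) := by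
    rw [← ofReal_integral_eq_lintegral_ofReal hint (Eventually.of_forall hx0),
      ENNReal.ofReal_rpow_of_nonneg (integral_nonneg hx0) hτ]
  -- the bracket
  have hφ : ∀ (k : ℕ) z, ENNReal.ofReal ((∫ ω, |conv ε K (fun y => c k y ω) z| ^ p ∂P) ^ (2 / p))
      ≤ (∫⁻ ω, ENNReal.ofReal ((min |diagIntegral ε (M ω) n F' z (k * (t / m))| B') ^ p) ∂P)
        ^ (2 / p) := fun k z => by
    have hn : ∀ ω, 0 ≤ |conv ε K (fun y => c k y ω) z| ^ p := fun ω => Real.rpow_nonneg (abs_nonneg _) _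
    have hi : Integrable (fun ω => |conv ε K (fun y => c k y ω) z| ^ p) P := by
      refine integrable_of_abs_le ((continuous_abs.measurable.comp
        (Finset.measurable_fun_sum _ fun y _ => (hcm' k y).const_mul _)).pow_const p) (B := B' ^ p)
        fun ω => mem_Icc_rpow hp0.le ⟨abs_nonneg _, (hconv k ω z).trans (min_le_right _ _)⟩
    rw [← ENNReal.ofReal_rpow_of_nonneg (integral_nonneg hn) hτ,
      ofReal_integral_eq_lintegral_ofReal hi (Eventually.of_forall hn)]
    refine ENNReal.rpow_le_rpow (lintegral_mono fun ω => ENNReal.ofReal_le_ofReal ?_) hτ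
    exact Real.rpow_le_rpow (abs_nonneg _) (hconv k ω z) hp0.le
  have hφ0 : ∀ (k : ℕ) z, 0 ≤ (∫ ω, |conv ε K (fun y => c k y ω) z| ^ p ∂P) ^ (2 / p) := fun k z =>
    Real.rpow_nonneg (integral_nonneg fun ω => Real.rpow_nonneg (abs_nonneg _) _) _
  have hbr : ENNReal.ofReal (∑ k ∈ Finset.range m, t / m * ∑ z, a * b ^ 2 *
        (∫ ω, |conv ε K (fun y => c k y ω) z| ^ p ∂P) ^ (2 / p))
      ≤ ∫⁻ s in Ioc 0 t, ∑ z, ENNReal.ofReal (a * b ^ 2) *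
        (∫⁻ ω, ENNReal.ofReal ((min |diagIntegral ε (M ω) n F' z
          (gridBelow (t / m) s)| B') ^ p) ∂P) ^ (2 / p) := by
    have hT : (m : ℝ) * (t / m) = t := mul_div_cancel₀ _ hm'.ne'
    have hg := lintegral_comp_gridBelow (fun s => ∑ z, ENNReal.ofReal (a * b ^ 2) *
        (∫⁻ ω, ENNReal.ofReal ((min |diagIntegral ε (M ω) n F' z s| B') ^ p) ∂P) ^ (2 / p)) hh0 m
    rw [hT] at hg
    have hab : 0 ≤ a * b ^ 2 := by positivity
    rw [hg, ENNReal.ofReal_sum_of_nonneg fun k _ => mul_nonneg hh0.le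
      (Finset.sum_nonneg fun z _ => mul_nonneg hab (hφ0 k z))]
    refine Finset.sum_le_sum fun k _ => ?_
    rw [ENNReal.ofReal_mul hh0.le, ENNReal.ofReal_sum_of_nonneg fun z _ => mul_nonneg hab (hφ0 k z)]
    refine mul_le_mul_right (Finset.sum_le_sum fun z _ => ?_) _
    rw [ENNReal.ofReal_mul hab]
    exact mul_le_mul_right (hφ k z) _
  -- the jumps
  have hjump : ENNReal.ofReal ((b ^ p * ∫ ω, D ω ^ p ∂P) ^ (2 / p))
      ≤ ENNReal.ofReal (b ^ 2) * diagMoment P ε p M n F' t := by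
    have hDi : 0 ≤ ∫ ω, D ω ^ p ∂P := integral_nonneg fun ω => Real.rpow_nonneg (hDn ω) _
    rw [Real.mul_rpow (Real.rpow_nonneg hb _) hDi, ← Real.rpow_mul hb, mul_div_cancel₀ _ hp0.ne',
      Real.rpow_two, ENNReal.ofReal_mul (sq_nonneg b), ← ENNReal.ofReal_rpow_of_nonneg hDi hτ]
    refine mul_le_mul_right (ENNReal.rpow_le_rpow ?_ hτ) _
    simp_rw [hDp]
    rw [integral_toReal (hJm.min measurable_const).aemeasurable (Eventually.of_forall fun ω =>
      (min_le_right _ _).trans_lt ENNReal.ofReal_lt_top)]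
    exact ENNReal.ofReal_toReal_le.trans (lintegral_mono fun ω => min_le_left _ _)
  calc _ = _ := hlhs
    _ ≤ ENNReal.ofReal _ := ENNReal.ofReal_le_ofReal hmain
    _ ≤ _ := by
      rw [ENNReal.ofReal_mul hC0, add_assoc]
      refine mul_le_mul_right (ENNReal.ofReal_add_le.trans (add_le_add ?_ le_rfl)) _
      exact ENNReal.ofReal_add_le.trans (add_le_add hbr hjump)

/-- The moment bound for one stochastic integral. -/
theorem IsMarkovJump.supMoment_succ_le [IsProbabilityMeasure P] (hX : IsMarkovJump P A ℱ X)
    {f : Torus N → S → ℝ} {ε : ℝ} {K : Torus N → ℝ} {a b : ℝ} (hJ : JumpBound A f ε K a b)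
    (ha : 0 ≤ a) (hb : 0 ≤ b) {p : ℝ} (hp : 2 ≤ p) {F : TimeSpaceKernel N (n + 1)}
    (hF : Admissible F) {t : ℝ} (ht : 0 ≤ t) :
    supMoment P ε p (dynkinFamily A f X) (n + 1) F t
      ≤ ENNReal.ofReal (3 * bdgConst p + 1) *
        ((∫⁻ s in Ioc 0 t, ∑ z, ENNReal.ofReal (a * b ^ 2) *
          supMoment P ε p (dynkinFamily A f X) n (freezeFirst (convHead ε K F) s z) s)
        + ENNReal.ofReal (b ^ 2) * diagMoment P ε p (dynkinFamily A f X) n (convHead ε K F) t) := by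
  have hp0 : 0 < p := by linarith
  have hτ : 0 < 2 / p := by positivity
  rcases ht.eq_or_lt with rfl | ht0
  -- Time zero is separate, as the mesh t/m must be positive.
  · have e : ∀ ω, ⨆ r ∈ Icc (0 : ℝ) 0,
        ‖iteratedIntegral ε (dynkinFamily A f X ω) (n + 1) F r‖ₑ ^ p = 0 := fun ω => by
      simp [iteratedIntegral_succ, stieltjesIntegral_zero_time, hp0]
    rw [supMoment, lintegral_congr e, lintegral_zero, ENNReal.zero_rpow_of_pos hτ]
    exact zero_le
  set M := dynkinFamily A f X with hM
  set F' := convHead ε K F with hF'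
  have hF'a : Admissible F' := hF.convHead ε K
  have hMd := fun ω => hX.isDriver f ω
  choose R hR0 hR using fun B : ℕ =>
    hX.exists_cut_moment_le hJ ha hb hp hF ht0 (Nat.cast_nonneg (α := ℝ) B) rfl
  set B' : ℕ → ℝ := fun B => ∑ z, ∑ y : Torus N, |ε ^ 2 * K (y - z)| * B with hB'
  have hB'0 : ∀ B, 0 ≤ B' B := fun B => Finset.sum_nonneg fun z _ => Finset.sum_nonneg fun y _ => by
    positivity
  set W : ℝ≥0∞ := ENNReal.ofReal (3 * bdgConst p + 1) *
        ((∫⁻ s in Ioc 0 t, ∑ z, ENNReal.ofReal (a * b ^ 2) *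
          supMoment P ε p M n (freezeFirst F' s z) s)
        + ENNReal.ofReal (b ^ 2) * diagMoment P ε p M n F' t) with hW
  have inv : ∀ x : ℝ≥0∞, (x ^ (p / 2)) ^ (2 / p) = x := fun x => by
    rw [← ENNReal.rpow_mul, show p / 2 * (2 / p) = 1 by field_simp, ENNReal.rpow_one]
  have inv' : ∀ x : ℝ≥0∞, (x ^ (2 / p)) ^ (p / 2) = x := fun x => by
    rw [← ENNReal.rpow_mul, show 2 / p * (p / 2) = 1 by field_simp, ENNReal.rpow_one]
  -- The outer power 2/p is undone first, because Fatou's lemma concerns the p-th moment itself.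
  suffices h : ∫⁻ ω, ⨆ r ∈ Icc 0 t, ‖iteratedIntegral ε (M ω) (n + 1) F r‖ₑ ^ p ∂P ≤ W ^ (p / 2) by
    rw [← inv W]
    exact ENNReal.rpow_le_rpow h hτ.le
  refine lintegral_le_of_le_liminf_liminf (Y := fun B m ω => ENNReal.ofReal ((partialSups (fun k =>
      |discreteIntegral ε (M ω) (t / m) (fun k => cutDiag ε (M ω) n F B (k * (t / m))) k|) m) ^ p))
    (fun B m => ?_) (fun ω => iSup₂_le fun r hr =>
      enorm_iteratedIntegral_rpow_le_liminf ε (hMd ω) hF hp0 ht0 hr)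
    (fun B => ?_) (fun B => ?_)
    (V := fun B m => (ENNReal.ofReal (3 * bdgConst p + 1) *
      ((∫⁻ s in Ioc 0 t, ∑ z, ENNReal.ofReal (a * b ^ 2) *
        (∫⁻ ω, ENNReal.ofReal ((min |diagIntegral ε (M ω) n F' z
          (gridBelow (t / m) s)| (B' B)) ^ p) ∂P) ^ (2 / p))
      + ENNReal.ofReal (b ^ 2) * diagMoment P ε p M n F' t
      + ENNReal.ofReal (R B * (m * (t / m) ^ 2) + (R B * (m * (t / m) ^ 2)) ^ (2 / p)))) ^ (p / 2))
  · refine ((measurable_partialSups (fun k => continuous_abs.measurable.comp ?_) m).pow_const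
      p).ennreal_ofReal
    refine Finset.measurable_fun_sum _ fun i _ => Finset.measurable_fun_sum _ fun y _ => ?_
    have hi : (0 : ℝ) ≤ i * (t / m) := by positivity
    refine Measurable.mul (((hX.measurable_cutDiag f ε hF B hi y).mono (hX.le _) le_rfl).const_mul _)
      (.sub ?_ ?_)
    · exact (hX.measurable_dynkin_of_le (by positivity) le_rfl _).mono (hX.le _) le_rfl
    · exact (hX.measurable_dynkin_of_le hi le_rfl _).mono (hX.le _) le_rfl
  · filter_upwards [eventually_ge_atTop ⌈t⌉₊, eventually_gt_atTop 0] with m hmt hm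
    rw [← inv' (∫⁻ ω, _ ∂P)]
    exact ENNReal.rpow_le_rpow (hR B m hm (Nat.ceil_le.1 hmt)) (by positivity)
  -- The short-time errors sum to R t²/m, which vanishes at fixed truncation level.
  · have hρ : Tendsto (fun m : ℕ => R B * (m * (t / m) ^ 2)) atTop (𝓝 0) := by
      have h1 : Tendsto (fun m : ℕ => R B * t ^ 2 / m) atTop (𝓝 0) :=
        tendsto_const_div_atTop_nhds_zero_nat _
      refine h1.congr' ?_
      filter_upwards [eventually_gt_atTop 0] with m hm
      have hm' : (m : ℝ) ≠ 0 := by exact_mod_cast hm.ne'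
      field_simp
    have hρ' : Tendsto (fun m : ℕ => ENNReal.ofReal (R B * (m * (t / m) ^ 2)
        + (R B * (m * (t / m) ^ 2)) ^ (2 / p))) atTop (𝓝 0) := by
      have h2 := hρ.add (hρ.rpow_const (p := 2 / p) (Or.inr hτ.le))
      rw [Real.zero_rpow hτ.ne', add_zero] at h2
      simpa [Function.comp_def] using (ENNReal.continuous_ofReal.tendsto _).comp h2
    have hmain := tendsto_lintegral_gridBelow (P := P)
      (g := fun z s ω => diagIntegral ε (M ω) n F' z s)
      (fun z s hs => (hX.measurable_diagIntegral f ε hF'a z hs).mono (hX.le _) le_rfl)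
      (fun z ω => (pathwiseRegular ε (hMd ω) n).regulated_diag hF'a z) hp0 (hB'0 B) (a * b ^ 2) ht0
    have hlim := (ENNReal.continuous_rpow_const (y := p / 2)).tendsto _ |>.comp
      (ENNReal.Tendsto.const_mul (a := ENNReal.ofReal (3 * bdgConst p + 1))
        ((hmain.add (tendsto_const_nhds
          (x := ENNReal.ofReal (b ^ 2) * diagMoment P ε p M n F' t))).add hρ')
        (Or.inr ENNReal.ofReal_ne_top))
    refine ⟨_, ?_, hlim⟩
    refine ENNReal.rpow_le_rpow ?_ (by positivity)
    -- The limit still carries left limits capped at B'; dropping the cap and passing to suprema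
    -- bounds it uniformly in B.
    rw [add_zero, hW]
    refine mul_le_mul_right (add_le_add (setLIntegral_mono' measurableSet_Ioc fun s hs =>
      Finset.sum_le_sum fun z _ => mul_le_mul_right (ENNReal.rpow_le_rpow
        (lintegral_mono fun ω => ?_) hτ.le) _) le_rfl) _
    refine le_trans ?_ (leftLim_rpow_le_iSup ε (hMd ω) hF'a hs.1 z)
    rw [← ofReal_abs_rpow hp0.le]
    exact ENNReal.ofReal_le_ofReal (Real.rpow_le_rpow (le_min (abs_nonneg _) (hB'0 B))
      (min_le_left _ _) hp0.le)

end Markov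

end

section

/-! ### Moments of iterated integrals -/

variable {N : ℕ} {Ω : Type*} [mΩ : MeasurableSpace Ω]

/-- The iterated integral over the simplex of the square of the kernel, with one variable convolved
and integrated at a time. -/
noncomputable def mainRec (ε : ℝ) (K : Torus N → ℝ) : (n : ℕ) → TimeSpaceKernel N n → ℝ → ℝ≥0∞
  | 0, F, _ => ENNReal.ofReal (F Fin.elim0 Fin.elim0 ^ 2)
  | n + 1, F, t => ∫⁻ s in Ioc 0 t, ∑ z, ENNReal.ofReal (ε ^ 2) *
      mainRec ε K n (freezeFirst (convHead ε K F) s z) s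

/-- The contribution of the jumps of the `(k + 1)`-st integral from the outside, with one variable
convolved and integrated at a time. -/
noncomputable def errRec (P : Measure Ω) (ε p : ℝ) (M : Ω → ℝ → Torus N → ℝ) (K : Torus N → ℝ) :
    (n k : ℕ) → TimeSpaceKernel N n → ℝ → ℝ≥0∞
  | 0, _, _, _ => 0
  | n + 1, 0, F, t => diagMoment P ε p M n (convHead ε K F) t
  | n + 1, k + 1, F, t => ∫⁻ s in Ioc 0 t, ∑ z, ENNReal.ofReal (ε ^ 2) *
      errRec P ε p M K n k (freezeFirst (convHead ε K F) s z) s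

variable {P : Measure Ω} {S : Type*} [Fintype S] {A : (S → ℝ) →L[ℝ] (S → ℝ)}
  {ℱ : ℝ → MeasurableSpace Ω} {X : ℝ → Ω → S} {n : ℕ}

theorem IsMarkovJump.measurable_iteratedIntegral_prod (hX : IsMarkovJump P A ℱ X)
    (f : Torus N → S → ℝ) (ε : ℝ) {α : Type*} [MeasurableSpace α] {F : α → TimeSpaceKernel N n}
    (hF : MeasurableFamily F) : Measurable fun q : α × ℝ × Ω =>
      iteratedIntegral ε (dynkinFamily A f X q.2.2) n (F q.1) (max 0 q.2.1) := by
  refine measurable_of_tendsto_metrizable (f := fun (j : ℕ) (q : α × ℝ × Ω) =>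
    iteratedIntegral ε (dynkinFamily A f X q.2.2) n (F q.1) (max 0 (min q.2.1 j))) (fun j => ?_) ?_
  · exact MeasurableFamily.measurable_iteratedIntegral ε (M := fun s ω y => dynkinFamily A f X ω s y)
      (fun ω y => hX.isDriver f ω y) j.cast_nonneg
      (fun y => measurable_dynkin hX.path j.cast_nonneg (fun t ht => hX.measurable ht.1) A (f y)) hF
  · refine tendsto_pi_nhds.2 fun q => tendsto_const_nhds.congr' ?_
    filter_upwards [eventually_ge_atTop ⌈q.2.1⌉₊] with j hj
    rw [min_eq_left (Nat.ceil_le.1 hj)]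

/-- This measurability is what allows integrals of sums of error terms to be split. The supremum
over countably many rational proportions in `diagMoment` makes the case k = 0 possible. -/
theorem IsMarkovJump.measurable_errRec [IsProbabilityMeasure P] (hX : IsMarkovJump P A ℱ X)
    (f : Torus N → S → ℝ) (ε p : ℝ) (K : Torus N → ℝ) (n k : ℕ) {α : Type*} [MeasurableSpace α]
    {F : α → TimeSpaceKernel N n} (hF : MeasurableFamily F) : Measurable fun q : α × ℝ =>
      errRec P ε p (dynkinFamily A f X) K n k (F q.1) (max 0 q.2) := by
  induction n generalizing k α with
  | zero => exact measurable_const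
  | succ n ih =>
    cases k with
    | zero =>
      refine Measurable.pow_const ?_ _
      refine Measurable.lintegral_prod_right' (f := fun q : (α × ℝ) × Ω => ⨆ r : ℚ, ⨆ z,
        ‖diagIntegral ε (dynkinFamily A f X q.2) n (convHead ε K (F q.1.1)) z
          (max 0 (min (r : ℝ) 1) * max 0 q.1.2)‖ₑ ^ p) ?_
      refine Measurable.iSup fun r => Measurable.iSup fun z => Measurable.pow_const (.enorm ?_) _
      have ht : Measurable fun q : (α × ℝ) × Ω => max 0 (min (r : ℝ) 1) * max 0 q.1.2 := by
        fun_prop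
      have h := (hX.measurable_iteratedIntegral_prod f ε ((hF.convHead ε K).freezeFirst z)).comp
        (((measurable_fst.fst.prodMk ht).prodMk (ht.prodMk measurable_snd)) :
          Measurable fun q : (α × ℝ) × Ω => (((q.1.1, max 0 (min (r : ℝ) 1) * max 0 q.1.2) : α × ℝ),
            max 0 (min (r : ℝ) 1) * max 0 q.1.2, q.2))
      convert h using 1
      funext q
      have h0 : 0 ≤ max 0 (min (r : ℝ) 1) * max 0 q.1.2 :=
        mul_nonneg (le_max_left _ _) (le_max_left _ _)
      simp only [diagIntegral, Function.comp_apply, max_eq_right h0]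
    | succ k =>
      have h1 : Measurable fun q : (α × ℝ) × ℝ => {q : (α × ℝ) × ℝ | 0 < q.2 ∧ q.2 ≤ max 0 q.1.2}.indicator
          (fun q => ∑ z, ENNReal.ofReal (ε ^ 2) * errRec P ε p (dynkinFamily A f X) K n k
            (freezeFirst (convHead ε K (F q.1.1)) (max 0 q.2) z) (max 0 q.2)) q := by
        refine Measurable.indicator (Finset.measurable_fun_sum _ fun z _ => Measurable.const_mul ?_ _) ?_
        · exact (ih k ((hF.convHead ε K).freezeFirst z)).comp
            (((measurable_fst.fst.prodMk measurable_snd).prodMk measurable_snd) :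
              Measurable fun q : (α × ℝ) × ℝ => (((q.1.1, q.2) : α × ℝ), q.2))
        · exact (measurableSet_lt measurable_const measurable_snd).inter
            (measurableSet_le measurable_snd (by fun_prop))
      convert Measurable.lintegral_prod_right' (ν := volume) h1 using 1
      funext q
      rw [errRec, ← lintegral_indicator measurableSet_Ioc]
      refine lintegral_congr fun s => ?_
      by_cases hs : 0 < s ∧ s ≤ max 0 q.2
      · rw [indicator_of_mem (mem_Ioc.2 hs), indicator_of_mem (by exact hs)]
        simp only [max_eq_right hs.1.le]
      · rw [indicator_of_notMem (fun h => hs (mem_Ioc.1 h)), indicator_of_notMem (by exact hs)]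

/-- Additivity of the lower integral requires measurability of one summand only. The error part
provides it, so none is needed for `mainRec`. -/
theorem IsMarkovJump.lintegral_mainRec_add_errRec [IsProbabilityMeasure P] (hX : IsMarkovJump P A ℱ X)
    (f : Torus N → S → ℝ) (ε p : ℝ) (K : Torus N → ℝ) {F : TimeSpaceKernel N (n + 1)}
    (hF : Admissible F) (t : ℝ) (e : ℝ≥0∞) :
    ∫⁻ s in Ioc 0 t, ∑ z, ENNReal.ofReal (ε ^ 2) *
        (mainRec ε K n (freezeFirst (convHead ε K F) s z) s + e * ∑ k ∈ Finset.range n,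
          errRec P ε p (dynkinFamily A f X) K n k (freezeFirst (convHead ε K F) s z) s)
      = mainRec ε K (n + 1) F t + e * ∑ k ∈ Finset.range n,
        errRec P ε p (dynkinFamily A f X) K (n + 1) (k + 1) F t := by
  have hm : ∀ k, AEMeasurable (fun s => ∑ z, ENNReal.ofReal (ε ^ 2) *
      errRec P ε p (dynkinFamily A f X) K n k (freezeFirst (convHead ε K F) s z) s)
      (volume.restrict (Ioc 0 t)) := by
    intro k
    have h1 : Measurable fun s : ℝ => ∑ z, ENNReal.ofReal (ε ^ 2) *
        errRec P ε p (dynkinFamily A f X) K n k (freezeFirst (convHead ε K F) (max 0 s) z) (max 0 s) := by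
      refine Finset.measurable_fun_sum _ fun z _ => Measurable.const_mul ?_ _
      exact (hX.measurable_errRec f ε p K n k
        (((hF.convHead ε K).measurableFamily (α := Unit)).freezeFirst z)).comp
        (((measurable_const (a := ())).prodMk measurable_id).prodMk measurable_id :
          Measurable fun s : ℝ => (((), s), s))
    refine h1.aemeasurable.congr ((ae_restrict_iff' measurableSet_Ioc).2
      (Eventually.of_forall fun s hs => ?_))
    simp only [max_eq_right hs.1.le]
  have e1 : ∀ s, ∑ z, ENNReal.ofReal (ε ^ 2) *
        (mainRec ε K n (freezeFirst (convHead ε K F) s z) s + e * ∑ k ∈ Finset.range n,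
          errRec P ε p (dynkinFamily A f X) K n k (freezeFirst (convHead ε K F) s z) s)
      = ∑ z, ENNReal.ofReal (ε ^ 2) * mainRec ε K n (freezeFirst (convHead ε K F) s z) s
        + e * ∑ k ∈ Finset.range n, ∑ z, ENNReal.ofReal (ε ^ 2) *
          errRec P ε p (dynkinFamily A f X) K n k (freezeFirst (convHead ε K F) s z) s := fun s => by
    rw [Finset.sum_comm, Finset.mul_sum, ← Finset.sum_add_distrib]
    refine Finset.sum_congr rfl fun z _ => ?_
    rw [mul_add, ← Finset.mul_sum, mul_left_comm]
  have hs : AEMeasurable (fun s => ∑ k ∈ Finset.range n, ∑ z, ENNReal.ofReal (ε ^ 2) *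
      errRec P ε p (dynkinFamily A f X) K n k (freezeFirst (convHead ε K F) s z) s)
      (volume.restrict (Ioc 0 t)) := Finset.aemeasurable_fun_sum _ fun k _ => hm k
  simp_rw [e1]
  rw [lintegral_add_right' _ (hs.const_mul e), lintegral_const_mul'' _ hs,
    lintegral_finsetSum' _ fun k _ => hm k]
  rfl

theorem supMoment_zero [IsProbabilityMeasure P] (ε : ℝ) {p : ℝ} (hp : 0 < p)
    (M : Ω → ℝ → Torus N → ℝ) (K : Torus N → ℝ) (F : TimeSpaceKernel N 0) {t : ℝ} (ht : 0 ≤ t) :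
    supMoment P ε p M 0 F t = mainRec ε K 0 F t := by
  have e : ∀ ω, ⨆ r ∈ Icc 0 t, ‖iteratedIntegral ε (M ω) 0 F r‖ₑ ^ p
      = ‖F Fin.elim0 Fin.elim0‖ₑ ^ p := fun ω =>
    biSup_const (a := ‖F Fin.elim0 Fin.elim0‖ₑ ^ p) (nonempty_Icc.2 ht)
  rw [supMoment, lintegral_congr e, lintegral_const, measure_univ, mul_one, ← ENNReal.rpow_mul,
    mul_div_cancel₀ _ hp.ne', mainRec, ENNReal.rpow_two, Real.enorm_eq_ofReal_abs,
    ← ENNReal.ofReal_pow (abs_nonneg _), sq_abs]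

/-- The constant in the moment bound for `n`-fold integrals. -/
noncomputable def momentConst (p : ℝ) : ℕ → ℝ≥0
  | 0 => 1
  | n + 1 => (3 * bdgConst p + 1).toNNReal * (8 * momentConst p n + 4)

/-- The induction hypothesis is applied, for each s and z, to the convolved kernel frozen at (s,z).
Integration shifts its error terms from k to k + 1, and the new maximal-jump term takes the place k
= 0. The constants 8 and 4 in `momentConst` come from the two bounds on a and b. -/
theorem IsMarkovJump.supMoment_le [IsProbabilityMeasure P] (hX : IsMarkovJump P A ℱ X)
    {f : Torus N → S → ℝ} {ε : ℝ} {K : Torus N → ℝ} {a b e : ℝ} (hJ : JumpBound A f ε K a b)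
    (ha : 0 ≤ a) (hb : 0 ≤ b) (hab : a * b ^ 2 ≤ 8 * ε ^ 2) (hbe : b ^ 2 ≤ 4 * e) {p : ℝ} (hp : 2 ≤ p)
    {F : TimeSpaceKernel N n} (hF : Admissible F) {t : ℝ} (ht : 0 ≤ t) :
    supMoment P ε p (dynkinFamily A f X) n F t ≤ momentConst p n * (mainRec ε K n F t
      + ENNReal.ofReal e * ∑ k ∈ Finset.range n, errRec P ε p (dynkinFamily A f X) K n k F t) := by
  induction n generalizing t with
  | zero => simp [supMoment_zero ε (by linarith : 0 < p) _ K F ht, momentConst]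
  | succ n ih =>
    refine (hX.supMoment_succ_le hJ ha hb hp hF ht).trans ?_
    rw [momentConst, ENNReal.coe_mul, mul_assoc]
    refine mul_le_mul_right ?_ _
    have h1 : ENNReal.ofReal (a * b ^ 2) ≤ 8 * ENNReal.ofReal (ε ^ 2) := by
      refine (ENNReal.ofReal_le_ofReal hab).trans (le_of_eq ?_)
      rw [ENNReal.ofReal_mul (by norm_num)]
      norm_num
    have h2 : ENNReal.ofReal (b ^ 2) ≤ 4 * ENNReal.ofReal e := by
      refine (ENNReal.ofReal_le_ofReal hbe).trans (le_of_eq ?_)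
      rw [ENNReal.ofReal_mul (by norm_num)]
      norm_num
    have h3 : ∫⁻ s in Ioc 0 t, ∑ z, ENNReal.ofReal (a * b ^ 2) *
          supMoment P ε p (dynkinFamily A f X) n (freezeFirst (convHead ε K F) s z) s
        ≤ ∫⁻ s in Ioc 0 t, (8 * momentConst p n : ℝ≥0) * ∑ z, ENNReal.ofReal (ε ^ 2) *
        (mainRec ε K n (freezeFirst (convHead ε K F) s z) s + ENNReal.ofReal e * ∑ k ∈ Finset.range n,
          errRec P ε p (dynkinFamily A f X) K n k (freezeFirst (convHead ε K F) s z) s) := by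
      refine setLIntegral_mono' measurableSet_Ioc fun s hs => ?_
      rw [Finset.mul_sum]
      refine Finset.sum_le_sum fun z _ => ?_
      refine (mul_le_mul' h1 (ih ((hF.convHead ε K).freezeFirst hs.1.le z) hs.1.le)).trans
        (le_of_eq ?_)
      push_cast
      ring
    rw [lintegral_const_mul' _ _ ENNReal.coe_ne_top, hX.lintegral_mainRec_add_errRec f ε p K hF] at h3
    rw [Finset.sum_range_succ']
    refine (add_le_add h3 (mul_le_mul_left h2 _)).trans ?_
    have e2 : errRec P ε p (dynkinFamily A f X) K (n + 1) 0 F t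
      = diagMoment P ε p (dynkinFamily A f X) n (convHead ε K F) t := rfl
    rw [e2]
    push_cast
    set c : ℝ≥0∞ := 8 * (momentConst p n : ℝ≥0∞)
    set m := mainRec ε K (n + 1) F t
    set r := ENNReal.ofReal e * ∑ k ∈ Finset.range n,
      errRec P ε p (dynkinFamily A f X) K (n + 1) (k + 1) F t with hr
    set d := diagMoment P ε p (dynkinFamily A f X) n (convHead ε K F) t
    calc c * (m + r) + 4 * ENNReal.ofReal e * d
        = c * (m + r) + 4 * (ENNReal.ofReal e * d) := by rw [mul_assoc (4 : ℝ≥0∞)]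
      _ ≤ (c + 4) * (m + r) + (c + 4) * (ENNReal.ofReal e * d) := by
          gcongr
          · exact le_self_add
          · exact le_add_self
      _ = _ := by rw [mul_add (ENNReal.ofReal e), ← hr]; ring

end

section

/-! ### Iterated convolutions and integrals over the simplex -/

variable {N n : ℕ}

theorem append_cast_eq {α : Type*} {ℓ m n : ℕ} (h : n = ℓ + m) (a : Fin ℓ → α) (b : Fin m → α)
    (i : Fin n) : Fin.append a b (Fin.cast h i)
      = if hi : (i : ℕ) < ℓ then a ⟨i, hi⟩ else b ⟨i - ℓ, by omega⟩ := by
  split_ifs with hi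
  · have e : Fin.cast h i = Fin.castAdd m ⟨i, hi⟩ := Fin.ext rfl
    rw [e, Fin.append_left]
  · have e : Fin.cast h i = Fin.natAdd ℓ ⟨i - ℓ, by omega⟩ := Fin.ext (by simp; omega)
    rw [e, Fin.append_right]

theorem sum_fin_succ {β M : Type*} [Fintype β] [AddCommMonoid M] {k : ℕ}
    (g : (Fin (k + 1) → β) → M) : ∑ z, g z = ∑ z₀, ∑ z : Fin k → β, g (Fin.cons z₀ z) := by
  rw [← (Fin.consEquiv fun _ : Fin (k + 1) => β).sum_comp, Fintype.sum_prod_type]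
  rfl

/-- Convolutions in different variables compose: this links the one-variable-at-a-time recursion
with the simultaneous convolution F_ℓ. -/
theorem convFirst_cons (ε : ℝ) (K : Torus N → ℝ) (ℓ : ℕ) (hℓ : ℓ ≤ n) (F : TimeSpaceKernel N (n + 1))
    (s : ℝ) (z : Torus N) (r : Fin n → ℝ) (z' : Fin n → Torus N) :
    convFirst ε K ℓ hℓ (freezeFirst (convHead ε K F) s z) r z'
      = convFirst ε K (ℓ + 1) (Nat.succ_le_succ hℓ) F (Fin.cons s r) (Fin.cons z z') := by
  unfold convFirst
  rw [sum_fin_succ, Finset.sum_comm]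
  refine Finset.sum_congr rfl fun y _ => ?_
  rw [freezeFirst_convHead]
  simp only [Finset.mul_sum, Finset.sum_mul]
  refine Finset.sum_congr rfl fun y₀ _ => ?_
  have e : (fun i : Fin (n + 1) => if h : (i : ℕ) < ℓ + 1 then
        (Fin.cons y₀ y : Fin (ℓ + 1) → Torus N) ⟨i, h⟩ else (Fin.cons z z' : Fin (n + 1) → Torus N) i)
      = Fin.cons y₀ fun i : Fin n => if h : (i : ℕ) < ℓ then y ⟨i, h⟩ else z' i := by
    funext i
    cases i using Fin.cases with
    | zero => rfl
    | succ i =>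
      simp only [Fin.val_succ, Nat.succ_lt_succ_iff, Fin.cons_succ]
      split_ifs with h
      · rfl
      · rfl
  rw [e, Fin.prod_univ_succ]
  have e2 : ∀ i : Fin ℓ, Fin.castLE (Nat.succ_le_succ hℓ) i.succ = (Fin.castLE hℓ i).succ :=
    fun i => rfl
  have e3 : Fin.castLE (Nat.succ_le_succ hℓ) (0 : Fin (ℓ + 1)) = 0 := rfl
  simp only [e2, e3, Fin.cons_succ, Fin.cons_zero, freezeFirst]
  ring

/-- Transport between the propositionally equal orders n - k and n + 1 - (k + 1). -/
theorem iteratedIntegral_cast (ε : ℝ) (M : ℝ → Torus N → ℝ) {m m' : ℕ} (h : m' = m)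
    (G : TimeSpaceKernel N m) (t : ℝ) : iteratedIntegral ε M m G t
      = iteratedIntegral ε M m' (fun r y => G (fun i => r (Fin.cast h.symm i))
        fun i => y (Fin.cast h.symm i)) t := by
  subst h
  rfl

theorem iteratedIntegral_freezeMany_cons (ε : ℝ) (M : ℝ → Torus N → ℝ) {k : ℕ} (hk : k ≤ n)
    {G : TimeSpaceKernel N n} {H : TimeSpaceKernel N (n + 1)} (s : ℝ) (z : Torus N)
    (hGH : ∀ r y, G r y = H (Fin.cons s r) (Fin.cons z y)) (r : Fin k → ℝ) (y : Fin k → Torus N)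
    (t : ℝ) : iteratedIntegral ε M (n - k) (freezeMany k hk G r y) t
      = iteratedIntegral ε M (n + 1 - (k + 1)) (freezeMany (k + 1) (Nat.succ_le_succ hk) H
        (Fin.cons s r) (Fin.cons z y)) t := by
  rw [iteratedIntegral_cast ε M (Nat.succ_sub_succ n k).symm.symm]
  congr 1
  funext rs ys
  simp only [freezeMany, hGH]
  have key : ∀ {α : Type} (s : α) (r : Fin k → α) (rs : Fin (n + 1 - (k + 1)) → α),
      (Fin.cons s fun i : Fin n => Fin.append r (fun i => rs (Fin.cast (Nat.succ_sub_succ n k).symm i))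
        (Fin.cast (Nat.add_sub_cancel' hk).symm i) : Fin (n + 1) → α)
      = fun i => Fin.append (Fin.cons s r : Fin (k + 1) → α) rs
        (Fin.cast (Nat.add_sub_cancel' (Nat.succ_le_succ hk)).symm i) := by
    intro α s r rs
    funext i
    rw [append_cast_eq]
    cases i using Fin.cases with
    | zero => rfl
    | succ i =>
      rw [Fin.cons_succ, append_cast_eq]
      by_cases hi : (i : ℕ) < k
      · rw [dif_pos hi, dif_pos (by simpa using hi)]
        rfl
      · rw [dif_neg hi, dif_neg (by simpa using hi)]
        congr 1
        exact Fin.ext (by simp)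
  rw [key, key]

theorem simplexIntegral_mono {k : ℕ} {t : ℝ} {G H : (Fin k → ℝ) → ℝ≥0∞} (h : ∀ r, G r ≤ H r) :
    simplexIntegral k t G ≤ simplexIntegral k t H := by
  induction k generalizing t with
  | zero => exact h _
  | succ k ih => exact lintegral_mono fun s => ih fun r => h _

/-- The lower integral is superadditive without any measurability, and this is the direction needed
to merge the recursive integrals into one over the simplex. -/
theorem sum_mul_lintegral_le {α ι : Type*} [MeasurableSpace α] (μ : Measure α) (s : Finset ι)
    (c : ι → ℝ≥0∞) (g : ι → α → ℝ≥0∞) :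
    ∑ i ∈ s, c i * ∫⁻ x, g i x ∂μ ≤ ∫⁻ x, ∑ i ∈ s, c i * g i x ∂μ := by
  classical
  induction s using Finset.induction with
  | empty => simp
  | insert i s hi ih =>
    simp only [Finset.sum_insert hi]
    exact (add_le_add (lintegral_const_mul_le _ _) ih).trans (le_lintegral_add _ _)

theorem sum_mul_simplexIntegral_le {ι : Type*} (s : Finset ι) (c : ι → ℝ≥0∞) {k : ℕ} (t : ℝ)
    (G : ι → (Fin k → ℝ) → ℝ≥0∞) : ∑ i ∈ s, c i * simplexIntegral k t (G i)
      ≤ simplexIntegral k t fun r => ∑ i ∈ s, c i * G i r := by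
  induction k generalizing t with
  | zero => exact le_rfl
  | succ k ih =>
    exact (sum_mul_lintegral_le _ s c _).trans (lintegral_mono fun r => ih r _)

theorem mainRec_le (ε : ℝ) (K : Torus N → ℝ) (F : TimeSpaceKernel N n) (t : ℝ) :
    mainRec ε K n F t ≤ simplexIntegral n t fun r => ENNReal.ofReal
      (∑ z : Fin n → Torus N, ε ^ (2 * n) * convFirst ε K n le_rfl F r z ^ 2) := by
  induction n generalizing t with
  | zero =>
    refine ENNReal.ofReal_le_ofReal (le_of_eq ?_)
    simp only [convFirst, Fintype.sum_unique, mul_zero, pow_zero, one_mul, Finset.univ_eq_empty,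
      Finset.prod_empty, mul_one]
    congr 2
  | succ n ih =>
    refine lintegral_mono fun s => ?_
    refine (Finset.sum_le_sum fun z _ => mul_le_mul_right (ih _ s) _).trans
      ((sum_mul_simplexIntegral_le _ _ _ _).trans (simplexIntegral_mono fun r => le_of_eq ?_))
    have hn : ∀ z, 0 ≤ ∑ z' : Fin n → Torus N, ε ^ (2 * n) *
        convFirst ε K n le_rfl (freezeFirst (convHead ε K F) s z) r z' ^ 2 := fun z =>
      Finset.sum_nonneg fun z' _ => by rw [pow_mul]; positivity
    simp_rw [← ENNReal.ofReal_mul (sq_nonneg ε)]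
    rw [← ENNReal.ofReal_sum_of_nonneg fun z _ => mul_nonneg (sq_nonneg ε) (hn z)]
    congr 1
    rw [sum_fin_succ]
    refine Finset.sum_congr rfl fun z _ => ?_
    rw [Finset.mul_sum]
    refine Finset.sum_congr rfl fun z' _ => ?_
    rw [convFirst_cons]
    ring

/-- The contribution of the jumps of the `(k + 1)`-st integral from the outside. -/
noncomputable def errTerm {Ω : Type*} [MeasurableSpace Ω] (P : Measure Ω) (ε p : ℝ)
    (M : Ω → ℝ → Torus N → ℝ) (K : Torus N → ℝ) (n k : ℕ) (hk : k < n) (F : TimeSpaceKernel N n)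
    (t : ℝ) : ℝ≥0∞ :=
  simplexIntegral k t fun r => ∑ z : Fin k → Torus N, ENNReal.ofReal (ε ^ (2 * k)) *
    (∫⁻ ω, ⨆ s ∈ Icc 0 (lastTime t r), ⨆ x : Torus N,
      ‖iteratedIntegral ε (M ω) (n - (k + 1)) (freezeMany (k + 1) hk (convFirst ε K (k + 1) hk F)
        (Fin.snoc (α := fun _ => ℝ) r s) (Fin.snoc (α := fun _ => Torus N) z x)) s‖ₑ ^ p ∂P) ^ (2 / p)

theorem lastTime_cons {k : ℕ} (t s : ℝ) (r : Fin k → ℝ) :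
    lastTime t (Fin.cons s r : Fin (k + 1) → ℝ) = lastTime s r := rfl

/-- For k = 0, a supremum over rational proportions of t is bounded by the one over [0,t]; for
larger k, sums move inside the simplex integral by superadditivity. -/
theorem errRec_le {Ω : Type*} [MeasurableSpace Ω] (P : Measure Ω) (ε : ℝ) {p : ℝ} (hp : 0 < p)
    (M : Ω → ℝ → Torus N → ℝ) (K : Torus N → ℝ) {k : ℕ} (hk : k < n) (F : TimeSpaceKernel N n)
    {t : ℝ} (ht : 0 ≤ t) : errRec P ε p M K n k F t ≤ errTerm P ε p M K n k hk F t := by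
  have hτ : 0 ≤ 2 / p := by positivity
  induction k generalizing n t with
  | zero =>
    obtain ⟨n, rfl⟩ : ∃ m, n = m + 1 := ⟨n - 1, by omega⟩
    simp only [errRec, errTerm, simplexIntegral, Fintype.sum_unique, mul_zero, pow_zero,
      ENNReal.ofReal_one, one_mul, diagMoment]
    refine ENNReal.rpow_le_rpow (lintegral_mono fun ω => iSup_le fun q => iSup_le fun x => ?_) hτ
    have hq : max 0 (min (q : ℝ) 1) * t ∈ Icc 0 (lastTime t Fin.elim0) := by
      refine ⟨mul_nonneg (le_max_left _ _) ht, ?_⟩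
      exact mul_le_of_le_one_left ht (max_le zero_le_one (min_le_right _ _))
    refine le_iSup₂_of_le _ hq (le_iSup_of_le x (le_of_eq ?_))
    congr 2
    rw [diagIntegral]
    have h0 : ∀ (s : ℝ) (x : Torus N), freezeFirst (convHead ε K F) s x
        = freezeMany 0 (Nat.zero_le n) (freezeFirst (convHead ε K F) s x) Fin.elim0 Fin.elim0 := by
      intro s x
      funext rs ys
      simp only [freezeMany]
      congr 1
      · funext i; rw [append_cast_eq]; rfl
      · funext i; rw [append_cast_eq]; rfl
    rw [h0]
    refine (iteratedIntegral_freezeMany_cons ε (M ω) (Nat.zero_le n)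
      (max 0 (min (q : ℝ) 1) * t) x
      (H := convFirst ε K 1 hk F) (fun r y => ?_) _ _ _).trans ?_
    · have := convFirst_cons ε K 0 (Nat.zero_le n) F (max 0 (min (q : ℝ) 1) * t) x r y
      rw [← this]
      simp only [convFirst, Fintype.sum_unique, mul_zero, pow_zero, one_mul, Finset.univ_eq_empty,
        Finset.prod_empty, mul_one]
      rfl
    · congr 2
      · funext i; fin_cases i; rfl
      · funext i; fin_cases i; rfl
  | succ k ih =>
    obtain ⟨n, rfl⟩ : ∃ m, n = m + 1 := ⟨n - 1, by omega⟩
    have hk' : k < n := by omega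
    refine setLIntegral_mono' measurableSet_Ioc fun s hs => ?_
    refine (Finset.sum_le_sum fun z _ => mul_le_mul_right (ih hk' _ hs.1.le) _).trans
      ((sum_mul_simplexIntegral_le _ _ _ _).trans (simplexIntegral_mono fun r => le_of_eq ?_))
    beta_reduce
    rw [sum_fin_succ]
    refine Finset.sum_congr rfl fun z _ => ?_
    rw [Finset.mul_sum]
    refine Finset.sum_congr rfl fun z' _ => ?_
    rw [← mul_assoc, ← ENNReal.ofReal_mul (sq_nonneg ε), ← pow_add, lastTime_cons]
    congr 2
    · congr 1
      ring
    refine lintegral_congr fun ω => iSup_congr fun s' => iSup_congr fun _ => iSup_congr fun x => ?_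
    rw [iteratedIntegral_freezeMany_cons ε (M ω) hk' s z (H := convFirst ε K (k + 2) hk F)
      (fun r y => convFirst_cons ε K (k + 1) hk' F s z r y)]
    rw [Fin.cons_snoc_eq_snoc_cons, Fin.cons_snoc_eq_snoc_cons]

end

/-! ### The rescaled Glauber dynamics -/

theorem past_mono {Ω : Type*} {N : ℕ} (σ : ℝ → Ω → Config N) : Monotone (past σ) := fun _ _ hst =>
  biSup_mono fun _ hu => ⟨hu.1, hu.2.trans hst⟩

theorem gibbs_pos {N : ℕ} (β : ℝ) (κ : Torus N → ℝ) (η : Config N) : 0 < gibbs β κ η :=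
  div_pos (Real.exp_pos _) (Finset.sum_pos (fun _ _ => Real.exp_pos _) Finset.univ_nonempty)

/-- A rate is a quotient x/(y + x) of positive weights; the bound by 1 is what makes a = α⁻¹
admissible. -/
theorem rate_mem_Icc {N : ℕ} (β : ℝ) (κ : Torus N → ℝ) (η : Config N) (j : Torus N) :
    rate β κ η j ∈ Icc (0 : ℝ) 1 := by
  have h1 := gibbs_pos β κ η
  have h2 := gibbs_pos β κ (flip η j)
  exact ⟨by unfold rate; positivity, (div_le_one (by positivity)).2 (by linarith)⟩

theorem abs_spin {N : ℕ} (η : Config N) (j : Torus N) : |spin η j| = 1 := by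
  rcases Int.units_eq_one_or (η j) with h | h <;> simp [spin, h]

theorem localField_flip_sub {N : ℕ} (κ : Torus N → ℝ) (η : Config N) (j y : Torus N) :
    localField κ (flip η j) y - localField κ η y = κ (y - j) * (-2 * spin η j) := by
  unfold localField
  rw [← Finset.sum_sub_distrib, Finset.sum_eq_single j]
  · simp only [spin, flip, Function.update_self, Units.val_neg, Int.cast_neg]
    ring
  · intro i _ hi
    simp [spin, flip, Function.update_of_ne hi]
  · exact fun h => absurd (Finset.mem_univ j) h

section

variable (𝔎 : EuclideanSpace ℝ (Fin 2) → ℝ) (γ β : ℝ)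

/-- The generator of the Glauber dynamics on the macroscopic time scale. -/
noncomputable def macroGenerator :
    (Config (sysSize γ) → ℝ) →L[ℝ] (Config (sysSize γ) → ℝ) :=
  (alpha γ)⁻¹ • LinearMap.toContinuousLinearMap (generator β (kac 𝔎 γ (sysSize γ)))

/-- The rescaled local fields. -/
noncomputable def macroField (y : Torus (sysSize γ)) (η : Config (sysSize γ)) : ℝ :=
  (delta γ)⁻¹ * localField (kac 𝔎 γ (sysSize γ)) η y

variable {γ}

/-- Running the process at time t/α multiplies the generator by α⁻¹, and the substitution s ↦ s/α in
the compensator produces the same factor. -/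
theorem macroMartingale_eq (hγ : 0 < γ) {Ω : Type*} (σ : ℝ → Ω → Config (sysSize γ)) (ω : Ω) :
    macroMartingale 𝔎 γ β (fun s => σ s ω)
      = dynkinFamily (macroGenerator 𝔎 γ β) (macroField 𝔎 γ) (fun s => σ (s / alpha γ)) ω := by
  funext t y
  have hα : alpha γ ≠ 0 := by unfold alpha; positivity
  simp only [dynkinFamily, dynkin, macroMartingale, microMartingale, macroField, zero_div]
  have e : ∀ s, macroGenerator 𝔎 γ β
        (fun η => (delta γ)⁻¹ * localField (kac 𝔎 γ (sysSize γ)) η y) (σ (s / alpha γ) ω)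
      = (alpha γ)⁻¹ * ((delta γ)⁻¹ * generator β (kac 𝔎 γ (sysSize γ))
        (fun η => localField (kac 𝔎 γ (sysSize γ)) η y) (σ (s / alpha γ) ω)) := fun s => by
    have h := (generator β (kac 𝔎 γ (sysSize γ))).map_smul (delta γ)⁻¹
      (fun η => localField (kac 𝔎 γ (sysSize γ)) η y)
    have h' := congrFun h (σ (s / alpha γ) ω)
    simp only [Pi.smul_apply, smul_eq_mul] at h'
    rw [← h']
    rfl
  change _ = _ - _ - ∫ s in (0 : ℝ)..t, macroGenerator 𝔎 γ β
        (fun η => (delta γ)⁻¹ * localField (kac 𝔎 γ (sysSize γ)) η y) (σ (s / alpha γ) ω)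
  simp_rw [e]
  rw [intervalIntegral.integral_const_mul, intervalIntegral.integral_const_mul,
    intervalIntegral.integral_comp_div (fun s => generator β (kac 𝔎 γ (sysSize γ))
        (fun η => localField (kac 𝔎 γ (sysSize γ)) η y) (σ s ω)) hα, zero_div, smul_eq_mul]
  field_simp

theorem eps_pos : 0 < eps γ := by unfold eps; positivity

/-- A flip at j changes the local field at y by -2σ(j)κ(y - j), where κ = ε²K. Summed against
ε²g(y)δ⁻¹, this is 2δ⁻¹ε² times the convolution at j, up to a sign. The generator then sums over j
with weights at most α⁻¹. -/
theorem jumpBound_macro (hγ : 0 < γ) : JumpBound (macroGenerator 𝔎 γ β) (macroField 𝔎 γ) (eps γ)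
    (Kg 𝔎 γ) (alpha γ)⁻¹ (2 * (delta γ)⁻¹ * eps γ ^ 2) := by
  intro q hq g η
  have hα : 0 < alpha γ := by unfold alpha; positivity
  have hδ : 0 < delta γ := hγ
  have hε := eps_pos (γ := γ)
  set φ := jumpPow (macroField 𝔎 γ) q (fun y => eps γ ^ 2 * g y) η with hφ
  have e : macroGenerator 𝔎 γ β φ η = (alpha γ)⁻¹ *
      ∑ j, rate β (kac 𝔎 γ (sysSize γ)) η j * (φ (flip η j) - φ η) := rfl
  rw [e]
  refine mul_le_mul_of_nonneg_left (Finset.sum_le_sum fun j _ => ?_) (inv_nonneg.2 hα.le)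
  have h0 : φ η = 0 := jumpPow_self _ (by linarith) _ _
  have h1 : ∑ y, eps γ ^ 2 * g y * (macroField 𝔎 γ y (flip η j) - macroField 𝔎 γ y η)
      = -spin η j * (2 * (delta γ)⁻¹ * eps γ ^ 2 * conv (eps γ) (Kg 𝔎 γ) g j) := by
    rw [conv, Finset.mul_sum, Finset.mul_sum]
    refine Finset.sum_congr rfl fun y _ => ?_
    have h2 : kac 𝔎 γ (sysSize γ) (y - j) = eps γ ^ 2 * Kg 𝔎 γ (y - j) := by
      rw [Kg, mul_inv_cancel_left₀ (by positivity)]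
    simp only [macroField, ← mul_sub, localField_flip_sub, h2]
    ring
  have h3 : φ (flip η j) = |2 * (delta γ)⁻¹ * eps γ ^ 2 * conv (eps γ) (Kg 𝔎 γ) g j| ^ q := by
    rw [hφ, jumpPow, h1, abs_mul, abs_neg, abs_spin, one_mul]
  rw [h0, sub_zero, h3]
  exact mul_le_of_le_one_left (Real.rpow_nonneg (abs_nonneg _) _) (rate_mem_Icc _ _ _ _).2

/-- From N + 1 > γ⁻² and γ² < 1/9 follows 2N + 1 > (17/9)γ⁻², hence ε ≤ (18/17)γ²; the square of
18/17 is below 2. -/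
theorem eps_sq_le (hγ : 0 < γ) (hγ' : γ < 1 / 3) : eps γ ^ 2 ≤ 2 * γ ^ 4 := by
  have h1 : (γ ^ 2)⁻¹ < sysSize γ + 1 := Nat.lt_floor_add_one _
  have h2 : 0 < γ ^ 2 := by positivity
  have h3 : 1 < (sysSize γ + 1) * γ ^ 2 := by
    rwa [inv_lt_iff_one_lt_mul₀ h2] at h1
  have h4 : γ ^ 2 < 1 / 9 := by nlinarith
  have h5 : eps γ ≤ 18 / 17 * γ ^ 2 := by
    rw [eps, div_le_iff₀ (by positivity)]
    nlinarith
  have h6 := eps_pos (γ := γ)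
  nlinarith

/-- The time change carries over to filtration and semigroup alike: the exponential of (t/α)L is
that of t times the accelerated generator. -/
theorem IsGlauberDynamics.isMarkovJump (hγ : 0 < γ) {Ω : Type*} [mΩ : MeasurableSpace Ω]
    {P : Measure Ω} {σ : ℝ → Ω → Config (sysSize γ)}
    (hσ : IsGlauberDynamics P β (kac 𝔎 γ (sysSize γ)) σ) :
    IsMarkovJump P (macroGenerator 𝔎 γ β) (fun s => past σ (s / alpha γ))
      (fun s => σ (s / alpha γ)) := by
  have hα : 0 < alpha γ := by unfold alpha; positivity
  have hdiv : ∀ t, Tendsto (fun s => s / alpha γ) (𝓝 t) (𝓝 (t / alpha γ)) := fun t =>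
    (continuous_id.div_const _).tendsto t
  refine ⟨fun s t hst => past_mono σ (div_le_div_of_nonneg_right hst hα.le), fun t => ?_,
    fun t ht f => ?_, fun ω => ⟨fun t ht => ?_, fun t ht => ?_⟩, fun s t hs ht f => ?_⟩
  · refine iSup₂_le fun s hs => ?_
    rw [← measurable_iff_comap_le]
    exact @measurable_to_countable' _ _ ⊤ _ _ _ fun η => hσ.measurable s hs.1 η
  · have h1 : MeasurableSpace.comap (σ (t / alpha γ)) ⊤ ≤ past σ (t / alpha γ) :=
      le_iSup₂_of_le (t / alpha γ) ⟨div_nonneg ht hα.le, le_rfl⟩ le_rfl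
    have h2 : Measurable[MeasurableSpace.comap (σ (t / alpha γ)) ⊤]
        fun ω => f (σ (t / alpha γ) ω) := fun s _ => ⟨f ⁻¹' s, trivial, rfl⟩
    exact h2.mono h1 le_rfl
  · refine (tendsto_nhdsWithin_iff.2 ⟨(hdiv t).mono_left nhdsWithin_le_nhds, ?_⟩).eventually
      (hσ.right_continuous ω (t / alpha γ) (div_nonneg ht hα.le))
    filter_upwards [self_mem_nhdsWithin] with s hs
    exact div_lt_div_of_pos_right hs hα
  · obtain ⟨η, hη⟩ := hσ.left_limits ω (t / alpha γ) (div_pos ht hα)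
    refine ⟨η, (tendsto_nhdsWithin_iff.2 ⟨(hdiv t).mono_left nhdsWithin_le_nhds, ?_⟩).eventually hη⟩
    filter_upwards [self_mem_nhdsWithin] with s hs
    exact div_lt_div_of_pos_right hs hα
  · have h := hσ.markov (s / alpha γ) (t / alpha γ) (div_nonneg hs hα.le) (div_nonneg ht hα.le) f
    have e : semigroup β (kac 𝔎 γ (sysSize γ)) (t / alpha γ)
        = NormedSpace.exp (t • macroGenerator 𝔎 γ β) := by
      rw [semigroup, macroGenerator, smul_smul, div_eq_mul_inv]
    rw [e] at h
    simpa only [add_div] using h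

end

end IsingKac

/-! ### Scaling constants and conclusion -/

theorem lemma4p1 (n : ℕ) (hn : 1 ≤ n) (p : ℝ) (hp : 2 ≤ p) :
    ∃ C : ℝ≥0, ∀ (𝔎 : EuclideanSpace ℝ (Fin 2) → ℝ), IsingKac.IsProfile 𝔎 →
      ∀ (γ : ℝ), 0 < γ → γ < 1 / 3 → ∀ (β : ℝ)
        (Ω : Type*) [MeasurableSpace Ω] (P : Measure Ω) [IsProbabilityMeasure P]
        (σ : ℝ → Ω → IsingKac.Config (IsingKac.sysSize γ)),
      IsingKac.IsGlauberDynamics P β (IsingKac.kac 𝔎 γ (IsingKac.sysSize γ)) σ →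
      ∀ (F : IsingKac.TimeSpaceKernel (IsingKac.sysSize γ) n),
        IsingKac.LeftContinuousInTimes F → IsingKac.LocallyBounded F →
      ∀ (t : ℝ), 0 ≤ t →
        (∫⁻ ω, ⨆ r ∈ Icc 0 t, ‖IsingKac.itInt 𝔎 γ β σ n F r ω‖ₑ ^ p ∂P) ^ (2 / p)
          ≤ C * IsingKac.mainTerm 𝔎 γ n F t
            + C * ENNReal.ofReal (IsingKac.eps γ ^ 4 * (IsingKac.delta γ ^ 2)⁻¹)
              * IsingKac.errorSum P 𝔎 γ β σ p n F t := by
  refine ⟨IsingKac.momentConst p n, fun 𝔎 _ γ hγ hγ' β Ω _ P _ σ hσ F hF₁ hF₂ t ht => ?_⟩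
  have hε := IsingKac.eps_pos (γ := γ)
  have hε2 := IsingKac.eps_sq_le hγ hγ'
  have hα : 0 < IsingKac.alpha γ := by unfold IsingKac.alpha; positivity
  have hδ : 0 < IsingKac.delta γ := hγ
  -- The left side is 4ε⁴/γ⁴, and ε² ≤ 2γ⁴ trades two powers of ε for γ⁴: the intensity of the noise
  -- is of the order of the lattice weight ε².
  have hab : (IsingKac.alpha γ)⁻¹ * (2 * (IsingKac.delta γ)⁻¹ * IsingKac.eps γ ^ 2) ^ 2
      ≤ 8 * IsingKac.eps γ ^ 2 := by
    have e : (IsingKac.alpha γ)⁻¹ * (2 * (IsingKac.delta γ)⁻¹ * IsingKac.eps γ ^ 2) ^ 2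
        = 4 * IsingKac.eps γ ^ 2 * IsingKac.eps γ ^ 2 / γ ^ 4 := by
      simp only [IsingKac.alpha, IsingKac.delta]
      field_simp
      norm_num
    rw [e, div_le_iff₀ (by positivity)]
    nlinarith [sq_nonneg (IsingKac.eps γ)]
  -- The squared jump size is the prefactor ε⁴δ⁻² of the error term, up to the factor 4.
  have hbe : (2 * (IsingKac.delta γ)⁻¹ * IsingKac.eps γ ^ 2) ^ 2
      ≤ 4 * (IsingKac.eps γ ^ 4 * (IsingKac.delta γ ^ 2)⁻¹) := le_of_eq (by
    rw [mul_pow, mul_pow, inv_pow]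
    ring)
  have hM := fun ω => IsingKac.macroMartingale_eq 𝔎 β hγ σ ω
  have main := (hσ.isMarkovJump 𝔎 β hγ).supMoment_le (IsingKac.jumpBound_macro 𝔎 β hγ)
    (inv_nonneg.2 hα.le) (by positivity) hab hbe hp (F := F) ⟨hF₁, hF₂⟩ ht
  simp only [IsingKac.itInt, IsingKac.errorSum, hM]
  refine main.trans ?_
  rw [mul_add, ← mul_assoc]
  refine add_le_add (mul_le_mul_right (IsingKac.mainRec_le _ _ _ _) _)
    (mul_le_mul_right ?_ _)
  rw [Finset.sum_range]
  exact Finset.sum_le_sum fun k _ => IsingKac.errRec_le P _ (by linarith) _ _ k.isLt F ht
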